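/- A graph sequence $(G,\tau)$ consists of a finite simple graph $G=(V,E)$ with $V=\{1,\dots,n\}$ and a map $\tau$ that assigns to every edge $e\in E$ a non-empty set $\tau(e)\subseteq\mathcal T=\{1,\dots,t_{\max}\}$ of time stamps, where $t_{\max}\ge 1$. For $F\subseteq E$ put $\tau(F)=\bigcap_{e\in F}\tau(e)$, with $\tau(\emptyset)=\mathcal T$; $F$ is active if $\tau(F)\ne\emptyset$. A clique is the edge set of a complete subgraph of $G$ (the empty edge set is a clique); an active clique $K$ is closed if no clique $K'\supsetneq K$ satisfies $\tau(K')=\tau(K)$. The interval assumption says that every $\tau(e)$ is an interval $\{s,s+1,\dots,s+\ell\}$ with $\ell\ge 0$. Lemma. Under the interval assumption, all closed active cliques can be enumerated in $O(|V||E|^3)$ time for each. That is: there are a single random access machine program and a constant $C$ such that, for every graph sequence satisfying the interval assumption, given as $n$, $|E|$, $t_{\max}$ and a list of the edges in any order, each with its two end vertices and the two ends of its interval, the program halts having output every closed active clique exactly once (as a list of its edges), after at most $C\cdot\max(1,|V||E|^3)\cdot N$ steps in total, where $N$ is the number of closed active cliques. Here every elementary operation on a machine word (addition, subtraction, multiplication,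 comparison, memory access, output) costs one step, and the words have $O(\log(|V|+|E|+t_{\max}+2))$ bits. -/

import Mathlib

/-! ### Graph sequences and closed active cliques -/

/-- A graph sequence `(G, τ)` on the vertex set `{1, …, n}` (vertex number `v + 1` is `v : Fin n`)
with ground set of time stamps `{1, …, tmax}`.  Only the values of `τ` on the edges of `G` are ever
used, and every edge is active at some time stamp. -/
structure GraphSequence (n tmax : ℕ) where
  graph : SimpleGraph (Fin n)
  τ : Sym2 (Fin n) → Finset ℕ
  τ_subset : ∀ e ∈ graph.edgeSet, τ e ⊆ Finset.Icc 1 tmax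
  τ_nonempty : ∀ e ∈ graph.edgeSet, (τ e).Nonempty

namespace GraphSequence

variable {n tmax : ℕ}

/-- The number of edges of the underlying graph. -/
noncomputable def numEdges (S : GraphSequence n tmax) : ℕ := S.graph.edgeSet.ncard

/-- The interval assumption: the active time stamp set of every edge is a single interval. -/
def IntervalAssumption (S : GraphSequence n tmax) : Prop :=
  ∀ e ∈ S.graph.edgeSet, ∃ a b : ℕ, a ≤ b ∧ S.τ e = Finset.Icc a b

/-- The active time stamp set of an edge set: the intersection of the active time stamp sets of its
members, and the whole ground set for the empty edge set. -/
def activeSet (S : GraphSequence n tmax) (F : Finset (Sym2 (Fin n))) : Finset ℕ :=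
  (Finset.Icc 1 tmax).filter fun t => ∀ e ∈ F, t ∈ S.τ e

/-- A clique, given by its edge set: the set of all edges inside a vertex set whose members are
pairwise adjacent.  The empty edge set is a clique. -/
def IsCliqueEdgeSet (S : GraphSequence n tmax) (K : Finset (Sym2 (Fin n))) : Prop :=
  ∃ U : Set (Fin n), S.graph.IsClique U ∧
    ∀ e, e ∈ K ↔ e ∈ S.graph.edgeSet ∧ ∀ v ∈ e, v ∈ U

/-- An active clique that is properly contained in no clique with the same active time stamp
set. -/
def IsClosedActiveClique (S : GraphSequence n tmax) (K : Finset (Sym2 (Fin n))) : Prop :=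
  S.IsCliqueEdgeSet K ∧ (S.activeSet K).Nonempty ∧
    ∀ K', S.IsCliqueEdgeSet K' → K ⊂ K' → S.activeSet K ≠ S.activeSet K'

/-- The number of closed active cliques. -/
noncomputable def numClosedActiveCliques (S : GraphSequence n tmax) : ℕ :=
  {K | S.IsClosedActiveClique K}.ncard

end GraphSequence

/-! ### A word RAM

Programs are finite texts over finitely many integer variables and arrays, with unit cost for every
elementary operation.  A run with word bound `W` may only handle numbers below `W`. -/

namespace WordRAM

/-- A configuration: the contents of the variables and arrays, and the words written so far. -/
structure Config where
  var : ℕ → ℕ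
  arr : ℕ → ℕ → ℕ
  out : List ℕ

/-- Expressions; `load a i` is the content of cell `i` of array number `a`. -/
inductive Expr where
  | const (k : ℕ)
  | var (x : ℕ)
  | load (a : ℕ) (i : Expr)
  | add (e f : Expr)
  | sub (e f : Expr)
  | mul (e f : Expr)

namespace Expr

/-- The value of an expression (subtraction is truncated). -/
def eval (σ : Config) : Expr → ℕ
  | const k => k
  | var x => σ.var x
  | load a i => σ.arr a (i.eval σ)
  | add e f => e.eval σ + f.eval σ
  | sub e f => e.eval σ - f.eval σ
  | mul e f => e.eval σ * f.eval σ

/-- The number of elementary operations needed to evaluate an expression. -/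
def cost : Expr → ℕ
  | const _ => 1
  | var _ => 1
  | load _ i => i.cost + 1
  | add e f => e.cost + f.cost + 1
  | sub e f => e.cost + f.cost + 1
  | mul e f => e.cost + f.cost + 1

/-- All values that occur in the evaluation are below `W`. -/
def Fits (W : ℕ) (σ : Config) : Expr → Prop
  | const k => k < W
  | var x => σ.var x < W
  | load a i => i.Fits W σ ∧ σ.arr a (i.eval σ) < W
  | add e f => e.Fits W σ ∧ f.Fits W σ ∧ e.eval σ + f.eval σ < W
  | sub e f => e.Fits W σ ∧ f.Fits W σ
  | mul e f => e.Fits W σ ∧ f.Fits W σ ∧ e.eval σ * f.eval σ < W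

end Expr

/-- Tests. -/
inductive Test where
  | lt (e f : Expr)
  | eq (e f : Expr)
  | neg (b : Test)

namespace Test

def Holds (σ : Config) : Test → Prop
  | lt e f => e.eval σ < f.eval σ
  | eq e f => e.eval σ = f.eval σ
  | neg b => ¬ b.Holds σ

def cost : Test → ℕ
  | lt e f => e.cost + f.cost + 1
  | eq e f => e.cost + f.cost + 1
  | neg b => b.cost + 1

def Fits (W : ℕ) (σ : Config) : Test → Prop
  | lt e f => e.Fits W σ ∧ f.Fits W σ
  | eq e f => e.Fits W σ ∧ f.Fits W σ
  | neg b => b.Fits W σ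

end Test

/-- Programs. `set x e` assigns to a variable, `store a i e` writes into cell `i` of array number
`a`, `emit e` appends a word to the output, and `loop b p` repeats `p` while `b` holds. -/
inductive Program where
  | nop
  | set (x : ℕ) (e : Expr)
  | store (a : ℕ) (i e : Expr)
  | emit (e : Expr)
  | seq (p q : Program)
  | cond (b : Test) (p q : Program)
  | loop (b : Test) (p : Program)

/-- `Exec W p σ t σ'`: started in `σ`, the program `p` halts in `σ'` after exactly `t` elementary
steps, and all numbers handled during the run are below `W`. -/
inductive Exec (W : ℕ) : Program → Config → ℕ → Config → Prop where
  | nop (σ : Config) : Exec W .nop σ 1 σ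
  | set (x : ℕ) (e : Expr) (σ : Config) (he : e.Fits W σ) :
      Exec W (.set x e) σ (e.cost + 1) { σ with var := Function.update σ.var x (e.eval σ) }
  | store (a : ℕ) (i e : Expr) (σ : Config) (hi : i.Fits W σ) (he : e.Fits W σ) :
      Exec W (.store a i e) σ (i.cost + e.cost + 1)
        { σ with
          arr := Function.update σ.arr a (Function.update (σ.arr a) (i.eval σ) (e.eval σ)) }
  | emit (e : Expr) (σ : Config) (he : e.Fits W σ) :
      Exec W (.emit e) σ (e.cost + 1) { σ with out := σ.out ++ [e.eval σ] }
  | seq {p q : Program} {σ σ' σ'' : Config} {t t' : ℕ} (hp : Exec W p σ t σ')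
      (hq : Exec W q σ' t' σ'') : Exec W (.seq p q) σ (t + t') σ''
  | condTrue {b : Test} {p q : Program} {σ σ' : Config} {t : ℕ} (hf : b.Fits W σ)
      (hb : b.Holds σ) (hp : Exec W p σ t σ') : Exec W (.cond b p q) σ (b.cost + 1 + t) σ'
  | condFalse {b : Test} {p q : Program} {σ σ' : Config} {t : ℕ} (hf : b.Fits W σ)
      (hb : ¬ b.Holds σ) (hq : Exec W q σ t σ') : Exec W (.cond b p q) σ (b.cost + 1 + t) σ'
  | loopDone {b : Test} {p : Program} {σ : Config} (hf : b.Fits W σ) (hb : ¬ b.Holds σ) :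
      Exec W (.loop b p) σ (b.cost + 1) σ
  | loopStep {b : Test} {p : Program} {σ σ' σ'' : Config} {t t' : ℕ} (hf : b.Fits W σ)
      (hb : b.Holds σ) (hp : Exec W p σ t σ') (hl : Exec W (.loop b p) σ' t' σ'') :
      Exec W (.loop b p) σ (b.cost + 1 + t + t') σ''

end WordRAM

/-! ### Input and output formats -/

namespace GraphSequence

variable {n tmax : ℕ}

/-- `es` lists every edge of the graph exactly once, each with its end vertices in either order. -/
def IsEdgeList (S : GraphSequence n tmax) (es : List (Fin n × Fin n)) : Prop :=
  (es.map fun p => s(p.1, p.2)).Nodup ∧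
    ∀ e, e ∈ es.map (fun p => s(p.1, p.2)) ↔ e ∈ S.graph.edgeSet

/-- The array `f (es 0), f (es 1), …`, followed by zeros. -/
def column (es : List (Fin n × Fin n)) (f : Fin n × Fin n → ℕ) (i : ℕ) : ℕ :=
  (es[i]?.map f).getD 0

/-- The initial configuration.  Variables 0, 1, 2 hold the number of vertices, the number of edges
and `tmax`; arrays 0, 1 hold the end vertices of the listed edges, and arrays 2, 3 hold the first
and the last time stamp of their active time stamp sets.  Everything else is zero. -/
noncomputable def inputConfig (S : GraphSequence n tmax) (es : List (Fin n × Fin n)) :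
    WordRAM.Config where
  var x := match x with
    | 0 => n
    | 1 => es.length
    | 2 => tmax
    | _ => 0
  arr a := match a with
    | 0 => column es fun p => p.1.val + 1
    | 1 => column es fun p => p.2.val + 1
    | 2 => column es fun p => sInf (S.τ s(p.1, p.2) : Set ℕ)
    | 3 => column es fun p => sSup (S.τ s(p.1, p.2) : Set ℕ)
    | _ => fun _ => 0
  out := []

/-- The output words for one edge set: the end vertices of the listed edges, then a zero. -/
def encodeEdges (r : List (Fin n × Fin n)) : List ℕ :=
  r.flatMap (fun p => [p.1.val + 1, p.2.val + 1]) ++ [0]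

/-- The output `out` lists every closed active clique exactly once, and each of them by a list of
its edges without repetitions. -/
def OutputCorrect (S : GraphSequence n tmax) (out : List ℕ) : Prop :=
  ∃ L : List (List (Fin n × Fin n)),
    out = L.flatMap encodeEdges ∧
    (∀ r ∈ L, (r.map fun p => s(p.1, p.2)).Nodup) ∧
    (L.map fun r => (r.map fun p => s(p.1, p.2)).toFinset).Nodup ∧
    ∀ K, K ∈ (L.map fun r => (r.map fun p => s(p.1, p.2)).toFinset) ↔ S.IsClosedActiveClique K

end GraphSequence

/-! Under the interval assumption the time set of a non-empty active edge set runs from the largest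
first stamp to the smallest last stamp of its members. Hence a non-empty closed active clique has
the time set `[s i, t j]` for two of its own edges `i` and `j`. For `a ≤ b` let `G[a,b]` be the
graph of the edges whose interval contains `[a,b]`, on the end vertices of these edges only.

Two facts connect closed cliques with these graphs. A non-empty closed active clique `K` with time
set `[a,b]` spans a maximal clique of `G[a,b]`, because a further vertex joined there to all of `K`
could be added without shrinking the time set (`Models.exists_out`). Conversely, for `1 ≤ a ≤ b ≤
tmax`, the edges of every maximal clique of `G[a,b]` form a closed active clique, even if its time
set is larger than `[a,b]` (`Models.isClosedActiveClique`). Since `G[a,b]` has no isolated vertices,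
a maximal clique is determined by its edges (`IsMaxClique.mem_iff`). So each `G[a,b]` has at most
`N` maximal cliques (`Models.length_le`), where `N` is the number of closed active cliques, and
listing all of them is affordable even if few are printed.

The program treats all pairs `(i, j)` of edges, lists the maximal cliques of `G[s i, t j]`, and
prints one only if `i` is its last edge with first stamp `s i` and `j` its last edge with last stamp
`t j`. With this tie-break every non-empty closed clique is printed for exactly one pair
(`Out.left_eq`). The empty clique is never printed for a pair; it is closed exactly if no edge is
active at all times (`isClosedActiveClique_empty_iff`).

It remains to list the maximal cliques of a graph with `ν` vertices and `μ` arcs in time `O(ν(μ +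
ν))` for each. The vertices are added one at a time, and the maximal cliques of the successive
induced graphs form a tree. If the new vertex `i` is adjacent to all of `C`, then `C` has the only
child `C ∪ {i}`. Otherwise `C` stays maximal, and `(C ∩ N(i)) ∪ {i}` is a second child provided that
it is maximal and that `C` is the lexicographically first maximal clique containing `C ∩ N(i)`; the
last condition makes parents unique. The leaves are therefore the maximal cliques without repetition
(`leaves_spec`), and since no node is a dead end (`leaves_ne_nil`), a depth-first search spends at
most `ν` steps of cost `O(μ + ν)` between two leaves. Without isolated vertices `ν ≤ μ ≤ 2|E|`, so a
clique costs `O(|V||E|)` and all `|E|²` pairs together `O(|V||E|³ N)`.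

The running time and the word bound of the concrete program are verified with a small program logic
for total correctness (`Runs.of_wp`, `Runs.loop`, `Runs.forTo`) and a syntactic frame rule
(`Exec.same`). -/

namespace WordRAM

/-! ### A program logic for the word RAM -/

namespace Config

/-- Assignment to a variable. -/
def setVar (σ : Config) (x v : ℕ) : Config :=
  { σ with var := Function.update σ.var x v }

/-- Assignment to an array cell. -/
def setArr (σ : Config) (a i v : ℕ) : Config :=
  { σ with arr := Function.update σ.arr a (Function.update (σ.arr a) i v) }

/-- Output of a word. -/
def write (σ : Config) (v : ℕ) : Config :=
  { σ with out := σ.out ++ [v] }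

@[simp] theorem setVar_var (σ : Config) (x v y : ℕ) :
    (σ.setVar x v).var y = if y = x then v else σ.var y := by
  simp [setVar, Function.update_apply]

@[simp] theorem setVar_arr (σ : Config) (x v : ℕ) : (σ.setVar x v).arr = σ.arr := rfl

@[simp] theorem setVar_out (σ : Config) (x v : ℕ) : (σ.setVar x v).out = σ.out := rfl

@[simp] theorem setArr_var (σ : Config) (a i v : ℕ) : (σ.setArr a i v).var = σ.var := rfl

@[simp] theorem setArr_arr (σ : Config) (a i v b : ℕ) :
    (σ.setArr a i v).arr b = if b = a then Function.update (σ.arr a) i v else σ.arr b := by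
  simp only [setArr, Function.update_apply]

@[simp] theorem setArr_out (σ : Config) (a i v : ℕ) : (σ.setArr a i v).out = σ.out := rfl

@[simp] theorem write_var (σ : Config) (v : ℕ) : (σ.write v).var = σ.var := rfl

@[simp] theorem write_arr (σ : Config) (v : ℕ) : (σ.write v).arr = σ.arr := rfl

@[simp] theorem write_out (σ : Config) (v : ℕ) : (σ.write v).out = σ.out ++ [v] := rfl

end Config

namespace Program

/-- Whether a program contains an assignment to the variable `y`. -/
def wv : Program → ℕ → Bool
  | nop, _ => false
  | set x _, y => y == x
  | store _ _ _, _ => false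
  | emit _, _ => false
  | seq p q, y => p.wv y || q.wv y
  | cond _ p q, y => p.wv y || q.wv y
  | loop _ p, y => p.wv y

/-- Whether a program contains an assignment to a cell of array `y`. -/
def wa : Program → ℕ → Bool
  | nop, _ => false
  | set _ _, _ => false
  | store a _ _, y => y == a
  | emit _, _ => false
  | seq p q, y => p.wa y || q.wa y
  | cond _ p q, y => p.wa y || q.wa y
  | loop _ p, y => p.wa y

/-- Whether a program contains an output instruction. -/
def em : Program → Bool
  | nop => false
  | set _ _ => false
  | store _ _ _ => false
  | emit _ => true
  | seq p q => p.em || q.em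
  | cond _ p q => p.em || q.em
  | loop _ p => p.em

/-- The weakest precondition of a loop-free program. -/
def wp (W : ℕ) : Program → Config → (Config → Prop) → Prop
  | nop, σ, Q => Q σ
  | set x e, σ, Q => e.Fits W σ ∧ Q (σ.setVar x (e.eval σ))
  | store a i e, σ, Q => i.Fits W σ ∧ e.Fits W σ ∧ Q (σ.setArr a (i.eval σ) (e.eval σ))
  | emit e, σ, Q => e.Fits W σ ∧ Q (σ.write (e.eval σ))
  | seq p q, σ, Q => p.wp W σ fun σ' => q.wp W σ' Q
  | cond b p q, σ, Q => b.Fits W σ ∧ (b.Holds σ → p.wp W σ Q) ∧ (¬ b.Holds σ → q.wp W σ Q)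
  | loop _ _, _, _ => False

/-- An upper bound on the number of steps of a loop-free program. -/
def scost : Program → ℕ
  | nop => 1
  | set _ e => e.cost + 1
  | store _ i e => i.cost + e.cost + 1
  | emit e => e.cost + 1
  | seq p q => p.scost + q.scost
  | cond b p q => b.cost + 1 + max p.scost q.scost
  | loop _ _ => 0

/-- `forTo x b p` runs `p` with the variable `x` ranging over the numbers below the value of the
variable `b`. -/
def forTo (x b : ℕ) (p : Program) : Program :=
  .seq (.set x (.const 0))
    (.loop (.lt (.var x) (.var b)) (.seq p (.set x (.add (.var x) (.const 1)))))

end Program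

/-- `σ'` differs from `σ` only in places that `p` may modify. -/
structure Same (p : Program) (σ σ' : Config) : Prop where
  var : ∀ y, p.wv y = false → σ'.var y = σ.var y
  arr : ∀ a, p.wa a = false → σ'.arr a = σ.arr a
  out : p.em = false → σ'.out = σ.out

theorem Same.rfl {p : Program} {σ : Config} : Same p σ σ := ⟨fun _ _ => .refl _, fun _ _ => .refl _, fun _ => .refl _⟩

theorem Same.trans {p : Program} {σ σ' σ'' : Config} (h : Same p σ σ') (h' : Same p σ' σ'') :
    Same p σ σ'' :=
  ⟨fun y hy => (h'.var y hy).trans (h.var y hy), fun y hy => (h'.arr y hy).trans (h.arr y hy),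
    fun hy => (h'.out hy).trans (h.out hy)⟩

/-- The frame rule. The functions `wv`, `wa` and `em` are computed from the program text, so that
later on `rfl` or `decide` shows which places are untouched, and loop invariants need to mention
only what changes. -/
theorem Exec.same {W : ℕ} {p : Program} {σ σ' : Config} {t : ℕ} (h : Exec W p σ t σ') :
    Same p σ σ' := by
  induction h with
  | nop σ => exact Same.rfl
  | set x e σ he =>
    refine ⟨fun y hy => ?_, fun _ _ => rfl, fun _ => rfl⟩
    have : y ≠ x := by simpa [Program.wv] using hy
    simp [Function.update_of_ne this]
  | store a i e σ hi he =>
    refine ⟨fun _ _ => rfl, fun y hy => ?_, fun _ => rfl⟩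
    have : y ≠ a := by simpa [Program.wa] using hy
    simp [Function.update_of_ne this]
  | emit e σ he => exact ⟨fun _ _ => rfl, fun _ _ => rfl, fun h => by simp [Program.em] at h⟩
  | seq hp hq ihp ihq =>
    refine ⟨fun y hy => ?_, fun y hy => ?_, fun hy => ?_⟩
    · simp only [Program.wv, Bool.or_eq_false_iff] at hy
      rw [ihq.var y hy.2, ihp.var y hy.1]
    · simp only [Program.wa, Bool.or_eq_false_iff] at hy
      rw [ihq.arr y hy.2, ihp.arr y hy.1]
    · simp only [Program.em, Bool.or_eq_false_iff] at hy
      rw [ihq.out hy.2, ihp.out hy.1]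
  | condTrue hf hb hp ih =>
    refine ⟨fun y hy => ?_, fun y hy => ?_, fun hy => ?_⟩
    · simp only [Program.wv, Bool.or_eq_false_iff] at hy
      exact ih.var y hy.1
    · simp only [Program.wa, Bool.or_eq_false_iff] at hy
      exact ih.arr y hy.1
    · simp only [Program.em, Bool.or_eq_false_iff] at hy
      exact ih.out hy.1
  | condFalse hf hb hp ih =>
    refine ⟨fun y hy => ?_, fun y hy => ?_, fun hy => ?_⟩
    · simp only [Program.wv, Bool.or_eq_false_iff] at hy
      exact ih.var y hy.2
    · simp only [Program.wa, Bool.or_eq_false_iff] at hy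
      exact ih.arr y hy.2
    · simp only [Program.em, Bool.or_eq_false_iff] at hy
      exact ih.out hy.2
  | loopDone hf hb => exact Same.rfl
  | loopStep hf hb hp hl ihp ihl =>
    exact Same.trans ⟨ihp.var, ihp.arr, ihp.out⟩ ihl

/-- From `σ`, the program `p` halts within `T` steps in a configuration that satisfies `Q`. -/
def Runs (W : ℕ) (p : Program) (σ : Config) (T : ℕ) (Q : Config → Prop) : Prop :=
  ∃ t σ', Exec W p σ t σ' ∧ t ≤ T ∧ Q σ'

namespace Runs

variable {W : ℕ} {p q : Program} {b : Test} {σ : Config} {T T' : ℕ} {Q Q' : Config → Prop}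

theorem mono (h : Runs W p σ T Q) (hT : T ≤ T') (hQ : ∀ σ', Q σ' → Q' σ') :
    Runs W p σ T' Q' := by
  obtain ⟨t, σ', he, ht, hq⟩ := h
  exact ⟨t, σ', he, ht.trans hT, hQ _ hq⟩

theorem withSame (h : Runs W p σ T Q) : Runs W p σ T fun σ' => Q σ' ∧ Same p σ σ' := by
  obtain ⟨t, σ', he, ht, hq⟩ := h
  exact ⟨t, σ', he, ht, hq, he.same⟩

theorem seq (h : Runs W p σ T fun σ' => Runs W q σ' T' Q) : Runs W (.seq p q) σ (T + T') Q := by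
  obtain ⟨t, σ', he, ht, t', σ'', he', ht', hq⟩ := h
  exact ⟨t + t', σ'', he.seq he', by omega, hq⟩

/-- Sequential composition with the frame of the first program. -/
theorem seqSame (h : Runs W p σ T Q') (h' : ∀ σ', Q' σ' → Same p σ σ' → Runs W q σ' T' Q) :
    Runs W (.seq p q) σ (T + T') Q :=
  seq (h.withSame.mono le_rfl fun σ' hσ => h' σ' hσ.1 hσ.2)

theorem cond (hf : b.Fits W σ) (hp : b.Holds σ → Runs W p σ T Q)
    (hq : ¬ b.Holds σ → Runs W q σ T Q) : Runs W (.cond b p q) σ (b.cost + 1 + T) Q := by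
  by_cases hb : b.Holds σ
  · obtain ⟨t, σ', he, ht, h⟩ := hp hb
    exact ⟨_, σ', .condTrue hf hb he, by omega, h⟩
  · obtain ⟨t, σ', he, ht, h⟩ := hq hb
    exact ⟨_, σ', .condFalse hf hb he, by omega, h⟩

/-- Reduces a loop-free body to symbolic evaluation: unfolding `wp` leaves arithmetic side
conditions. A loop has the precondition `False`, so the value of `scost` on loops is irrelevant. -/
theorem of_wp (h : p.wp W σ Q) : Runs W p σ p.scost Q := by
  induction p generalizing σ Q with
  | nop => exact ⟨_, _, .nop σ, le_rfl, h⟩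
  | set x e => exact ⟨_, _, .set x e σ h.1, le_rfl, h.2⟩
  | store a i e => exact ⟨_, _, .store a i e σ h.1 h.2.1, le_rfl, h.2.2⟩
  | emit e => exact ⟨_, _, .emit e σ h.1, le_rfl, h.2⟩
  | seq p q ihp ihq => exact seq ((ihp h).mono le_rfl fun σ' h' => ihq h')
  | cond b p q ihp ihq =>
    exact cond h.1 (fun hb => (ihp (h.2.1 hb)).mono (le_max_left _ _) fun _ => id)
      (fun hb => (ihq (h.2.2 hb)).mono (le_max_right _ _) fun _ => id)
  | loop b p => exact h.elim

/-- A loop with a known number of rounds. -/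
theorem loop {I : ℕ → Config → Prop} (hf : ∀ k σ, I k σ → b.Fits W σ)
    (h0 : ∀ σ, I 0 σ → ¬ b.Holds σ)
    (hs : ∀ k σ, I (k + 1) σ → b.Holds σ ∧ Runs W p σ T (I k)) {k : ℕ} (h : I k σ) :
    Runs W (.loop b p) σ (k * (T + b.cost + 1) + b.cost + 1) (I 0) := by
  induction k generalizing σ with
  | zero => exact ⟨_, σ, .loopDone (hf _ _ h) (h0 _ h), by omega, h⟩
  | succ k ih =>
    obtain ⟨hb, t, σ', he, ht, h'⟩ := hs k σ h
    obtain ⟨t', σ'', he', ht', h''⟩ := ih h'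
    refine ⟨_, σ'', .loopStep (hf _ _ h) hb he he', ?_, h''⟩
    rw [Nat.add_mul]
    omega

/-- A loop over an initial segment of the natural numbers. -/
theorem forTo {x nb B : ℕ} {I : ℕ → Config → Prop} (hW : B < W) (hW1 : 1 < W)
    (hB : σ.var nb = B) (hx : p.wv x = false) (hn : p.wv nb = false) (hne : nb ≠ x)
    (h0 : I 0 (σ.setVar x 0))
    (hs : ∀ k < B, ∀ σ', Same (.forTo x nb p) σ σ' → σ'.var x = k → I k σ' →
      Runs W p σ' T fun σ'' => I (k + 1) (σ''.setVar x (k + 1))) :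
    Runs W (.forTo x nb p) σ (B * (T + 8) + 6)
      fun σ' => I B σ' ∧ Same (.forTo x nb p) σ σ' := by
  refine Runs.withSame ?_
  have hwx : (Program.forTo x nb p).wv nb = false := by
    simp [Program.forTo, Program.wv, hn, hne]
  -- `Runs.loop` counts the rounds that are left, so the counter `k` is traded for `r = B - k`. A
  -- round costs `T` for the body, 4 for the increment and 4 for the test; the final 6 pays for the
  -- failing test and the initialisation.
  let J : ℕ → Config → Prop := fun r σ' =>
    ∃ k, k + r = B ∧ σ'.var x = k ∧ Same (.forTo x nb p) σ σ' ∧ I k σ'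
  have key : ∀ σ', J B σ' → Runs W
      (.loop (.lt (.var x) (.var nb)) (.seq p (.set x (.add (.var x) (.const 1))))) σ'
      (B * ((T + 4) + 3 + 1) + 3 + 1) (J 0) := by
    intro σ' h
    refine Runs.loop (b := .lt (.var x) (.var nb)) (I := J) (T := T + 4) ?_ ?_ ?_ h
    · rintro r τ ⟨k, hk, hx, hsame, -⟩
      have := hsame.var nb hwx
      simp only [Test.Fits, Expr.Fits]
      omega
    · rintro τ ⟨k, hk, hx, hsame, -⟩
      have := hsame.var nb hwx
      simp only [Test.Holds, Expr.eval]
      omega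
    · rintro r τ ⟨k, hk, hxk, hsame, hI⟩
      have := hsame.var nb hwx
      refine ⟨by simp only [Test.Holds, Expr.eval]; omega, ?_⟩
      refine Runs.seqSame (hs k (by omega) τ hsame hxk hI) fun τ' hI' hsame' => ?_
      have hx' := hsame'.var x hx
      refine Runs.mono (of_wp (p := .set x (.add (.var x) (.const 1))) (Q := J r) ?_) le_rfl
        fun _ => id
      refine ⟨by simp only [Expr.Fits, Expr.eval]; omega, k + 1, by omega, ?_, ?_, ?_⟩
      · simp [Expr.eval, hx', hxk]
      · refine hsame.trans ⟨fun y hy => ?_, fun y hy => ?_, fun hy => ?_⟩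
        · simp only [Program.forTo, Program.wv, Bool.or_eq_false_iff] at hy
          have : y ≠ x := by simpa using hy.1
          simp only [Config.setVar_var, if_neg this]
          exact hsame'.var y hy.2.1
        · simp only [Program.forTo, Program.wa, Bool.or_eq_false_iff] at hy
          exact hsame'.arr y hy.2.1
        · simp only [Program.forTo, Program.em, Bool.or_eq_false_iff] at hy
          exact hsame'.out hy.2.1
      · simpa [Expr.eval, hx', hxk] using hI'
  have := Runs.seq (T := 2) (Q := fun σ' => I B σ') (p := .set x (.const 0)) (σ := σ)
    ((of_wp (p := .set x (.const 0)) (Q := J B) ?_).mono (T' := 2) le_rfl fun σ' h' =>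
      (key σ' h').mono le_rfl ?_)
  · refine this.mono ?_ fun _ => id
    have e : T + 4 + 3 + 1 = T + 8 := by omega
    rw [e]
    omega
  · refine ⟨by simp only [Expr.Fits]; omega, 0, by omega, by simp [Expr.eval], ?_, h0⟩
    refine ⟨fun y hy => ?_, fun _ _ => rfl, fun _ => rfl⟩
    simp only [Program.forTo, Program.wv, Bool.or_eq_false_iff] at hy
    have : y ≠ x := by simpa using hy.1
    simp [this]
  · rintro τ ⟨k, hk, -, -, hI⟩
    obtain rfl : k = B := by omega
    exact hI

end Runs

end WordRAM

/-! ### The tree of maximal cliques -/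

namespace CliqueTree

open Finset

variable (adj : ℕ → ℕ → Prop)

/-- `C` is a maximal clique of the graph induced by the vertices below `i`. -/
structure MaxClique (i : ℕ) (C : Finset ℕ) : Prop where
  lt : ∀ x ∈ C, x < i
  clique : ∀ x ∈ C, ∀ y ∈ C, x ≠ y → adj x y
  maximal : ∀ w < i, w ∉ C → ∃ x ∈ C, ¬ adj w x

open Classical in
/-- The members of `C` that are adjacent to `v`. -/
noncomputable def nbrs (C : Finset ℕ) (v : ℕ) : Finset ℕ := C.filter fun x => adj v x

/-- The clique `insert v (nbrs adj C v)` is maximal up to `v`, and `C` is the lexicographically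
first maximal clique below `v` that contains `nbrs adj C v`. -/
def Branches (C : Finset ℕ) (v : ℕ) : Prop :=
  ∀ w < v, w ∉ C → (∃ x ∈ insert v (nbrs adj C v), ¬ adj w x) ∧
    ∃ x ∈ nbrs adj C v ∪ C.filter (· < w), ¬ adj w x

open Classical in
/-- The maximal cliques below `i + r` that descend from the maximal clique `C` below `i`. -/
noncomputable def leaves : ℕ → ℕ → Finset ℕ → List (Finset ℕ)
  | 0, _, C => [C]
  | r + 1, i, C =>
    if nbrs adj C i = C then leaves r (i + 1) (insert i C)
    else leaves r (i + 1) C ++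
      if Branches adj C i then leaves r (i + 1) (insert i (nbrs adj C i)) else []

variable {adj}

theorem mem_nbrs {C : Finset ℕ} {v x : ℕ} : x ∈ nbrs adj C v ↔ x ∈ C ∧ adj v x := by
  simp [nbrs]

theorem nbrs_subset {C : Finset ℕ} {v : ℕ} : nbrs adj C v ⊆ C := fun _ h => (mem_nbrs.1 h).1

theorem maxClique_zero : MaxClique adj 0 ∅ := ⟨by simp, by simp, by simp⟩

theorem MaxClique.eq_of_subset {i : ℕ} {C C' : Finset ℕ} (h : MaxClique adj i C)
    (h' : MaxClique adj i C') (hs : C ⊆ C') : C = C' := by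
  refine hs.antisymm fun w hw => ?_
  by_contra hc
  obtain ⟨x, hx, hn⟩ := h.maximal w (h'.lt w hw) hc
  exact hn (h'.clique w hw x (hs hx) (by rintro rfl; exact hc hx))

variable (hs : ∀ x y, adj x y → adj y x)

include hs

theorem MaxClique.extend {i : ℕ} {C : Finset ℕ} (h : MaxClique adj i C) (hC : nbrs adj C i = C) :
    MaxClique adj (i + 1) (insert i C) := by
  have had : ∀ x ∈ C, adj i x := fun x hx => (mem_nbrs.1 (hC ▸ hx)).2
  refine ⟨fun x hx => ?_, fun x hx y hy hxy => ?_, fun w hw hwC => ?_⟩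
  · rcases mem_insert.1 hx with rfl | hx
    · omega
    · have := h.lt x hx
      omega
  · rcases mem_insert.1 hx with hx | hx <;> rcases mem_insert.1 hy with hy | hy
    · omega
    · exact hx ▸ had y hy
    · exact hy ▸ hs _ _ (had x hx)
    · exact h.clique x hx y hy hxy
  · rw [mem_insert, not_or] at hwC
    obtain ⟨x, hx, hn⟩ := h.maximal w (by omega) hwC.2
    exact ⟨x, mem_insert_of_mem hx, hn⟩

omit hs in
theorem MaxClique.keep {i : ℕ} {C : Finset ℕ} (h : MaxClique adj i C) (hC : nbrs adj C i ≠ C) :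
    MaxClique adj (i + 1) C := by
  refine ⟨fun x hx => (h.lt x hx).trans (by omega), h.clique, fun w hw hwC => ?_⟩
  rcases Nat.lt_succ_iff_lt_or_eq.1 hw with hw | rfl
  · exact h.maximal w hw hwC
  · by_contra! hc
    exact hC (nbrs_subset.antisymm fun x hx => mem_nbrs.2 ⟨hx, hc x hx⟩)

/-- A vertex outside `C` is excluded by the first half of `Branches`; a vertex of `C` that has been
dropped is not adjacent to `i`. -/
theorem MaxClique.branch {i : ℕ} {C : Finset ℕ} (h : MaxClique adj i C) (hB : Branches adj C i) :
    MaxClique adj (i + 1) (insert i (nbrs adj C i)) := by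
  refine ⟨fun x hx => ?_, fun x hx y hy hxy => ?_, fun w hw hwC => ?_⟩
  · rcases mem_insert.1 hx with rfl | hx
    · omega
    · have := h.lt x (nbrs_subset hx)
      omega
  · rcases mem_insert.1 hx with hx | hx <;> rcases mem_insert.1 hy with hy | hy
    · omega
    · exact hx ▸ (mem_nbrs.1 hy).2
    · exact hy ▸ hs _ _ (mem_nbrs.1 hx).2
    · exact h.clique x (nbrs_subset hx) y (nbrs_subset hy) hxy
  · rw [mem_insert, not_or] at hwC
    by_cases hw' : w ∈ C
    · exact ⟨i, mem_insert_self _ _, fun ha => hwC.2 (mem_nbrs.2 ⟨hw', hs _ _ ha⟩)⟩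
    · exact (hB w (by omega) hw').1

omit hs in
/-- Two maximal cliques with the same trace `D` that are both lexicographically first are equal. -/
theorem MaxClique.eq_of_first {i : ℕ} {C C' D : Finset ℕ} (h : MaxClique adj i C)
    (h' : MaxClique adj i C') (hD : D ⊆ C) (hD' : D ⊆ C')
    (hf : ∀ w < i, w ∉ C → ∃ x ∈ D ∪ C.filter (· < w), ¬ adj w x)
    (hf' : ∀ w < i, w ∉ C' → ∃ x ∈ D ∪ C'.filter (· < w), ¬ adj w x) : C = C' := by
  -- Strong induction: if `w` were in only one of the cliques, the obstruction that keeps it out of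
  -- the other would lie in `D` or in the part below `w`, where the cliques agree. It would then
  -- belong to the same clique as `w`, yet not be adjacent to `w`.
  have key : ∀ w, w ∈ C ↔ w ∈ C' := by
    intro w
    induction w using Nat.strong_induction_on with
    | _ w ih =>
      constructor
      · intro hw
        by_contra hc
        obtain ⟨x, hx, hn⟩ := hf' w (h.lt w hw) hc
        rcases mem_union.1 hx with hx | hx
        · exact hn (h.clique w hw x (hD hx) (by rintro rfl; exact hc (hD' hx)))
        · rw [mem_filter] at hx
          exact hn (h.clique w hw x ((ih x hx.2).2 hx.1) (by omega))
      · intro hw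
        by_contra hc
        obtain ⟨x, hx, hn⟩ := hf w (h'.lt w hw) hc
        rcases mem_union.1 hx with hx | hx
        · exact hn (h'.clique w hw x (hD' hx) (by rintro rfl; exact hc (hD hx)))
        · rw [mem_filter] at hx
          exact hn (h'.clique w hw x ((ih x hx.2).1 hx.1) (by omega))
  exact Finset.ext key

/-- Every clique has a lexicographically first completion. -/
theorem exists_first {i : ℕ} {D : Finset ℕ} (hlt : ∀ x ∈ D, x < i)
    (hD : ∀ x ∈ D, ∀ y ∈ D, x ≠ y → adj x y) :
    ∃ C, MaxClique adj i C ∧ D ⊆ C ∧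
      ∀ w < i, w ∉ C → ∃ x ∈ D ∪ C.filter (· < w), ¬ adj w x := by
  -- The greedy construction: scan the vertices upwards and add `k` if it is adjacent to all other
  -- current members.
  have key : ∀ k ≤ i, ∃ C : Finset ℕ, D ⊆ C ∧ (∀ x ∈ C, x < i) ∧ (∀ x ∈ C, x ∈ D ∨ x < k) ∧
      (∀ x ∈ C, ∀ y ∈ C, x ≠ y → adj x y) ∧
      ∀ w < k, w ∉ C → ∃ x ∈ D ∪ C.filter (· < w), ¬ adj w x := by
    intro k
    induction k with
    | zero => exact fun _ => ⟨D, Subset.rfl, hlt, fun x hx => .inl hx, hD, by simp⟩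
    | succ k ih =>
      intro hk
      obtain ⟨C, h1, h2, h3, h4, h5⟩ := ih (by omega)
      by_cases hc : ∀ x ∈ C, x ≠ k → adj k x
      · refine ⟨insert k C, h1.trans (subset_insert _ _), ?_, ?_, ?_, ?_⟩
        · intro x hx
          rcases mem_insert.1 hx with rfl | hx
          · omega
          · exact h2 x hx
        · intro x hx
          rcases mem_insert.1 hx with rfl | hx
          · right; omega
          · rcases h3 x hx with h | h
            · exact .inl h
            · right; omega
        · intro x hx y hy hxy
          rcases mem_insert.1 hx with hx | hx <;> rcases mem_insert.1 hy with hy | hy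
          · omega
          · exact hx ▸ hc y hy (by omega)
          · exact hy ▸ hs _ _ (hc x hx (by omega))
          · exact h4 x hx y hy hxy
        · intro w hw hwC
          rw [mem_insert, not_or] at hwC
          obtain ⟨x, hx, hn⟩ := h5 w (by omega) hwC.2
          refine ⟨x, ?_, hn⟩
          rw [mem_union, mem_filter] at hx ⊢
          exact hx.imp_right fun h => ⟨mem_insert_of_mem h.1, h.2⟩
      · push Not at hc
        obtain ⟨x, hx, hxk, hn⟩ := hc
        refine ⟨C, h1, h2, fun x hx => (h3 x hx).imp_right fun h => by omega, h4, ?_⟩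
        intro w hw hwC
        rcases Nat.lt_succ_iff_lt_or_eq.1 hw with hw | rfl
        · exact h5 w hw hwC
        · refine ⟨x, ?_, hn⟩
          rw [mem_union, mem_filter]
          exact (h3 x hx).imp_right fun h => ⟨hx, h⟩
  obtain ⟨C, h1, h2, -, h4, h5⟩ := key i le_rfl
  refine ⟨C, ⟨h2, h4, fun w hw hwC => ?_⟩, h1, h5⟩
  obtain ⟨x, hx, hn⟩ := h5 w hw hwC
  rw [mem_union, mem_filter] at hx
  exact ⟨x, hx.elim (fun h => h1 h) (·.1), hn⟩

/-- Every maximal clique below `i + 1` arises from a maximal clique below `i`. -/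
theorem exists_parent (hi : ∀ x, ¬ adj x x) {i : ℕ} {K : Finset ℕ} (h : MaxClique adj (i + 1) K) :
    ∃ C, MaxClique adj i C ∧
      ((nbrs adj C i = C ∧ K = insert i C) ∨
        (nbrs adj C i ≠ C ∧ (K = C ∨ (Branches adj C i ∧ K = insert i (nbrs adj C i))))) := by
  by_cases hiK : i ∈ K
  · have hadj : ∀ x ∈ K, x ≠ i → adj i x := fun x hx hxi => h.clique i hiK x hx (Ne.symm hxi)
    obtain ⟨C, hC, hDC, hf⟩ := exists_first hs (i := i) (D := K.erase i)
      (fun x hx => by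
        have h1 := h.lt x (mem_of_mem_erase hx)
        have h2 := ne_of_mem_erase hx
        omega)
      (fun x hx y hy => h.clique x (mem_of_mem_erase hx) y (mem_of_mem_erase hy))
    -- A further neighbour of `i` in the completion `C` would be adjacent to all of `K`, against the
    -- maximality of `K`. So `K` is recovered from its parent as the second child, or as the only
    -- one.
    have hn : nbrs adj C i = K.erase i := by
      ext x
      rw [mem_nbrs, mem_erase]
      constructor
      · rintro ⟨hxC, hxi⟩
        have hne : x ≠ i := by rintro rfl; exact hi _ hxi
        refine ⟨hne, ?_⟩
        by_contra hxK
        obtain ⟨y, hy, hny⟩ := h.maximal x ((hC.lt x hxC).trans (by omega)) hxK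
        by_cases hyi : y = i
        · exact hny (hyi ▸ hs _ _ hxi)
        · exact hny (hC.clique x hxC y (hDC (mem_erase.2 ⟨hyi, hy⟩)) (by rintro rfl; exact hxK hy))
      · rintro ⟨hxi, hxK⟩
        exact ⟨hDC (mem_erase.2 ⟨hxi, hxK⟩), hadj x hxK hxi⟩
    refine ⟨C, hC, ?_⟩
    have hK : K = insert i (nbrs adj C i) := by rw [hn, insert_erase hiK]
    by_cases hCC : nbrs adj C i = C
    · exact .inl ⟨hCC, by rw [hCC] at hK; exact hK⟩
    · refine .inr ⟨hCC, .inr ⟨fun w hw hwC => ⟨?_, hn ▸ hf w hw hwC⟩, hK⟩⟩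
      rw [← hK]
      exact h.maximal w (by omega) fun hwK => hwC (hDC (mem_erase.2 ⟨by omega, hwK⟩))
  · have hlt : ∀ x ∈ K, x < i := fun x hx => by
      have h1 := h.lt x hx
      have h2 : x ≠ i := by rintro rfl; exact hiK hx
      omega
    refine ⟨K, ⟨hlt, h.clique, fun w hw => h.maximal w (by omega)⟩, .inr ⟨?_, .inl rfl⟩⟩
    intro he
    obtain ⟨x, hx, hn⟩ := h.maximal i (by omega) hiK
    rw [← he] at hx
    exact hn (mem_nbrs.1 hx).2

/-- Three claims are carried through one induction on the height: the leaves below a node are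
distinct maximal cliques, different nodes of a level have disjoint sets of leaves, and every maximal
clique is a leaf below some node. Distinctness at one level needs disjointness at the next. -/
theorem leaves_spec (hi : ∀ x, ¬ adj x x) (r i : ℕ) :
    (∀ C, MaxClique adj i C → (leaves adj r i C).Nodup ∧
      ∀ K ∈ leaves adj r i C, MaxClique adj (i + r) K) ∧
    (∀ C C', MaxClique adj i C → MaxClique adj i C' → ∀ K, K ∈ leaves adj r i C →
      K ∈ leaves adj r i C' → C = C') ∧
    ∀ K, MaxClique adj (i + r) K → ∃ C, MaxClique adj i C ∧ K ∈ leaves adj r i C := by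
  induction r generalizing i with
  | zero =>
    refine ⟨fun C hC => ⟨by simp [leaves], fun K hK => ?_⟩, fun C C' _ _ K hK hK' => ?_,
      fun K hK => ⟨K, hK, by simp [leaves]⟩⟩
    · simp only [leaves, List.mem_singleton] at hK
      exact hK ▸ hC
    · simp only [leaves, List.mem_singleton] at hK hK'
      rw [← hK, hK']
  | succ r ih =>
    obtain ⟨ih1, ih2, ih3⟩ := ih (i + 1)
    have e : i + 1 + r = i + (r + 1) := by omega
    rw [e] at ih1 ih3
    -- the child of a node above a given leaf
    have child : ∀ C, MaxClique adj i C → ∀ K, K ∈ leaves adj (r + 1) i C ↔ ∃ C',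
        MaxClique adj (i + 1) C' ∧ K ∈ leaves adj r (i + 1) C' ∧
        ((nbrs adj C i = C ∧ C' = insert i C) ∨
        (nbrs adj C i ≠ C ∧ (C' = C ∨ (Branches adj C i ∧ C' = insert i (nbrs adj C i))))) := by
      intro C hC K
      rw [leaves]
      by_cases h : nbrs adj C i = C
      · rw [if_pos h]
        constructor
        · exact fun hK => ⟨_, hC.extend hs h, hK, .inl ⟨h, rfl⟩⟩
        · rintro ⟨C', -, hK, ⟨-, rfl⟩ | ⟨h', -⟩⟩
          · exact hK
          · exact absurd h h'
      · rw [if_neg h, List.mem_append]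
        constructor
        · rintro (hK | hK)
          · exact ⟨C, hC.keep h, hK, .inr ⟨h, .inl rfl⟩⟩
          · split_ifs at hK with hB
            · exact ⟨_, hC.branch hs hB, hK, .inr ⟨h, .inr ⟨hB, rfl⟩⟩⟩
            · simp at hK
        · rintro ⟨C', -, hK, ⟨h', -⟩ | ⟨-, rfl | ⟨hB, rfl⟩⟩⟩
          · exact absurd h' h
          · exact .inl hK
          · rw [if_pos hB]
            exact .inr hK
    refine ⟨fun C hC => ⟨?_, fun K hK => ?_⟩, fun C C' hC hC' K hK hK' => ?_, fun K hK => ?_⟩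
    · rw [leaves]
      split_ifs with h hB
      · exact (ih1 _ (hC.extend hs h)).1
      · refine List.nodup_append.2 ⟨(ih1 _ (hC.keep h)).1, (ih1 _ (hC.branch hs hB)).1, ?_⟩
        rintro K hK _ hK' rfl
        have := ih2 _ _ (hC.keep h) (hC.branch hs hB) _ hK hK'
        have hmem : i ∈ C := this ▸ mem_insert_self _ _
        exact lt_irrefl _ (hC.lt i hmem)
      · rw [List.append_nil]
        exact (ih1 _ (hC.keep h)).1
    · obtain ⟨C', hC', hK', -⟩ := (child C hC K).1 hK
      exact (ih1 C' hC').2 K hK'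
    · obtain ⟨A, hA, hKA, h⟩ := (child C hC K).1 hK
      obtain ⟨A', hA', hKA', h'⟩ := (child C' hC' K).1 hK'
      obtain rfl := ih2 _ _ hA hA' _ hKA hKA'
      have hiC : i ∉ C := fun h => lt_irrefl _ (hC.lt i h)
      have hiC' : i ∉ C' := fun h => lt_irrefl _ (hC'.lt i h)
      have hiN : i ∉ nbrs adj C i := fun h => hiC (nbrs_subset h)
      have hiN' : i ∉ nbrs adj C' i := fun h => hiC' (nbrs_subset h)
      have inj : ∀ {X Y : Finset ℕ}, i ∉ X → i ∉ Y → insert i X = insert i Y → X = Y :=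
        fun hX hY he => by rw [← erase_insert hX, he, erase_insert hY]
      -- Nine ways to be a child of both `C` and `C'`. Membership of `i` excludes four. If one is
      -- extended by `i` and the other branches, one parent contains the other, and maximality makes
      -- them equal. If both branch, both are the first completion of the same trace.
      rcases h with ⟨h, rfl⟩ | ⟨h, rfl | ⟨hB, rfl⟩⟩ <;>
        rcases h' with ⟨h', h''⟩ | ⟨h', h'' | ⟨hB', h''⟩⟩
      · exact inj hiC hiC' h''
      · exact absurd (h'' ▸ mem_insert_self _ _) hiC'
      · exact hC.eq_of_subset hC' ((inj hiC hiN' h'').subset.trans nbrs_subset)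
      · exact absurd (h'' ▸ mem_insert_self _ _) hiC
      · exact h''
      · exact absurd (h'' ▸ mem_insert_self _ _) hiC
      · exact (hC'.eq_of_subset hC ((inj hiN hiC' h'').symm.subset.trans nbrs_subset)).symm
      · exact absurd (h'' ▸ mem_insert_self _ _) hiC'
      · have e := inj hiN hiN' h''
        exact hC.eq_of_first hC' (D := nbrs adj C i) nbrs_subset (e ▸ nbrs_subset)
          (fun w hw hwC => (hB w hw hwC).2) (fun w hw hwC => e ▸ (hB' w hw hwC).2)
    · obtain ⟨A, hA, hKA⟩ := ih3 K hK
      obtain ⟨C, hC, h⟩ := exists_parent hs hi hA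
      exact ⟨C, hC, (child C hC K).2 ⟨A, hA, hKA, h⟩⟩

theorem nodup_leaves (hi : ∀ x, ¬ adj x x) (r : ℕ) : (leaves adj r 0 ∅).Nodup :=
  ((leaves_spec hs hi r 0).1 ∅ maxClique_zero).1

theorem mem_leaves (hi : ∀ x, ¬ adj x x) {r : ℕ} {K : Finset ℕ} :
    K ∈ leaves adj r 0 ∅ ↔ MaxClique adj r K := by
  obtain ⟨h1, -, h3⟩ := leaves_spec hs hi r 0
  rw [Nat.zero_add] at h1 h3
  refine ⟨fun h => (h1 ∅ maxClique_zero).2 K h, fun h => ?_⟩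
  obtain ⟨C, hC, hK⟩ := h3 K h
  rwa [hC.eq_of_subset maxClique_zero fun x hx => absurd (hC.lt x hx) (by omega)] at hK

omit hs

/-- Every node has a first child, so there are no dead ends. This is what allows the whole search to
be charged to the leaves. -/
theorem leaves_ne_nil (r i : ℕ) (C : Finset ℕ) : leaves adj r i C ≠ [] := by
  induction r generalizing i C with
  | zero => simp [leaves]
  | succ r ih =>
    rw [leaves]
    split_ifs <;> simp [ih]

end CliqueTree

namespace CliqueTree

open Finset

/-! ### Graphs given by lists of arcs -/

/-- The arcs `(P j, Q j)` with `j < μ` are the ordered pairs of adjacent vertices of a simple graph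
on the vertices below `ν`. -/
structure Arcs (ν μ : ℕ) (P Q : ℕ → ℕ) (adj : ℕ → ℕ → Prop) : Prop where
  lt : ∀ j < μ, P j < ν ∧ Q j < ν
  inj : ∀ j < μ, ∀ j' < μ, P j = P j' → Q j = Q j' → j = j'
  adj_iff : ∀ x y, adj x y ↔ ∃ j < μ, P j = x ∧ Q j = y
  symm : ∀ x y, adj x y → adj y x
  irrefl : ∀ x, ¬ adj x x

/-- The members of `S` that are reached from `w` by one of the first `k` arcs. -/
def arcNbrs (P Q : ℕ → ℕ) (k : ℕ) (S : Finset ℕ) (w : ℕ) : Finset ℕ :=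
  S.filter fun x => ∃ j < k, P j = w ∧ Q j = x

variable {ν μ : ℕ} {P Q : ℕ → ℕ} {adj : ℕ → ℕ → Prop}

theorem arcNbrs_zero (S : Finset ℕ) (w : ℕ) : arcNbrs P Q 0 S w = ∅ := by simp [arcNbrs]

theorem mem_arcNbrs_succ {k w x : ℕ} {S : Finset ℕ} :
    x ∈ arcNbrs P Q (k + 1) S w ↔ x ∈ arcNbrs P Q k S w ∨ (x ∈ S ∧ P k = w ∧ Q k = x) := by
  simp only [arcNbrs, mem_filter]
  constructor
  · rintro ⟨hx, j, hj, h⟩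
    rcases Nat.lt_succ_iff_lt_or_eq.1 hj with hj | rfl
    · exact .inl ⟨hx, j, hj, h⟩
    · exact .inr ⟨hx, h⟩
  · rintro (⟨hx, j, hj, h⟩ | ⟨hx, h⟩)
    · exact ⟨hx, j, hj.trans (by omega), h⟩
    · exact ⟨hx, k, by omega, h⟩

/-- Distinct arcs have distinct pairs of ends, so the next arc from `w` into `S` reaches a member
that has not been counted. Hence a counter that is incremented arc by arc holds a cardinality. -/
theorem Arcs.card_arcNbrs_succ (h : Arcs ν μ P Q adj) {k : ℕ} (hk : k < μ) (w : ℕ)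
    (S : Finset ℕ) : (arcNbrs P Q (k + 1) S w).card =
      (arcNbrs P Q k S w).card + if P k = w ∧ Q k ∈ S then 1 else 0 := by
  split_ifs with hc
  · have : arcNbrs P Q (k + 1) S w = insert (Q k) (arcNbrs P Q k S w) := by
      ext x
      rw [mem_arcNbrs_succ, mem_insert]
      constructor
      · rintro (h | h)
        · exact .inr h
        · exact .inl h.2.2.symm
      · rintro (rfl | h)
        · exact .inr ⟨hc.2, hc.1, rfl⟩
        · exact .inl h
    rw [this, card_insert_of_notMem]
    simp only [arcNbrs, mem_filter, not_and, not_exists]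
    rintro - j hj hP hQ
    exact hj.ne (h.inj j (hj.trans hk) k hk (hP.trans hc.1.symm) hQ)
  · congr 1
    ext x
    rw [mem_arcNbrs_succ]
    refine ⟨fun h => h.elim id fun h => absurd ⟨h.2.1, h.2.2 ▸ h.1⟩ hc, .inl⟩

theorem Arcs.card_arcNbrs_le (h : Arcs ν μ P Q adj) {k : ℕ} (hk : k ≤ μ) (w : ℕ)
    (S : Finset ℕ) : (arcNbrs P Q k S w).card ≤ k := by
  induction k with
  | zero => simp [arcNbrs_zero]
  | succ k ih =>
    have := h.card_arcNbrs_succ hk w S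
    have := ih (by omega)
    split_ifs at * <;> omega

/-- Turns adjacency to all of `S` into an equality of numbers, so that one pass over the arcs
prepares the test for all vertices `w` at once. -/
theorem Arcs.card_arcNbrs (h : Arcs ν μ P Q adj) (w : ℕ) (S : Finset ℕ) :
    (arcNbrs P Q μ S w).card = S.card ↔ ¬ ∃ x ∈ S, ¬ adj w x := by
  push Not
  simp only [h.adj_iff, arcNbrs]
  exact card_filter_eq_iff

theorem Arcs.arcNbrs_eq (h : Arcs ν μ P Q adj) (w : ℕ) (S : Finset ℕ) :
    arcNbrs P Q μ S w = nbrs adj S w := by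
  ext x
  simp [arcNbrs, mem_nbrs, h.adj_iff]

end CliqueTree

namespace CliqueTree

open Finset WordRAM WordRAM.Program WordRAM.Expr

/-! ### One step down the tree -/

infixr:60 " ;; " => WordRAM.Program.seq

/-- The cells of `f` below `ν` are the characteristic function of `C`. -/
structure Codes (ν : ℕ) (f : ℕ → ℕ) (C : Finset ℕ) : Prop where
  lt : ∀ x ∈ C, x < ν
  eq : ∀ x < ν, f x = if x ∈ C then 1 else 0

/-- The vertex numbers and arcs of the current graph are stored in variables 7 and 8 and in
arrays 5 and 6; the numbers that occur are below `W`. -/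
structure Stored (W ν μ : ℕ) (P Q : ℕ → ℕ) (σ : Config) : Prop where
  var7 : σ.var 7 = ν
  var8 : σ.var 8 = μ
  arr5 : σ.arr 5 = P
  arr6 : σ.arr 6 = Q
  bound : ν * ν + 2 * ν + 2 * μ + 4 ≤ W

theorem Stored.of_same {W ν μ : ℕ} {P Q : ℕ → ℕ} {p : Program} {σ σ' : Config}
    (h : Stored W ν μ P Q σ) (hs : Same p σ σ') (h7 : p.wv 7 = false) (h8 : p.wv 8 = false)
    (h5 : p.wa 5 = false) (h6 : p.wa 6 = false) : Stored W ν μ P Q σ' :=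
  ⟨(hs.var 7 h7).trans h.var7, (hs.var 8 h8).trans h.var8, (hs.arr 5 h5).trans h.arr5,
    (hs.arr 6 h6).trans h.arr6, h.bound⟩

/-- Prepare the keys and counters, and count the current clique. -/
def prepare : Program :=
  .set 11 (.const 0) ;; .set 12 (.const 0) ;; forTo 10 7 (
    .set 11 (.add (.var 11) (.load 8 (.var 10))) ;;
    .store 9 (.var 10) (.var 7) ;;
    .cond (.eq (.load 8 (.var 10)) (.const 0)) (.store 10 (.var 10) (.var 7))
      (.store 10 (.var 10) (.add (.var 10) (.const 1))) ;;
    .store 13 (.var 10) (.const 0) ;;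
    .store 14 (.var 10) (.const 0))

/-- Set the keys of the members of the current clique that are adjacent to the new vertex. -/
def markNbrs : Program :=
  forTo 10 8 (
    .cond (.eq (.load 5 (.var 10)) (.var 9))
      (.cond (.eq (.load 8 (.load 6 (.var 10))) (.const 1))
        (.set 12 (.add (.var 12) (.const 1)) ;;
          .store 9 (.load 6 (.var 10)) (.const 0) ;;
          .store 10 (.load 6 (.var 10)) (.const 0)) .nop) .nop)

/-- Count for every vertex its neighbours among the vertices given by the keys. -/
def countNbrs : Program :=
  forTo 10 8 (
    .cond (.eq (.load 9 (.load 6 (.var 10))) (.const 0))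
      (.store 13 (.load 5 (.var 10)) (.add (.load 13 (.load 5 (.var 10))) (.const 1))) .nop ;;
    .cond (.lt (.load 10 (.load 6 (.var 10))) (.add (.load 5 (.var 10)) (.const 1)))
      (.store 14 (.load 5 (.var 10)) (.add (.load 14 (.load 5 (.var 10))) (.const 1))) .nop)

/-- Decide from the counters whether the current clique branches. -/
def decideBranch : Program :=
  .set 13 (.const 1) ;; .set 14 (.var 12) ;; forTo 10 9 (
    .cond (.eq (.load 8 (.var 10)) (.const 0))
      (.cond (.eq (.load 13 (.var 10)) (.add (.var 12) (.const 1))) (.set 13 (.const 0)) .nop ;;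
        .cond (.eq (.load 14 (.var 10)) (.var 14)) (.set 13 (.const 0)) .nop)
      (.cond (.eq (.load 10 (.var 10)) (.const 0)) .nop (.set 14 (.add (.var 14) (.const 1)))))

/-- Save the second child. -/
def saveBranch : Program :=
  forTo 10 7 (
    .cond (.eq (.load 9 (.var 10)) (.const 0))
      (.store 11 (.add (.mul (.add (.var 9) (.const 1)) (.var 7)) (.var 10)) (.const 1))
      (.store 11 (.add (.mul (.add (.var 9) (.const 1)) (.var 7)) (.var 10)) (.const 0))) ;;
  .store 12 (.add (.var 9) (.const 1)) (.const 1)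

/-- Go from a maximal clique below the number in variable 9 to its first child, and save its second
child if there is one. -/
def step : Program :=
  prepare ;; markNbrs ;;
  .cond (.eq (.var 11) (.var 12)) (.store 8 (.var 9) (.const 1))
    (.store 9 (.var 9) (.const 0) ;; countNbrs ;; decideBranch ;;
      .cond (.eq (.var 13) (.const 1)) saveBranch .nop) ;;
  .set 9 (.add (.var 9) (.const 1))

variable {W ν μ : ℕ} {P Q : ℕ → ℕ} {adj : ℕ → ℕ → Prop} {σ : Config} {C D : Finset ℕ} {i : ℕ}

theorem runs_prepare (hS : Stored W ν μ P Q σ) (hC : Codes ν (σ.arr 8) C) :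
    Runs W prepare σ (2 + (2 + (ν * (30 + 8) + 6))) fun σ' =>
      σ'.var 11 = C.card ∧ σ'.var 12 = 0 ∧
      ∀ x < ν, σ'.arr 9 x = ν ∧ (σ'.arr 10 x = if x ∈ C then x + 1 else ν) ∧
        σ'.arr 13 x = 0 ∧ σ'.arr 14 x = 0 := by
  have hb := hS.bound
  have hν : ν ≤ ν * ν := Nat.le_mul_self ν
  have hcard : C.card ≤ ν := by
    simpa using card_le_card (fun x hx => mem_range.2 (hC.lt x hx) : C ⊆ range ν)
  refine Runs.seq (T := 2) (Runs.of_wp (p := .set 11 (.const 0)) ?_)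
  refine ⟨by simp only [Fits]; omega, ?_⟩
  refine Runs.seq (T := 2) (Runs.of_wp (p := .set 12 (.const 0)) ?_)
  refine ⟨by simp only [Fits]; omega, ?_⟩
  refine (Runs.forTo (B := ν) (T := 30) (I := fun k σ' => σ'.var 11 = #{x ∈ C | x < k} ∧
      σ'.var 12 = 0 ∧
      ∀ x < k, σ'.arr 9 x = ν ∧ (σ'.arr 10 x = if x ∈ C then x + 1 else ν) ∧
        σ'.arr 13 x = 0 ∧ σ'.arr 14 x = 0) (by omega) (by omega) (by simp [hS.var7])
        rfl rfl (by decide) ?_ ?_).mono le_rfl ?_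
  · simp [eval]
  · intro k hk σ' hs hx ⟨h11, h12, hI⟩
    have e7 := hs.var 7 rfl
    have e8 := hs.arr 8 rfl
    simp [eval, hS.var7] at e7 e8
    have hcode := hC.eq k hk
    have hle : #{x ∈ C | x < k} ≤ ν := (card_filter_le _ _).trans hcard
    have hsucc : #{x ∈ C | x < k + 1} = #{x ∈ C | x < k} + if k ∈ C then 1 else 0 := by
      split_ifs with hkC
      · rw [← card_insert_of_notMem (a := k) (by simp)]
        congr 1
        ext x
        simp only [mem_filter, mem_insert, Nat.lt_succ_iff_lt_or_eq]
        constructor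
        · rintro ⟨h, h' | h'⟩
          · exact .inr ⟨h, h'⟩
          · exact .inl h'
        · rintro (rfl | h)
          · exact ⟨hkC, .inr rfl⟩
          · exact ⟨h.1, .inl h.2⟩
      · congr 1
        ext x
        simp only [mem_filter, Nat.lt_succ_iff_lt_or_eq]
        refine ⟨fun h => ⟨h.1, h.2.resolve_right ?_⟩, fun h => ⟨h.1, .inl h.2⟩⟩
        rintro rfl
        exact hkC h.1
    refine (Runs.of_wp ?_).mono (by decide) fun _ => id
    by_cases hkC : k ∈ C
    · simp only [if_pos hkC] at hcode hsucc
      simp [-Order.lt_add_one_iff, and_assoc, wp, Fits, Test.Fits, Test.Holds, eval,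
        hx, e7, e8, hcode, h11, h12, hsucc]
      repeat (refine ⟨by omega, ?_⟩)
      intro x hx
      rcases Nat.lt_succ_iff_lt_or_eq.1 hx with hx | rfl
      · have := hI x hx
        simpa [Function.update_of_ne hx.ne] using this
      · simp [hkC]
    · simp only [if_neg hkC] at hcode hsucc
      simp [-Order.lt_add_one_iff, and_assoc, wp, Fits, Test.Fits, Test.Holds, eval,
        hx, e7, e8, hcode, h11, h12, hsucc]
      repeat (refine ⟨by omega, ?_⟩)
      intro x hx
      rcases Nat.lt_succ_iff_lt_or_eq.1 hx with hx | rfl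
      · have := hI x hx
        simpa [Function.update_of_ne hx.ne] using this
      · simp [hkC]
  · rintro σ' ⟨⟨h11, h12, hI⟩, -⟩
    refine ⟨?_, h12, hI⟩
    rw [h11, filter_true_of_mem hC.lt]

theorem runs_markNbrs (hA : Arcs ν μ P Q adj) (hS : Stored W ν μ P Q σ)
    (hC : Codes ν (σ.arr 8) C) (h9 : σ.var 9 = i) (hi : i < ν) (h12 : σ.var 12 = 0)
    (hk : ∀ x < ν, σ.arr 9 x = ν ∧ σ.arr 10 x = if x ∈ C then x + 1 else ν) :
    Runs W markNbrs σ (μ * (30 + 8) + 6) fun σ' =>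
      σ'.var 12 = (nbrs adj C i).card ∧
      ∀ x < ν, (σ'.arr 9 x = if x ∈ nbrs adj C i then 0 else ν) ∧
        σ'.arr 10 x = if x ∈ nbrs adj C i then 0 else if x ∈ C then x + 1 else ν := by
  have hb := hS.bound
  have hν : ν ≤ ν * ν := Nat.le_mul_self ν
  refine (Runs.forTo (B := μ) (T := 30) (I := fun k σ' =>
      σ'.var 12 = (arcNbrs P Q k C i).card ∧
      ∀ x < ν, (σ'.arr 9 x = if x ∈ arcNbrs P Q k C i then 0 else ν) ∧
        σ'.arr 10 x = if x ∈ arcNbrs P Q k C i then 0 else if x ∈ C then x + 1 else ν)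
        (by omega) (by omega) hS.var8 rfl rfl (by decide) ?_ ?_).mono le_rfl ?_
  · simpa [arcNbrs_zero, h12] using hk
  · intro k hk σ' hs hx ⟨h12', hI⟩
    have e5 := (hs.arr 5 rfl).trans hS.arr5
    have e6 := (hs.arr 6 rfl).trans hS.arr6
    have e8 := hs.arr 8 rfl
    have e9 := (hs.var 9 rfl).trans h9
    obtain ⟨hP, hQ⟩ := hA.lt k hk
    have hcode := hC.eq (Q k) hQ
    have hsucc := hA.card_arcNbrs_succ hk i C
    have hmem : ∀ x, _ ↔ _ := fun x => mem_arcNbrs_succ (P := P) (Q := Q) (k := k) (S := C)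
      (w := i) (x := x)
    have hle := hA.card_arcNbrs_le hk.le i C
    refine (Runs.of_wp ?_).mono (by decide) fun _ => id
    by_cases hPk : P k = i
    · by_cases hQC : Q k ∈ C
      · simp only [if_pos hQC] at hcode
        simp only [hPk, hQC, true_and, if_true] at hsucc
        simp [-Order.lt_add_one_iff, and_assoc, wp, Fits, Test.Fits, Test.Holds, eval,
        hx, e5, e6, e8, e9, hcode, h12', hsucc, hPk]
        repeat (refine ⟨by omega, ?_⟩)
        intro x hx
        obtain ⟨h1, h2⟩ := hI x hx
        by_cases hxQ : x = Q k
        · subst hxQ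
          simp [hmem, hQC, hPk]
        · have : x ∈ arcNbrs P Q (k + 1) C i ↔ x ∈ arcNbrs P Q k C i := by
            rw [hmem]
            exact or_iff_left fun h => hxQ h.2.2.symm
          simp [Function.update_of_ne hxQ, this, h1, h2]
      · simp only [if_neg hQC] at hcode
        simp only [hQC, and_false, if_false] at hsucc
        have : ∀ x, x ∈ arcNbrs P Q (k + 1) C i ↔ x ∈ arcNbrs P Q k C i := fun x => by
          rw [hmem]
          exact or_iff_left fun h => hQC (h.2.2 ▸ h.1)
        simp [-Order.lt_add_one_iff, and_assoc, wp, Fits, Test.Fits, Test.Holds, eval,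
        hx, e5, e6, e8, e9, hcode, h12', hsucc, hPk,
          this]
        repeat (refine ⟨by omega, ?_⟩)
        exact hI
    · simp only [hPk, false_and, if_false] at hsucc
      have : ∀ x, x ∈ arcNbrs P Q (k + 1) C i ↔ x ∈ arcNbrs P Q k C i := fun x => by
        rw [hmem]
        exact or_iff_left fun h => hPk h.2.1
      simp [-Order.lt_add_one_iff, and_assoc, wp, Fits, Test.Fits, Test.Holds, eval,
        hx, e5, e6, e8, e9, hcode, h12', hsucc, hPk,
        this]
      repeat (refine ⟨by omega, ?_⟩)
      exact hI
  · rintro σ' ⟨⟨h12, hI⟩, -⟩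
    rw [hA.arcNbrs_eq] at *
    exact ⟨h12, hI⟩

/-- Before the arcs are counted, the keys describe the set `D₁` and the sets `D₂ w`. -/
theorem runs_countNbrs (hA : Arcs ν μ P Q adj) (hS : Stored W ν μ P Q σ) {D₁ : Finset ℕ}
    {D₂ : ℕ → Finset ℕ} (h9 : ∀ x < ν, σ.arr 9 x ≤ ν ∧ (σ.arr 9 x = 0 ↔ x ∈ D₁))
    (h10 : ∀ x < ν, σ.arr 10 x ≤ ν ∧ ∀ w < ν, σ.arr 10 x < w + 1 ↔ x ∈ D₂ w)
    (h13 : ∀ w < ν, σ.arr 13 w = 0) (h14 : ∀ w < ν, σ.arr 14 w = 0) :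
    Runs W countNbrs σ (μ * (40 + 8) + 6) fun σ' =>
      ∀ w < ν, σ'.arr 13 w = (arcNbrs P Q μ D₁ w).card ∧
        σ'.arr 14 w = (arcNbrs P Q μ (D₂ w) w).card := by
  have hb := hS.bound
  have hν : ν ≤ ν * ν := Nat.le_mul_self ν
  refine (Runs.forTo (B := μ) (T := 40) (I := fun k σ' =>
      ∀ w < ν, σ'.arr 13 w = (arcNbrs P Q k D₁ w).card ∧
        σ'.arr 14 w = (arcNbrs P Q k (D₂ w) w).card)
        (by omega) (by omega) hS.var8 rfl rfl (by decide) ?_ ?_).mono le_rfl ?_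
  · simpa [arcNbrs_zero] using fun w hw => ⟨h13 w hw, h14 w hw⟩
  · intro k hk σ' hs hx hI
    have e5 := (hs.arr 5 rfl).trans hS.arr5
    have e6 := (hs.arr 6 rfl).trans hS.arr6
    have e9 := hs.arr 9 rfl
    have e10 := hs.arr 10 rfl
    obtain ⟨hP, hQ⟩ := hA.lt k hk
    obtain ⟨h9a, h9b⟩ := h9 _ hQ
    obtain ⟨h10a, h10b⟩ := h10 _ hQ
    replace h10b := h10b _ hP
    have s1 := fun w => hA.card_arcNbrs_succ hk w D₁
    have s2 := fun w => hA.card_arcNbrs_succ hk w (D₂ w)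
    have l1 := hA.card_arcNbrs_le hk.le (P k) D₁
    have l2 := hA.card_arcNbrs_le hk.le (P k) (D₂ (P k))
    obtain ⟨i1, i2⟩ := hI _ hP
    refine (Runs.of_wp ?_).mono (by decide) fun _ => id
    simp [-Order.lt_add_one_iff, and_assoc, wp, Fits, Test.Fits, Test.Holds, eval,
        hx, e5, e6, e9, e10, h9b, h10b]
    repeat (refine ⟨by omega, ?_⟩)
    refine ⟨fun hc => ?_, fun hc => ?_⟩ <;>
    · repeat (refine ⟨by omega, ?_⟩)
      refine ⟨fun hc' => ?_, fun hc' => ?_⟩ <;>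
      · repeat (refine ⟨by omega, ?_⟩)
        intro w hw
        obtain ⟨j1, j2⟩ := hI w hw
        rw [s1, s2]
        by_cases hw' : w = P k
        · subst hw'
          simp [hc, hc', i1, i2]
        · have := Ne.symm hw'
          simp [hw', this, j1, j2]
  · rintro σ' ⟨hI, -⟩
    exact hI

end CliqueTree

/-! ### The branching test, the saved second child, and one complete step. -/

namespace CliqueTree

open Finset WordRAM WordRAM.Program WordRAM.Expr

variable {W ν μ : ℕ} {P Q : ℕ → ℕ} {adj : ℕ → ℕ → Prop} {σ : Config} {C D : Finset ℕ} {i : ℕ}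

/-- The lexicographic test at `w` needs the size of `D ∪ {x ∈ C | x < w}`. While `w` runs upwards,
variable 14 maintains it: it starts at `|D|` and grows by one at each member of `C` outside `D`,
recognised by its non-zero key. -/
theorem runs_decideBranch (hS : Stored W ν μ P Q σ) (hC : Codes ν (σ.arr 8) C)
    (h9 : σ.var 9 = i) (hi : i < ν) (hD : D ⊆ C) (h12 : σ.var 12 = D.card)
    (h10 : ∀ x < ν, σ.arr 10 x = if x ∈ D then 0 else if x ∈ C then x + 1 else ν)
    (h13 : ∀ w < ν, σ.arr 13 w ≤ μ) (h14 : ∀ w < ν, σ.arr 14 w ≤ μ) :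
    Runs W decideBranch σ (2 + (2 + (i * (40 + 8) + 6))) fun σ' => σ'.var 13 ≤ 1 ∧
      (σ'.var 13 = 1 ↔ ∀ w < i, w ∉ C → σ.arr 13 w ≠ D.card + 1 ∧
        σ.arr 14 w ≠ (D ∪ C.filter (· < w)).card) := by
  have hb := hS.bound
  have hν : ν ≤ ν * ν := Nat.le_mul_self ν
  have hcard : ∀ S ⊆ C, S.card ≤ ν := fun S hSC => by
    simpa using card_le_card (fun x hx => mem_range.2 (hC.lt x (hSC hx)) : S ⊆ range ν)
  have hDν := hcard D hD
  refine Runs.seq (T := 2) (Runs.of_wp (p := .set 13 (.const 1)) ?_)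
  refine ⟨by simp only [Fits]; omega, ?_⟩
  refine Runs.seq (T := 2) (Runs.of_wp (p := .set 14 (.var 12)) ?_)
  refine ⟨by simp [Fits]; omega, ?_⟩
  refine (Runs.forTo (B := i) (T := 40) (I := fun k σ' =>
      σ'.var 14 = (D ∪ C.filter (· < k)).card ∧ σ'.var 13 ≤ 1 ∧
      (σ'.var 13 = 1 ↔ ∀ w < k, w ∉ C → σ.arr 13 w ≠ D.card + 1 ∧
        σ.arr 14 w ≠ (D ∪ C.filter (· < w)).card)) (by omega) (by omega) (by simp [h9])
        rfl rfl (by decide) ?_ ?_).mono le_rfl ?_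
  · simp [eval, h12]
  · intro k hk σ' hs hx ⟨i14, i13, hI⟩
    have e8 := hs.arr 8 rfl
    have e10 := hs.arr 10 rfl
    have e13 := hs.arr 13 rfl
    have e14 := hs.arr 14 rfl
    have e12 := hs.var 12 rfl
    simp only [eval, Config.setVar_arr, Config.setVar_var] at e8 e10 e13 e14 e12
    norm_num at e12
    have hkν := hk.trans hi
    have hcode := hC.eq k hkν
    have hcode10 := h10 k hkν
    have a13 := h13 k hkν
    have a14 := h14 k hkν
    have hle := hcard (D ∪ C.filter (· < k)) (union_subset hD (filter_subset _ _))
    have hsplit : ∀ p : ℕ → Prop, (∀ w < k + 1, p w) ↔ (∀ w < k, p w) ∧ p k := fun p =>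
      ⟨fun h => ⟨fun w hw => h w (by omega), h k (by omega)⟩, fun h w hw =>
        (Nat.lt_succ_iff_lt_or_eq.1 hw).elim (h.1 w) fun e => e ▸ h.2⟩
    refine (Runs.of_wp ?_).mono (by decide) fun _ => id
    by_cases hkC : k ∈ C
    · have hsucc : (D ∪ C.filter (· < k + 1)).card =
          (D ∪ C.filter (· < k)).card + if k ∈ D then 0 else 1 := by
        split_ifs with hkD
        · congr 1
          ext x
          simp only [mem_union, mem_filter, Nat.lt_succ_iff_lt_or_eq]
          constructor
          · rintro (h | ⟨h, h' | rfl⟩)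
            exacts [.inl h, .inr ⟨h, h'⟩, .inl hkD]
          · exact fun h => h.imp_right fun h => ⟨h.1, .inl h.2⟩
        · rw [← card_insert_of_notMem (a := k) (by simp [hkD])]
          congr 1
          ext x
          simp only [mem_union, mem_filter, mem_insert, Nat.lt_succ_iff_lt_or_eq]
          constructor
          · rintro (h | ⟨h, h' | rfl⟩)
            exacts [.inr (.inl h), .inr (.inr ⟨h, h'⟩), .inl rfl]
          · rintro (rfl | h | ⟨h, h'⟩)
            exacts [.inr ⟨hkC, .inr rfl⟩, .inl h, .inr ⟨h, .inl h'⟩]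
      rw [hsplit, hsucc]
      simp only [if_pos hkC] at hcode hcode10
      by_cases hkD : k ∈ D
      · simp only [if_pos hkD] at hcode10
        simp [-Order.lt_add_one_iff, and_assoc, wp, Fits, Test.Fits, Test.Holds, eval, hx, e8, e10,
          hcode, hcode10, hkC, hkD, i14, hI]
        repeat (refine ⟨by omega, ?_⟩)
        omega
      · simp only [if_neg hkD] at hcode10
        simp [-Order.lt_add_one_iff, and_assoc, wp, Fits, Test.Fits, Test.Holds, eval, hx, e8, e10,
          hcode, hcode10, hkC, hkD, i14, hI]
        repeat (refine ⟨by omega, ?_⟩)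
        omega
    · have hsucc : D ∪ C.filter (· < k + 1) = D ∪ C.filter (· < k) := by
        ext x
        simp only [mem_union, mem_filter, Nat.lt_succ_iff_lt_or_eq]
        constructor
        · rintro (h | ⟨h, h' | rfl⟩)
          exacts [.inl h, .inr ⟨h, h'⟩, absurd h hkC]
        · exact fun h => h.imp_right fun h => ⟨h.1, .inl h.2⟩
      rw [hsplit, hsucc]
      simp only [if_neg hkC] at hcode
      simp only [wp, Fits, Test.Fits, Test.Holds, eval, hx, e8, hcode, e12, h12, e13, e14, i14,
        Config.setVar_var, Config.setVar_arr, not_true, false_imp_iff, and_true, true_imp_iff,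
        hkC, not_false_eq_true, if_true]
      rw [← hI]
      norm_num [-Order.lt_add_one_iff, and_assoc, hx, e12, h12, e13, e14, i14]
      repeat (refine ⟨by omega, ?_⟩)
      omega
  · rintro σ' ⟨⟨-, hI⟩, -⟩
    exact hI

/-- Array 11 is a table with rows of length `ν`, one row for each level. Only row `i + 1` is
written, so the cliques saved at smaller levels survive; these row addresses are what makes the word
bound quadratic in `ν`. -/
theorem runs_saveBranch (hS : Stored W ν μ P Q σ) (h9 : σ.var 9 = i) (hi : i < ν)
    (hk : ∀ x < ν, σ.arr 9 x ≤ ν) :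
    Runs W saveBranch σ (ν * (30 + 8) + 6 + 5) fun σ' =>
      (∀ x < ν, σ'.arr 11 ((i + 1) * ν + x) = if σ.arr 9 x = 0 then 1 else 0) ∧
      (∀ y < (i + 1) * ν, σ'.arr 11 y = σ.arr 11 y) ∧
      σ'.arr 12 = Function.update (σ.arr 12) (i + 1) 1 := by
  have hb := hS.bound
  have hν : ν ≤ ν * ν := Nat.le_mul_self ν
  have hiν : (i + 1) * ν ≤ ν * ν := Nat.mul_le_mul_right _ hi
  have h7 := hS.var7
  refine Runs.seqSame (Q' := fun σ' =>
      (∀ x < ν, σ'.arr 11 ((i + 1) * ν + x) = if σ.arr 9 x = 0 then 1 else 0) ∧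
      (∀ y < (i + 1) * ν, σ'.arr 11 y = σ.arr 11 y)) ?_ ?_
  · refine (Runs.forTo (B := ν) (T := 30) (I := fun k σ' =>
      (∀ x < k, σ'.arr 11 ((i + 1) * ν + x) = if σ.arr 9 x = 0 then 1 else 0) ∧
      (∀ y < (i + 1) * ν, σ'.arr 11 y = σ.arr 11 y)) (by omega) (by omega) h7
        rfl rfl (by decide) ?_ ?_).mono le_rfl fun σ' h => h.1
    · simp
    · intro k hk' σ' hs hx ⟨h1, h2⟩
      have e7 := (hs.var 7 rfl).trans h7
      have e9 := (hs.var 9 rfl).trans h9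
      have a9 := hs.arr 9 rfl
      have hkk := hk k hk'
      refine (Runs.of_wp ?_).mono (by decide) fun _ => id
      simp [-Order.lt_add_one_iff, and_assoc, wp, Fits, Test.Fits, Test.Holds, eval, hx, e7, e9, a9]
      repeat (refine ⟨by omega, ?_⟩)
      refine ⟨fun hc => ?_, fun hc => ?_⟩ <;>
      · repeat (refine ⟨by omega, ?_⟩)
        refine ⟨fun x hx => ?_, fun y hy => ?_⟩
        · rcases Nat.lt_succ_iff_lt_or_eq.1 hx with hx | rfl
          · rw [Function.update_of_ne (by omega), h1 x hx]
          · simp [hc]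
        · rw [Function.update_of_ne (by omega), h2 y hy]
  · intro σ' ⟨h1, h2⟩ hs
    have e9 := (hs.var 9 rfl).trans h9
    have e12 := hs.arr 12 rfl
    refine (Runs.of_wp ?_).mono (by decide) fun _ => id
    simp [-Order.lt_add_one_iff, and_assoc, wp, Fits, eval, e9, e12]
    repeat (refine ⟨by omega, ?_⟩)
    exact h2

/-- The effect of one step. -/
def StepPost (adj : ℕ → ℕ → Prop) (ν i : ℕ) (C : Finset ℕ) (σ σ' : Config) : Prop :=
  σ'.var 9 = i + 1 ∧
  ((nbrs adj C i = C ∧ Codes ν (σ'.arr 8) (insert i C) ∧ σ'.arr 11 = σ.arr 11 ∧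
      σ'.arr 12 = σ.arr 12) ∨
    (nbrs adj C i ≠ C ∧ Codes ν (σ'.arr 8) C ∧
      ((¬ Branches adj C i ∧ σ'.arr 11 = σ.arr 11 ∧ σ'.arr 12 = σ.arr 12) ∨
        (Branches adj C i ∧
          Codes ν (fun x => σ'.arr 11 ((i + 1) * ν + x)) (insert i (nbrs adj C i)) ∧
          (∀ y < (i + 1) * ν, σ'.arr 11 y = σ.arr 11 y) ∧
          σ'.arr 12 = Function.update (σ.arr 12) (i + 1) 1))))

theorem runs_step (hA : Arcs ν μ P Q adj) (hS : Stored W ν μ P Q σ)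
    (hC : Codes ν (σ.arr 8) C) (hlt : ∀ x ∈ C, x < i) (h9 : σ.var 9 = i) (hi : i < ν) :
    Runs W step σ (200 * (μ + ν + 1)) (StepPost adj ν i C σ) := by
  have hb := hS.bound
  have hν : ν ≤ ν * ν := Nat.le_mul_self ν
  have hiC : i ∉ C := fun h => lt_irrefl _ (hlt i h)
  have hiD : i ∉ nbrs adj C i := fun h => hiC (nbrs_subset h)
  have hcard : ∀ S ⊆ C, S.card ≤ ν := fun S hSC => by
    simpa using card_le_card (fun x hx => mem_range.2 (hC.lt x (hSC hx)) : S ⊆ range ν)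
  have hDν := hcard _ (nbrs_subset (adj := adj) (v := i))
  have hCν := hcard _ Subset.rfl
  refine Runs.mono (Q := StepPost adj ν i C σ) (T := 2 + (2 + (ν * (30 + 8) + 6)) +
    ((μ * (30 + 8) + 6) + ((4 + (3 + ((μ * (40 + 8) + 6) + (2 + (2 + (i * (40 + 8) + 6)) +
      (4 + (ν * (30 + 8) + 6 + 5)))))) + 4))) ?_ (by omega) fun _ => id
  refine Runs.seqSame (runs_prepare hS hC) fun σ₁ ⟨p11, p12, pk⟩ s₁ => ?_
  have hS₁ := hS.of_same s₁ rfl rfl rfl rfl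
  have h9₁ := (s₁.var 9 rfl).trans h9
  have hC₁ : Codes ν (σ₁.arr 8) C := (s₁.arr 8 rfl).symm ▸ hC
  refine Runs.seqSame (runs_markNbrs hA hS₁ hC₁ h9₁ hi p12 fun x hx => ⟨(pk x hx).1, (pk x hx).2.1⟩)
    fun σ₂ ⟨q12, qk⟩ s₂ => ?_
  have hS₂ := hS₁.of_same s₂ rfl rfl rfl rfl
  have h9₂ := (s₂.var 9 rfl).trans h9₁
  have hC₂ : Codes ν (σ₂.arr 8) C := (s₂.arr 8 rfl).symm ▸ hC₁
  have h11₂ := (s₂.var 11 rfl).trans p11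
  have a11₂ := (s₂.arr 11 rfl).trans (s₁.arr 11 rfl)
  have a12₂ := (s₂.arr 12 rfl).trans (s₁.arr 12 rfl)
  have a13₂ : ∀ x < ν, σ₂.arr 13 x = 0 := fun x hx => by rw [s₂.arr 13 rfl]; exact (pk x hx).2.2.1
  have a14₂ : ∀ x < ν, σ₂.arr 14 x = 0 := fun x hx => by rw [s₂.arr 14 rfl]; exact (pk x hx).2.2.2
  refine Runs.seqSame (Q' := fun σ' => StepPost adj ν i C σ (σ'.setVar 9 (i + 1))) ?_
    fun σ' h hs => ?_
  · refine Runs.cond ?_ (fun hc => ?_) (fun hc => ?_)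
    · simp [Test.Fits, Fits, h11₂, q12]
      omega
    · simp only [Test.Holds, eval, h11₂, q12] at hc
      -- Comparing the two cardinalities decides whether `i` is adjacent to all of `C`.
      have hDC : nbrs adj C i = C := eq_of_subset_of_card_le nbrs_subset hc.le
      refine (Runs.of_wp ?_).mono (T := 3) (by omega) fun _ => id
      simp [wp, Fits, eval, h9₂]
      refine ⟨by omega, by omega, ?_⟩
      refine ⟨by simp, .inl ⟨hDC, ⟨fun x hx => ?_, fun x hx => ?_⟩, a11₂, a12₂⟩⟩
      · rcases mem_insert.1 hx with rfl | hx
        exacts [hi, hC.lt x hx]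
      · by_cases hxi : x = i
        · simp [hxi]
        · simp [hxi, hC₂.eq x hx]
    · simp only [Test.Holds, eval, h11₂, q12] at hc
      have hDC : nbrs adj C i ≠ C := fun h => hc (by rw [h])
      refine Runs.seqSame (T := 3) (Q' := fun τ => τ = σ₂.setArr 9 i 0)
        ((Runs.of_wp ?_).mono (by decide) fun _ => id) fun σ₃ e₃ s₃ => ?_
      · simp [wp, Fits, eval, h9₂]
        omega
      have hS₃ := hS₂.of_same s₃ rfl rfl rfl rfl
      have h9₃ := (s₃.var 9 rfl).trans h9₂
      have hC₃ : Codes ν (σ₃.arr 8) C := (s₃.arr 8 rfl).symm ▸ hC₂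
      have b9 : ∀ x < ν, σ₃.arr 9 x ≤ ν ∧ (σ₃.arr 9 x = 0 ↔ x ∈ insert i (nbrs adj C i)) := by
        intro x hx
        by_cases hxi : x = i
        · simp [e₃, hxi]
        · simp only [e₃, Config.setArr_arr, if_true, Function.update_of_ne hxi, (qk x hx).1,
            mem_insert, hxi, false_or]
          split_ifs with hxD <;> simp [hxD]
          omega
      have k10 : ∀ x < ν, σ₃.arr 10 x =
          if x ∈ nbrs adj C i then 0 else if x ∈ C then x + 1 else ν := by
        intro x hx
        rw [s₃.arr 10 rfl]
        exact (qk x hx).2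
      -- The purpose of the keys: one comparison with `w + 1` decides membership in a set that
      -- depends on `w`. The key 0 always passes, the key `x + 1` passes exactly for `x < w`, and
      -- the key `ν` never passes for `w < ν`.
      have b10 : ∀ x < ν, σ₃.arr 10 x ≤ ν ∧ ∀ w < ν, σ₃.arr 10 x < w + 1 ↔
          x ∈ nbrs adj C i ∪ C.filter (· < w) := by
        intro x hx
        rw [k10 x hx]
        refine ⟨by split_ifs <;> omega, fun w hw => ?_⟩
        simp only [mem_union, mem_filter]
        split_ifs with h1 h2
        · simp [h1]
        · simp [h1, h2]
        · simp [h1, h2]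
          omega
      refine Runs.seqSame (runs_countNbrs hA hS₃ b9 b10
        (fun w hw => by rw [s₃.arr 13 rfl]; exact a13₂ w hw)
        (fun w hw => by rw [s₃.arr 14 rfl]; exact a14₂ w hw)) fun σ₄ c₄ s₄ => ?_
      have hS₄ := hS₃.of_same s₄ rfl rfl rfl rfl
      have h9₄ := (s₄.var 9 rfl).trans h9₃
      have hC₄ : Codes ν (σ₄.arr 8) C := (s₄.arr 8 rfl).symm ▸ hC₃
      refine Runs.seqSame (runs_decideBranch (D := nbrs adj C i) hS₄ hC₄ h9₄ hi nbrs_subset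
        ((s₄.var 12 rfl).trans ((s₃.var 12 rfl).trans q12))
        (fun x hx => by rw [s₄.arr 10 rfl]; exact k10 x hx)
        (fun w hw => (c₄ w hw).1 ▸ hA.card_arcNbrs_le le_rfl w _)
        (fun w hw => (c₄ w hw).2 ▸ hA.card_arcNbrs_le le_rfl w _)) fun σ₅ ⟨d₁, d₂⟩ s₅ => ?_
      have hS₅ := hS₄.of_same s₅ rfl rfl rfl rfl
      have h9₅ := (s₅.var 9 rfl).trans h9₄
      have hC₅ : Codes ν (σ₅.arr 8) C := (s₅.arr 8 rfl).symm ▸ hC₄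
      have a9₅ := (s₅.arr 9 rfl).trans (s₄.arr 9 rfl)
      have a11₅ := (s₅.arr 11 rfl).trans ((s₄.arr 11 rfl).trans ((s₃.arr 11 rfl).trans a11₂))
      have a12₅ := (s₅.arr 12 rfl).trans ((s₄.arr 12 rfl).trans ((s₃.arr 12 rfl).trans a12₂))
      -- The number `D.card + 1` is the size of `insert i D`, as `i ∉ D`. Both tests thus compare a
      -- counter with the size of the set it counts in, and equality means adjacency to the whole
      -- set.
      have hB : σ₅.var 13 = 1 ↔ Branches adj C i := by
        rw [d₂]
        refine forall_congr' fun w => forall_congr' fun hw => forall_congr' fun _ => ?_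
        obtain ⟨c1, c2⟩ := c₄ w (hw.trans hi)
        rw [c1, c2, ← card_insert_of_notMem hiD, Ne, Ne, hA.card_arcNbrs, hA.card_arcNbrs, not_not,
          not_not]
      refine Runs.cond ?_ (fun hc => ?_) (fun hc => ?_)
      · simp [Test.Fits, Fits]
        omega
      · have hB := hB.1 hc
        refine (runs_saveBranch hS₅ h9₅ hi fun x hx => by rw [a9₅]; exact (b9 x hx).1).withSame.mono
          le_rfl fun σ' ⟨⟨r1, r2, r3⟩, s₆⟩ => ⟨by simp, .inr ⟨hDC, ?_, .inr ⟨hB, ?_, ?_, ?_⟩⟩⟩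
        · rw [Config.setVar_arr, s₆.arr 8 rfl]
          exact hC₅
        · refine ⟨fun x hx => ?_, fun x hx => ?_⟩
          · rcases mem_insert.1 hx with rfl | hx
            exacts [hi, hC.lt x (nbrs_subset hx)]
          · simp only [Config.setVar_arr]
            rw [r1 x hx, a9₅]
            simp only [(b9 x hx).2]
        · intro y hy
          rw [← a11₅]
          exact r2 y hy
        · rw [← a12₅]
          exact r3
      · refine (Runs.of_wp (p := .nop) ?_).mono (T := 1) (by omega) fun _ => id
        exact ⟨by simp, .inr ⟨hDC, hC₅, .inl ⟨fun h => hc (hB.2 h), a11₅, a12₅⟩⟩⟩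
  · have e9 : σ'.var 9 = i := (hs.var 9 rfl).trans h9₂
    refine (Runs.of_wp ?_).mono (by decide) fun _ => id
    simp [wp, Fits, eval, e9]
    exact ⟨⟨by omega, by omega, by omega⟩, h⟩

end CliqueTree

namespace CliqueTree

open Finset WordRAM WordRAM.Program WordRAM.Expr

/-! ### Enumeration of all maximal cliques -/

/-- Go back to the last level at which a clique has been saved. -/
def goBack : Program :=
  .loop (.eq (.load 12 (.var 9)) (.const 0)) (.set 9 (.sub (.var 9) (.const 1)))

/-- Restore the clique saved at the current level. -/
def restore : Program :=
  .store 12 (.var 9) (.const 0) ;;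
  forTo 10 7 (.store 8 (.var 10) (.load 11 (.add (.mul (.var 9) (.var 7)) (.var 10))))

/-- Start at the empty clique, with no saved cliques. -/
def startTree : Program :=
  forTo 10 7 (.store 8 (.var 10) (.const 0) ;;
    .store 12 (.add (.var 10) (.const 1)) (.const 0)) ;;
  .store 12 (.const 0) (.const 1) ;; .set 9 (.const 0) ;; .set 20 (.const 1)

/-- Run `leaf` for every maximal clique of the stored graph. -/
def enumerate (leaf : Program) : Program :=
  startTree ;;
  .loop (.eq (.var 20) (.const 1)) (
    .loop (.lt (.var 9) (.var 7)) step ;;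
    leaf ;;
    goBack ;;
    .cond (.eq (.var 9) (.const 0)) (.set 20 (.const 0)) restore)

/-- `σ` agrees with `σ₀` on the variables below 9 and on the arrays below 7. -/
structure Low (σ₀ σ : Config) : Prop where
  var : ∀ y < 9, σ.var y = σ₀.var y
  arr : ∀ a < 7, σ.arr a = σ₀.arr a

theorem Low.rfl {σ : Config} : Low σ σ := ⟨fun _ _ => .refl _, fun _ _ => .refl _⟩

theorem Low.of_same {σ₀ σ σ' : Config} {p : Program} (h : Low σ₀ σ) (hs : Same p σ σ')
    (hv : ∀ y < 9, p.wv y = false) (ha : ∀ a < 7, p.wa a = false) : Low σ₀ σ' :=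
  ⟨fun y hy => (hs.var y (hv y hy)).trans (h.var y hy),
    fun a h' => (hs.arr a (ha a h')).trans (h.arr a h')⟩

variable {W ν μ : ℕ} {P Q : ℕ → ℕ} {adj : ℕ → ℕ → Prop} {σ σ₀ : Config} {C D : Finset ℕ} {i : ℕ}
  {R : List (Finset ℕ)} {fl row : ℕ → ℕ}

theorem Stored.of_low (h : Stored W ν μ P Q σ₀) (hl : Low σ₀ σ) : Stored W ν μ P Q σ :=
  ⟨(hl.var 7 (by decide)).trans h.var7, (hl.var 8 (by decide)).trans h.var8,
    (hl.arr 5 (by decide)).trans h.arr5, (hl.arr 6 (by decide)).trans h.arr6, h.bound⟩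

/-- The list of the leaves below the cliques saved at the levels up to a given one. -/
inductive Pend (adj : ℕ → ℕ → Prop) (ν : ℕ) (fl row : ℕ → ℕ) : ℕ → List (Finset ℕ) → Prop where
  | zero : Pend adj ν fl row 0 []
  | skip {l : ℕ} {R : List (Finset ℕ)} : fl (l + 1) = 0 → Pend adj ν fl row l R →
      Pend adj ν fl row (l + 1) R
  | push {l : ℕ} {R : List (Finset ℕ)} {C : Finset ℕ} : fl (l + 1) = 1 →
      Codes ν (fun x => row ((l + 1) * ν + x)) C → MaxClique adj (l + 1) C →
      Pend adj ν fl row l R →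
      Pend adj ν fl row (l + 1) (leaves adj (ν - (l + 1)) (l + 1) C ++ R)

/-- The pending list depends only on the positive flags and on the rows up to level `i`, so saving a
clique at a deeper level does not disturb it. -/
theorem Pend.congr {fl' row' : ℕ → ℕ} (h : Pend adj ν fl row i R)
    (hf : ∀ l, 0 < l → l ≤ i → fl' l = fl l) (hr : ∀ y < (i + 1) * ν, row' y = row y) :
    Pend adj ν fl' row' i R := by
  induction h with
  | zero => exact .zero
  | @skip l R h _ ih =>
    exact .skip (by rw [hf _ (by omega) le_rfl, h])
      (ih (fun l hl hl' => hf l hl (by omega)) fun y hy => hr y (hy.trans_le (by gcongr; omega)))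
  | @push l R C h hc hm _ ih =>
    refine .push (by rw [hf _ (by omega) le_rfl, h]) ⟨hc.lt, fun x hx => ?_⟩ hm
      (ih (fun l hl hl' => hf l hl (by omega)) fun y hy => hr y (hy.trans_le (by gcongr; omega)))
    rw [hr _ (by rw [Nat.add_mul (l + 1)]; omega)]
    exact hc.eq x hx

/-- Describes where backtracking stops: at the deepest saved clique, whose leaves come first in the
pending list, or at level 0, whose flag is a sentinel, if nothing is pending. -/
theorem Pend.top (h : Pend adj ν fl row i R) (h0 : fl 0 = 1) :
    ∃ l ≤ i, (∀ l', l < l' → l' ≤ i → fl l' = 0) ∧ fl l = 1 ∧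
      ((l = 0 ∧ R = []) ∨ ∃ l₀ C R', l = l₀ + 1 ∧ R = leaves adj (ν - l) l C ++ R' ∧
        Codes ν (fun x => row (l * ν + x)) C ∧ MaxClique adj l C ∧ Pend adj ν fl row l₀ R') := by
  induction h with
  | zero => exact ⟨0, le_rfl, fun l' h h' => by omega, h0, .inl ⟨rfl, rfl⟩⟩
  | @skip l R h _ ih =>
    obtain ⟨k, hk, hz, h1, h2⟩ := ih
    refine ⟨k, by omega, fun l' hl hl' => ?_, h1, h2⟩
    rcases Nat.le_succ_iff.1 hl' with hl' | rfl
    exacts [hz l' hl hl', h]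
  | @push l R C h hc hm hp ih =>
    exact ⟨l + 1, le_rfl, fun l' h h' => by omega, h, .inr ⟨l, C, R, rfl, rfl, hc, hm, hp⟩⟩

/-- The configuration represents a node `k` levels above the leaves, such that `R` is the list of
the leaves that are still to be visited. -/
structure Node (adj : ℕ → ℕ → Prop) (ν k : ℕ) (R : List (Finset ℕ)) (i : ℕ) (C : Finset ℕ)
    (σ : Config) : Prop where
  level : i + k = ν
  var9 : σ.var 9 = i
  codes : Codes ν (σ.arr 8) C
  maxClique : MaxClique adj i C
  flag0 : σ.arr 12 0 = 1
  flags : ∀ l, i < l → l ≤ ν → σ.arr 12 l = 0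
  pend : ∃ R', R = leaves adj k i C ++ R' ∧ Pend adj ν (σ.arr 12) (σ.arr 11) i R'

/-- The list `R` of unvisited leaves does not change: `leaves` puts the leaves of the first child,
where the search continues, before those of the second child, which is pushed onto the pending ones.
-/
theorem runs_step_node (hA : Arcs ν μ P Q adj) (hS : Stored W ν μ P Q σ) {k : ℕ}
    (hN : Node adj ν (k + 1) R i C σ) :
    Runs W step σ (200 * (μ + ν + 1)) fun σ' => ∃ C', Node adj ν k R (i + 1) C' σ' := by
  obtain ⟨hl, h9, hC, hM, h0, hf, R', hR, hP⟩ := hN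
  refine (runs_step hA hS hC hM.lt h9 (by omega)).mono le_rfl fun σ' ⟨h9', h⟩ => ?_
  have hfl : ∀ l, i + 1 < l → l ≤ ν → σ.arr 12 l = 0 := fun l h h' => hf l (by omega) h'
  have hskip : Pend adj ν (σ.arr 12) (σ.arr 11) (i + 1) R' :=
    .skip (hf _ (by omega) (by omega)) hP
  rcases h with ⟨hD, hC', h11, h12⟩ | ⟨hD, hC', ⟨hB, h11, h12⟩ | ⟨hB, hC'', h11, h12⟩⟩
  · refine ⟨_, by omega, h9', hC', hM.extend hA.symm hD, h12 ▸ h0, h12 ▸ hfl, R', ?_, ?_⟩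
    · rw [hR, leaves, if_pos hD]
    · rw [h11, h12]
      exact hskip
  · refine ⟨_, by omega, h9', hC', hM.keep hD, h12 ▸ h0, h12 ▸ hfl, R', ?_, ?_⟩
    · rw [hR, leaves, if_neg hD, if_neg hB, List.append_nil]
    · rw [h11, h12]
      exact hskip
  · refine ⟨_, by omega, h9', hC', hM.keep hD, ?_, fun l hl hl' => ?_,
      leaves adj (ν - (i + 1)) (i + 1) (insert i (nbrs adj C i)) ++ R', ?_, ?_⟩
    · rw [h12, Function.update_of_ne (by omega), h0]
    · rw [h12, Function.update_of_ne (by omega), hfl l hl hl']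
    · rw [hR, leaves, if_neg hD, if_pos hB, List.append_assoc, show ν - (i + 1) = k by omega]
    · refine .push (by simp [h12]) hC'' (hM.branch hA.symm hB) (hP.congr (fun l h h' => ?_) h11)
      rw [h12, Function.update_of_ne (by omega)]

theorem runs_descend (hA : Arcs ν μ P Q adj) (hS : Stored W ν μ P Q σ) {k : ℕ}
    (hN : Node adj ν k R i C σ) :
    Runs W (.loop (.lt (.var 9) (.var 7)) step) σ (ν * (200 * (μ + ν + 1) + 4) + 4) fun σ' =>
      ∃ C', Node adj ν 0 R ν C' σ' := by
  have hb := hS.bound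
  have hν : ν ≤ ν * ν := Nat.le_mul_self ν
  have hk : k ≤ ν := by
    have := hN.level
    omega
  refine (Runs.loop (b := .lt (.var 9) (.var 7)) (T := 200 * (μ + ν + 1))
    (I := fun k σ' => Stored W ν μ P Q σ' ∧ ∃ i C', Node adj ν k R i C' σ') ?_ ?_ ?_
    ⟨hS, i, C, hN⟩).mono ?_ ?_
  · rintro k σ' ⟨hS', i, C', hN'⟩
    have := hN'.level
    simp only [Test.Fits, Fits, hN'.var9, hS'.var7]
    omega
  · rintro σ' ⟨hS', i, C', hN'⟩
    have := hN'.level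
    simp only [Test.Holds, eval, hN'.var9, hS'.var7]
    omega
  · rintro k σ' ⟨hS', i, C', hN'⟩
    have := hN'.level
    refine ⟨?_, (runs_step_node hA hS' hN').withSame.mono le_rfl fun σ'' ⟨⟨C'', h⟩, hs⟩ =>
      ⟨hS'.of_same hs rfl rfl rfl rfl, _, C'', h⟩⟩
    simp only [Test.Holds, eval, hN'.var9, hS'.var7]
    omega
  · have : k * (200 * (μ + ν + 1) + 4) ≤ ν * (200 * (μ + ν + 1) + 4) := by gcongr
    change k * (200 * (μ + ν + 1) + 4) + 4 ≤ _
    omega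
  · rintro σ' ⟨hS', i, C', hN'⟩
    obtain rfl : i = ν := by simpa using hN'.level
    exact ⟨C', hN'⟩

/-- For `l = 0` the loop is stopped by the sentinel flag, so no separate test for level 0 is needed.
-/
theorem runs_goBack {l : ℕ} (hl : l ≤ i) (hi : i < W) (hW : 1 < W) (h9 : σ.var 9 = i)
    (h : ∀ l', l < l' → l' ≤ i → σ.arr 12 l' = 0) (h1 : σ.arr 12 l = 1) :
    Runs W goBack σ (i * 9 + 5) fun σ' => σ'.var 9 = l := by
  refine (Runs.loop (b := .eq (.load 12 (.var 9)) (.const 0)) (T := 4)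
    (I := fun k σ' => σ'.var 9 = l + k ∧ l + k ≤ i ∧ σ'.arr 12 = σ.arr 12) ?_ ?_ ?_ (k := i - l)
    ⟨by omega, by omega, rfl⟩).mono ?_ ?_
  · rintro k σ' ⟨h9', hk, h12⟩
    have : σ.arr 12 (l + k) ≤ 1 := by
      rcases Nat.eq_zero_or_pos k with rfl | hk'
      · exact h1.le
      · rw [h _ (by omega) hk]
        omega
    simp only [Test.Fits, Fits, eval, h9', h12]
    omega
  · rintro σ' ⟨h9', hk, h12⟩
    simp only [Test.Holds, eval, h9', h12]
    rw [Nat.add_zero, h1]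
    omega
  · rintro k σ' ⟨h9', hk, h12⟩
    refine ⟨by simp only [Test.Holds, eval, h9', h12]; exact h _ (by omega) hk,
      (Runs.of_wp ?_).mono (by decide) fun _ => id⟩
    simp [-Order.lt_add_one_iff, and_assoc, wp, Fits, eval, h9', h12]
    omega
  · have : (i - l) * 9 ≤ i * 9 := by gcongr; omega
    simp only [Test.cost, cost]
    omega
  · rintro σ' ⟨h9', -⟩
    exact h9'

theorem runs_restore (hS : Stored W ν μ P Q σ) (h9 : σ.var 9 = i) (hi : i ≤ ν)
    (hC : Codes ν (fun x => σ.arr 11 (i * ν + x)) C) :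
    Runs W restore σ (3 + (ν * (12 + 8) + 6)) fun σ' =>
      Codes ν (σ'.arr 8) C ∧ σ'.arr 12 = Function.update (σ.arr 12) i 0 := by
  have hb := hS.bound
  have hν : ν ≤ ν * ν := Nat.le_mul_self ν
  have hiν : i * ν ≤ ν * ν := Nat.mul_le_mul_right _ hi
  refine Runs.seqSame (Q' := fun σ' => σ'.arr 12 = Function.update (σ.arr 12) i 0 ∧
    σ'.arr 11 = σ.arr 11) ((Runs.of_wp ?_).mono (by decide) fun _ => id) fun σ₁ ⟨h12, h11⟩ hs => ?_
  · simp [wp, Fits, eval, h9]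
    omega
  · have h9' := (hs.var 9 rfl).trans h9
    have h7' := (hs.var 7 rfl).trans hS.var7
    refine (Runs.forTo (B := ν) (T := 12) (I := fun k σ' =>
      ∀ x < k, σ'.arr 8 x = if x ∈ C then 1 else 0) (by omega) (by omega) h7' rfl rfl (by decide)
      (by simp) ?_).mono le_rfl fun σ' ⟨h, hs'⟩ => ⟨⟨hC.lt, h⟩, (hs'.arr 12 rfl).trans h12⟩
    intro k hk σ' hs' hx hI
    have e9 := (hs'.var 9 rfl).trans h9'
    have e7 := (hs'.var 7 rfl).trans h7'
    have e11 := (hs'.arr 11 rfl).trans h11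
    have hc : σ.arr 11 (i * ν + k) = if k ∈ C then 1 else 0 := hC.eq k hk
    have : σ.arr 11 (i * ν + k) ≤ 1 := by
      rw [hc]
      split_ifs <;> omega
    refine (Runs.of_wp ?_).mono (by decide) fun _ => id
    simp [-Order.lt_add_one_iff, and_assoc, wp, Fits, eval, hx, e7, e9, e11]
    refine ⟨by omega, by omega, by omega, by omega, by omega, by omega, by omega, fun x hx => ?_⟩
    rcases Nat.lt_succ_iff_lt_or_eq.1 hx with hx | rfl
    · rw [Function.update_of_ne hx.ne, hI x hx]
    · rw [Function.update_self, hc]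

/-- The flags of the levels 1 to `ν` are cleared because memory may contain leftovers of the
enumeration for another interval; the flag of level 0 is set as a sentinel. -/
theorem runs_startTree (hS : Stored W ν μ P Q σ) :
    Runs W startTree σ (ν * (12 + 8) + 6 + (3 + (2 + 2))) fun σ' =>
      σ'.var 20 = 1 ∧ Node adj ν ν (leaves adj ν 0 ∅) 0 ∅ σ' := by
  have hb := hS.bound
  have hν : ν ≤ ν * ν := Nat.le_mul_self ν
  refine Runs.seqSame (Runs.forTo (B := ν) (T := 12) (I := fun k σ' =>
      (∀ x < k, σ'.arr 8 x = 0) ∧ ∀ l, 0 < l → l ≤ k → σ'.arr 12 l = 0) (by omega) (by omega)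
      hS.var7 rfl rfl (by decide) ?_ ?_) fun σ₁ ⟨⟨h8, h12⟩, _⟩ hs => ?_
  · refine ⟨by simp, fun l h h' => by omega⟩
  · rintro k hk σ' hs hx ⟨h8, h12⟩
    refine (Runs.of_wp ?_).mono (by decide) fun _ => id
    simp [-Order.lt_add_one_iff, and_assoc, wp, Fits, eval, hx]
    refine ⟨by omega, by omega, by omega, by omega, by omega, by omega, fun x hx => ?_,
      fun l hl hl' => ?_⟩
    · rcases Nat.lt_succ_iff_lt_or_eq.1 hx with hx | rfl
      · rw [Function.update_of_ne hx.ne, h8 x hx]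
      · rw [Function.update_self]
    · rcases Nat.le_succ_iff.1 hl' with hl' | rfl
      · rw [Function.update_of_ne (by omega), h12 l hl hl']
      · rw [Function.update_self]
  · refine (Runs.of_wp ?_).mono (by decide) fun _ => id
    simp [-Order.lt_add_one_iff, wp, Fits, eval]
    repeat (refine ⟨by omega, ?_⟩)
    refine ⟨by omega, by simp, ⟨by simp, fun x hx => by simp [h8 x hx]⟩, maxClique_zero,
      by simp, fun l hl hl' => ?_, [], by simp, .zero⟩
    simp [Function.update_of_ne (show l ≠ 0 by omega), h12 l hl hl']

/-- If `leaf` outputs `g K` at every maximal clique `K`, then `enumerate leaf` outputs these words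
for all maximal cliques. -/
theorem runs_enumerate (hA : Arcs ν μ P Q adj) (hS : Stored W ν μ P Q σ) {leaf : Program}
    {TL : ℕ} {g : Finset ℕ → List ℕ}
    (hv : ∀ y < 10, leaf.wv y = false) (hv20 : leaf.wv 20 = false)
    (ha : ∀ a < 13, leaf.wa a = false)
    (hL : ∀ σ' K, Low σ σ' → MaxClique adj ν K → Codes ν (σ'.arr 8) K →
      Runs W leaf σ' TL fun σ'' => σ''.out = σ'.out ++ g K) :
    Runs W (enumerate leaf) σ
      ((leaves adj ν 0 ∅).length * (300 * (ν + 1) * (μ + ν + 1) + TL) + 100 * (ν + 1))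
      fun σ' => σ'.out = σ.out ++ (leaves adj ν 0 ∅).flatMap g := by
  have hb := hS.bound
  have hν : ν ≤ ν * ν := Nat.le_mul_self ν
  set total := σ.out ++ (leaves adj ν 0 ∅).flatMap g with htotal
  refine Runs.mono (T := ν * (12 + 8) + 6 + (3 + (2 + 2)) + ((leaves adj ν 0 ∅).length *
    (((ν * (200 * (μ + ν + 1) + 4) + 4) + (TL + ((ν * 9 + 5) + (4 + (3 + (ν * (12 + 8) + 6))))))
      + 3 + 1) + 3 + 1)) ?_ ?_ fun _ => id
  · refine Runs.seqSame (runs_startTree (adj := adj) hS) fun σ₁ ⟨h20, hN⟩ hs => ?_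
    have hlow₁ : Low σ σ₁ := Low.rfl.of_same hs (by decide) (by decide)
    have hout₁ := hs.out rfl
    -- Each round visits exactly one leaf, so the rounds left are counted by the list `R` of
    -- unvisited leaves. The words already written, followed by the words due for `R`, always give
    -- `total`.
    refine (Runs.loop (b := .eq (.var 20) (.const 1)) (I := fun r σ' => ∃ R : List (Finset ℕ),
      R.length = r ∧ Low σ σ' ∧ σ'.out ++ R.flatMap g = total ∧
      ((r = 0 ∧ σ'.var 20 = 0) ∨ (0 < r ∧ σ'.var 20 = 1 ∧ ∃ k i C, Node adj ν k R i C σ')))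
      ?_ ?_ ?_ (k := (leaves adj ν 0 ∅).length)
      ⟨_, rfl, hlow₁, by rw [hout₁], .inr ⟨?_, h20, _, _, _, hN⟩⟩).mono le_rfl ?_
    · rintro r σ' ⟨R, -, -, -, ⟨-, h⟩ | ⟨-, h, -⟩⟩ <;>
      · simp only [Test.Fits, Fits, h]
        omega
    · rintro σ' ⟨R, -, -, -, ⟨-, h⟩ | ⟨h, -⟩⟩
      · simp [Test.Holds, eval, h]
      · omega
    · rintro r σ' ⟨R, hr, hlow, hout, ⟨h, -⟩ | ⟨-, h20, k, i, C, hN⟩⟩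
      · omega
      refine ⟨by simpa [Test.Holds, eval] using h20, ?_⟩
      have hS' := hS.of_low hlow
      refine Runs.seqSame (runs_descend hA hS' hN) fun σ₂ ⟨K, hN₂⟩ s₂ => ?_
      have hlow₂ : Low σ σ₂ := hlow.of_same s₂ (by decide) (by decide)
      have hM : MaxClique adj ν K := hN₂.maxClique
      refine Runs.seqSame (hL σ₂ K hlow₂ hM hN₂.codes) fun σ₃ hout₃ s₃ => ?_
      have hlow₃ : Low σ σ₃ := hlow₂.of_same s₃ (fun y hy => hv y (by omega))
        fun a h => ha a (by omega)
      obtain ⟨-, h9, -, -, h0, -, R', hR, hP⟩ := hN₂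
      have hR : R = K :: R' := by simpa [leaves] using hR
      rw [← s₃.var 9 (hv 9 (by decide))] at h9
      rw [← s₃.arr 12 (ha 12 (by decide))] at h0 hP
      rw [← s₃.arr 11 (ha 11 (by decide))] at hP
      have h20₃ : σ₃.var 20 = 1 := by rw [s₃.var 20 hv20, s₂.var 20 rfl, h20]
      have hout₃' : σ₃.out ++ R'.flatMap g = total := by
        rw [hout₃, s₂.out rfl, ← hout, hR, List.flatMap_cons, List.append_assoc]
      obtain ⟨l, hl, hz, h1, htop⟩ := hP.top h0
      refine Runs.seqSame (runs_goBack hl (by omega) (by omega) h9 hz h1) fun σ₄ h9₄ s₄ => ?_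
      have hlow₄ : Low σ σ₄ := hlow₃.of_same s₄ (by decide) (by decide)
      have e11 := s₄.arr 11 rfl
      have e12 := s₄.arr 12 rfl
      have eout := s₄.out rfl
      have hr' : R'.length = r := by
        rw [hR, List.length_cons] at hr
        omega
      refine Runs.cond ?_ (fun hc => ?_) (fun hc => ?_)
      · simp only [Test.Fits, Fits, h9₄]
        omega
      · simp only [Test.Holds, eval, h9₄] at hc
        subst hc
        obtain rfl : R' = [] := by
          rcases htop with ⟨-, h⟩ | ⟨l₀, C', R'', h, -⟩
          exacts [h, by omega]
        refine ((Runs.of_wp (p := .set 20 (.const 0)) (Q := fun τ => τ.var 20 = 0)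
          ?_).withSame).mono (by simp [scost, cost]; omega) fun τ ⟨h20, s₅⟩ =>
            ⟨[], hr', hlow₄.of_same s₅ (by decide) (by decide), ?_, .inl ⟨hr'.symm, h20⟩⟩
        · simp [wp, Fits, eval]
          omega
        · rw [s₅.out rfl, eout]
          exact hout₃'
      · simp only [Test.Holds, eval, h9₄] at hc
        obtain ⟨h, -⟩ | ⟨l₀, C', R'', hl₀, hR', hC', hM', hP'⟩ := htop
        · exact absurd h hc
        refine (runs_restore (hS.of_low hlow₄) h9₄ hl (e11.symm ▸ hC')).withSame.mono le_rfl
          fun τ ⟨⟨h8, h12⟩, s₅⟩ => ⟨R', hr', hlow₄.of_same s₅ (by decide) (by decide), ?_, .inr ⟨?_,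
            ?_, ν - l, l, C', by omega, (s₅.var 9 rfl).trans h9₄, h8, hM', ?_, fun l' h h' => ?_,
            R'', hR', ?_⟩⟩
        · rw [s₅.out rfl, eout]
          exact hout₃'
        · have := List.length_pos_of_ne_nil (leaves_ne_nil (adj := adj) (ν - l) l C')
          rw [← hr', hR', List.length_append]
          omega
        · rw [s₅.var 20 rfl, s₄.var 20 rfl, h20₃]
        · rw [h12, Function.update_of_ne (by omega), e12, h0]
        · rw [h12, Function.update_of_ne (by omega), e12, hz l' h h']
        · rw [hl₀]
          refine .skip (by rw [h12, ← hl₀, Function.update_self]) (hP'.congr (fun l' h h' => ?_)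
            fun y hy => ?_)
          · rw [h12, Function.update_of_ne (by omega), e12]
          · rw [s₅.arr 11 rfl, e11]
    · exact List.length_pos_of_ne_nil (leaves_ne_nil _ _ _)
    · rintro τ ⟨R, hR, -, hout, -⟩
      rw [List.length_eq_zero_iff] at hR
      simpa [hR] using hout
  -- The cost of one leaf: at most `ν` steps of the descent, the call of `leaf`, and backtracking
  -- and restoring, which are linear in `ν`.
  · have h1 : ν * (200 * (μ + ν + 1) + 4) + 4 + (TL + (ν * 9 + 5 + (4 + (3 + (ν * (12 + 8) + 6)))))
        + 3 + 1 ≤ 300 * (ν + 1) * (μ + ν + 1) + TL := by nlinarith [Nat.zero_le (ν * μ)]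
    have h2 := Nat.mul_le_mul_left (leaves adj ν 0 ∅).length h1
    omega

end CliqueTree

namespace CliqueTree

open Finset WordRAM WordRAM.Program WordRAM.Expr

/-! ### The graph of the edges that are active during an interval -/

/-- The numbers and arrays of an input. -/
structure Input where
  n : ℕ
  m : ℕ
  T : ℕ
  p : ℕ → ℕ
  q : ℕ → ℕ
  s : ℕ → ℕ
  t : ℕ → ℕ

namespace Input

/-- The input describes a simple graph with intervals on its edges. -/
structure Valid (X : Input) : Prop where
  p_mem : ∀ e < X.m, 1 ≤ X.p e ∧ X.p e ≤ X.n
  q_mem : ∀ e < X.m, 1 ≤ X.q e ∧ X.q e ≤ X.n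
  ne : ∀ e < X.m, X.p e ≠ X.q e
  le : ∀ e < X.m, X.s e ≤ X.t e
  le_T : ∀ e < X.m, X.t e ≤ X.T
  simple : ∀ e < X.m, ∀ e' < X.m, (X.p e = X.p e' ∧ X.q e = X.q e') ∨
    (X.p e = X.q e' ∧ X.q e = X.p e') → e = e'

/-- The input is stored in memory. -/
structure InMem (X : Input) (σ : Config) : Prop where
  var1 : σ.var 1 = X.m
  var2 : σ.var 2 = X.T
  arr0 : σ.arr 0 = X.p
  arr1 : σ.arr 1 = X.q
  arr2 : σ.arr 2 = X.s
  arr3 : σ.arr 3 = X.t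

theorem InMem.of_same {X : Input} {σ σ' : Config} {p : Program} (h : X.InMem σ)
    (hs : Same p σ σ') (hv : ∀ y < 3, p.wv y = false) (ha : ∀ a < 4, p.wa a = false) :
    X.InMem σ' :=
  ⟨(hs.var 1 (hv 1 (by decide))).trans h.var1, (hs.var 2 (hv 2 (by decide))).trans h.var2,
    (hs.arr 0 (ha 0 (by decide))).trans h.arr0, (hs.arr 1 (ha 1 (by decide))).trans h.arr1,
    (hs.arr 2 (ha 2 (by decide))).trans h.arr2, (hs.arr 3 (ha 3 (by decide))).trans h.arr3⟩

/-- The edge number `e` is active during the interval from `a` to `b`. -/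
def Act (X : Input) (a b e : ℕ) : Prop := X.s e ≤ a ∧ b ≤ X.t e

/-- The labels of the end vertices of edges. -/
def ends (X : Input) : Set ℕ := {u | ∃ e < X.m, X.p e = u ∨ X.q e = u}

/-- The labels of the end vertices of the active ones among the first `k` edges. -/
def actEnds (X : Input) (a b k : ℕ) : Set ℕ := {u | ∃ e < k, X.Act a b e ∧ (X.p e = u ∨ X.q e = u)}

theorem actEnds_zero (X : Input) (a b : ℕ) : X.actEnds a b 0 = ∅ := by simp [actEnds]

theorem actEnds_succ_of_act {X : Input} {a b k : ℕ} (h : X.Act a b k) :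
    X.actEnds a b (k + 1) = insert (X.q k) (insert (X.p k) (X.actEnds a b k)) := by
  ext u
  simp only [actEnds, Set.mem_ofPred_eq, Set.mem_insert_iff]
  constructor
  · rintro ⟨e, he, ha, h'⟩
    rcases Nat.lt_succ_iff_lt_or_eq.1 he with he | rfl
    · exact .inr (.inr ⟨e, he, ha, h'⟩)
    · rcases h' with rfl | rfl
      exacts [.inr (.inl rfl), .inl rfl]
  · rintro (rfl | rfl | ⟨e, he, h'⟩)
    exacts [⟨k, by omega, h, .inr rfl⟩, ⟨k, by omega, h, .inl rfl⟩, ⟨e, by omega, h'⟩]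

theorem actEnds_succ_of_not_act {X : Input} {a b k : ℕ} (h : ¬ X.Act a b k) :
    X.actEnds a b (k + 1) = X.actEnds a b k := by
  ext u
  simp only [actEnds, Set.mem_ofPred_eq]
  constructor
  · rintro ⟨e, he, ha, h'⟩
    rcases Nat.lt_succ_iff_lt_or_eq.1 he with he | rfl
    exacts [⟨e, he, ha, h'⟩, absurd ha h]
  · rintro ⟨e, he, h'⟩
    exact ⟨e, by omega, h'⟩

theorem actEnds_subset (X : Input) {a b k : ℕ} (hk : k ≤ X.m) : X.actEnds a b k ⊆ X.ends := by
  rintro u ⟨e, he, -, h⟩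
  exact ⟨e, by omega, h⟩

theorem Valid.mem_labels {X : Input} (hX : X.Valid) {u : ℕ} (hu : u ∈ X.ends) : u ∈ Icc 1 X.n := by
  obtain ⟨e, he, rfl | rfl⟩ := hu
  exacts [mem_Icc.2 (hX.p_mem e he), mem_Icc.2 (hX.q_mem e he)]

end Input

/-- The function `f` numbers the members of `M ⊆ E` from `1` to `ν`, and vanishes on `E \ M`. -/
structure Numbers (E M : Set ℕ) (f : ℕ → ℕ) (ν : ℕ) : Prop where
  mem_iff : ∀ u ∈ E, f u ≠ 0 ↔ u ∈ M
  subset : M ⊆ E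
  le : ∀ u ∈ M, f u ≤ ν
  inj : ∀ u ∈ M, ∀ v ∈ M, f u = f v → u = v
  surj : ∀ x < ν, ∃ u ∈ M, f u = x + 1

variable {E M : Set ℕ} {f : ℕ → ℕ} {ν u : ℕ}

theorem Numbers.pos (h : Numbers E M f ν) (hu : u ∈ M) : 0 < f u :=
  Nat.pos_of_ne_zero ((h.mem_iff u (h.subset hu)).2 hu)

theorem Numbers.insert_of_ne (h : Numbers E M f ν) (hu : u ∈ E) (h0 : f u ≠ 0) :
    Numbers E (insert u M) f ν := by
  rwa [Set.insert_eq_of_mem ((h.mem_iff u hu).1 h0)]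

theorem Numbers.insert_of_eq (h : Numbers E M f ν) (hu : u ∈ E) (h0 : f u = 0) :
    Numbers E (insert u M) (Function.update f u (ν + 1)) (ν + 1) := by
  have huM : u ∉ M := fun hM => (h.mem_iff u hu).2 hM h0
  have hne : ∀ v ∈ M, v ≠ u := fun v hv e => huM (e ▸ hv)
  refine ⟨fun v hv => ?_, Set.insert_subset hu h.subset, fun v hv => ?_, fun v hv w hw hvw => ?_,
    fun x hx => ?_⟩
  · by_cases hvu : v = u
    · simp [hvu]
    · simp [hvu, Function.update_of_ne, h.mem_iff v hv]
  · rcases hv with rfl | hv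
    · simp
    · rw [Function.update_of_ne (hne v hv)]
      exact (h.le v hv).trans (by omega)
  · rcases hv with rfl | hv <;> rcases hw with hw | hw
    · exact hw.symm
    · rw [Function.update_self, Function.update_of_ne (hne w hw)] at hvw
      have := h.le w hw
      omega
    · rw [hw, Function.update_self, Function.update_of_ne (hne v hv)] at hvw
      have := h.le v hv
      omega
    · rw [Function.update_of_ne (hne w hw), Function.update_of_ne (hne v hv)] at hvw
      exact h.inj v hv w hw hvw
  · rcases Nat.lt_succ_iff_lt_or_eq.1 hx with hx | rfl
    · obtain ⟨v, hv, hvx⟩ := h.surj x hx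
      exact ⟨v, .inr hv, by rw [Function.update_of_ne (hne v hv), hvx]⟩
    · exact ⟨u, .inl rfl, by simp⟩

theorem Numbers.le_of_subset (h : Numbers E M f ν) {n : ℕ} (hE : ∀ u ∈ E, u ∈ Icc 1 n) :
    ν ≤ n := by
  choose! g hg hfg using h.surj
  have := card_le_card_of_injOn (s := range ν) (t := Icc 1 n) g
    (fun x hx => hE _ (h.subset (hg x (by simpa using hx))))
    (fun x hx y hy hxy => by
      have h1 := hfg x (by simpa using hx)
      have h2 := hfg y (by simpa using hy)
      rw [hxy] at h1
      omega)
  simpa using this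

/-- The first `μ` arcs `(P j, Q j)` are distinct and are the pairs in the relation `r`. -/
structure Lists (μ : ℕ) (P Q : ℕ → ℕ) (r : ℕ → ℕ → Prop) : Prop where
  iff : ∀ x y, r x y ↔ ∃ j < μ, P j = x ∧ Q j = y
  inj : ∀ j < μ, ∀ j' < μ, P j = P j' → Q j = Q j' → j = j'

theorem Lists.push {μ : ℕ} {P Q : ℕ → ℕ} {r : ℕ → ℕ → Prop} (h : Lists μ P Q r) {x y : ℕ}
    (hxy : ¬ r x y) : Lists (μ + 1) (Function.update P μ x) (Function.update Q μ y)
      fun x' y' => r x' y' ∨ (x' = x ∧ y' = y) := by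
  have hold : ∀ j < μ, Function.update P μ x j = P j ∧ Function.update Q μ y j = Q j :=
    fun j hj => ⟨Function.update_of_ne hj.ne _ _, Function.update_of_ne hj.ne _ _⟩
  refine ⟨fun x' y' => ⟨?_, ?_⟩, fun j hj j' hj' hP hQ => ?_⟩
  · rintro (h' | ⟨rfl, rfl⟩)
    · obtain ⟨j, hj, hP, hQ⟩ := (h.iff x' y').1 h'
      exact ⟨j, by omega, (hold j hj).1.trans hP, (hold j hj).2.trans hQ⟩
    · exact ⟨μ, by omega, by simp, by simp⟩
  · rintro ⟨j, hj, hP, hQ⟩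
    rcases Nat.lt_succ_iff_lt_or_eq.1 hj with hj | rfl
    · rw [(hold j hj).1] at hP
      rw [(hold j hj).2] at hQ
      exact .inl ((h.iff x' y').2 ⟨j, hj, hP, hQ⟩)
    · simp only [Function.update_self] at hP hQ
      exact .inr ⟨hP.symm, hQ.symm⟩
  · rcases Nat.lt_succ_iff_lt_or_eq.1 hj with hj | rfl <;>
      rcases Nat.lt_succ_iff_lt_or_eq.1 hj' with hj' | hj'
    · rw [(hold j hj).1, (hold j' hj').1] at hP
      rw [(hold j hj).2, (hold j' hj').2] at hQ
      exact h.inj j hj j' hj' hP hQ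
    · subst hj'
      rw [(hold j hj).1, Function.update_self] at hP
      rw [(hold j hj).2, Function.update_self] at hQ
      exact absurd ((h.iff x y).2 ⟨j, hj, hP, hQ⟩) hxy
    · rw [(hold j' hj').1, Function.update_self] at hP
      rw [(hold j' hj').2, Function.update_self] at hQ
      exact absurd ((h.iff x y).2 ⟨j', hj', hP.symm, hQ.symm⟩) hxy
    · omega

/-- The adjacency relation of the renumbered graph of the active ones among the first `k` edges. -/
def Input.adj (X : Input) (a b : ℕ) (f : ℕ → ℕ) (k x y : ℕ) : Prop :=
  ∃ e < k, X.Act a b e ∧ ((x = f (X.p e) - 1 ∧ y = f (X.q e) - 1) ∨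
    (x = f (X.q e) - 1 ∧ y = f (X.p e) - 1))

/-- Erase the numbers of all vertices. -/
def eraseNumbers : Program :=
  forTo 10 1 (.store 4 (.load 0 (.var 10)) (.const 0) ;; .store 4 (.load 1 (.var 10)) (.const 0))

/-- Give a number to the end vertex of the current edge that array `a` contains. -/
def assignNumber (a : ℕ) : Program :=
  .cond (.eq (.load 4 (.load a (.var 10))) (.const 0))
    (.set 7 (.add (.var 7) (.const 1)) ;; .store 4 (.load a (.var 10)) (.var 7)) .nop

/-- Run `p` if the edge whose number is in variable `x` is active. -/
def ifActive (x : ℕ) (p : Program) : Program :=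
  .cond (.lt (.var 5) (.load 2 (.var x))) .nop (.cond (.lt (.load 3 (.var x)) (.var 6)) .nop p)

/-- Number the end vertices of all active edges. -/
def assignNumbers : Program :=
  .set 7 (.const 0) ;; forTo 10 1 (ifActive 10 (assignNumber 0 ;; assignNumber 1))

/-- Append an arc to the list of arcs. -/
def pushArc (a a' : ℕ) : Program :=
  .store 5 (.var 8) (.sub (.load 4 (.load a (.var 10))) (.const 1)) ;;
  .store 6 (.var 8) (.sub (.load 4 (.load a' (.var 10))) (.const 1)) ;;
  .set 8 (.add (.var 8) (.const 1))

/-- List the arcs of the graph of the active edges. -/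
def listArcs : Program :=
  .set 8 (.const 0) ;; forTo 10 1 (ifActive 10 (pushArc 0 1 ;; pushArc 1 0))

/-- Store the graph of the active edges. -/
def build : Program := eraseNumbers ;; assignNumbers ;; listArcs

variable {X : Input} {W a b : ℕ} {σ : Config}

theorem runs_ifActive {x e T : ℕ} {p : Program} {R : Config → Prop} (hX : X.Valid)
    (hM : X.InMem σ) (hW : X.n * X.n + 2 * X.n + 4 * X.m + X.T + 10 ≤ W) (he : e < X.m)
    (hx : σ.var x = e) (h5 : σ.var 5 = a) (h6 : σ.var 6 = b) (ha : a < W) (hb : b < W) (hT : 1 ≤ T)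
    (hp : X.Act a b e → Runs W p σ T R) (hn : ¬ X.Act a b e → R σ) :
    Runs W (ifActive x p) σ (5 + (5 + T)) R := by
  have h1 := hX.le e he
  have h2 := hX.le_T e he
  have hnop : R σ → Runs W .nop σ 1 R := fun h => Runs.of_wp (p := .nop) h
  refine Runs.cond ?_ (fun hc => (hnop (hn ?_)).mono (by omega) fun _ => id)
    fun hc => Runs.cond ?_ (fun hc' => (hnop (hn ?_)).mono (by omega) fun _ => id) fun hc' => hp ?_
  · simp only [Test.Fits, Fits, eval, h5, hx, hM.arr2]
    omega
  · simp only [Test.Holds, eval, h5, hx, hM.arr2] at hc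
    simp only [Input.Act]
    omega
  · simp only [Test.Fits, Fits, eval, h6, hx, hM.arr3]
    omega
  · simp only [Test.Holds, eval, h6, hx, hM.arr3] at hc'
    simp only [Input.Act]
    omega
  · simp only [Test.Holds, eval, h5, h6, hx, hM.arr2, hM.arr3] at hc hc'
    simp only [Input.Act]
    omega

/-- Only the labels that occur as ends of edges are reset, which is enough for `Numbers` and costs
time linear in the number of edges. -/
theorem runs_eraseNumbers (hX : X.Valid) (hM : X.InMem σ)
    (hW : X.n * X.n + 2 * X.n + 4 * X.m + X.T + 10 ≤ W) :
    Runs W eraseNumbers σ (X.m * (8 + 8) + 6) fun σ' => ∀ u ∈ X.ends, σ'.arr 4 u = 0 := by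
  refine (Runs.forTo (B := X.m) (T := 8) (I := fun k σ' => ∀ e < k, σ'.arr 4 (X.p e) = 0 ∧
    σ'.arr 4 (X.q e) = 0) (by omega) (by omega) hM.var1 rfl rfl (by decide) (by simp) ?_).mono
    le_rfl ?_
  · intro k hk σ' hs hx hI
    have e0 := (hs.arr 0 rfl).trans hM.arr0
    have e1 := (hs.arr 1 rfl).trans hM.arr1
    have h1 := hX.p_mem k hk
    have h2 := hX.q_mem k hk
    refine (Runs.of_wp ?_).mono (by decide) fun _ => id
    simp [-Order.lt_add_one_iff, and_assoc, wp, Fits, eval, hx, e0, e1]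
    repeat (refine ⟨by omega, ?_⟩)
    intro e he
    have key : ∀ u, (e < k → σ'.arr 4 u = 0) → (e = k → u = X.p k ∨ u = X.q k) →
        Function.update (Function.update (σ'.arr 4) (X.p k) 0) (X.q k) 0 u = 0 := by
      intro u hu hu'
      by_cases h : u = X.q k
      · rw [h, Function.update_self]
      · rw [Function.update_of_ne h]
        by_cases h' : u = X.p k
        · rw [h', Function.update_self]
        · rw [Function.update_of_ne h']
          refine hu ?_
          by_contra hek
          exact (hu' (by omega)).elim h' h
    exact ⟨key _ (fun h => (hI e h).1) fun h => .inl (by rw [h]),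
      key _ (fun h => (hI e h).2) fun h => .inr (by rw [h])⟩
  · rintro σ' ⟨hI, -⟩ u ⟨e, he, rfl | rfl⟩
    exacts [(hI e he).1, (hI e he).2]

theorem runs_assignNumber {c e : ℕ} (hX : X.Valid)
    (hW : X.n * X.n + 2 * X.n + 4 * X.m + X.T + 10 ≤ W) (he : e < X.m)
    (hx : σ.var 10 = e) (hu : u ∈ X.ends) (hcu : σ.arr c e = u)
    (hN : Numbers X.ends M (σ.arr 4) (σ.var 7)) :
    Runs W (assignNumber c) σ 14 fun σ' => Numbers X.ends (insert u M) (σ'.arr 4) (σ'.var 7) := by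
  have hν := hN.le_of_subset fun u hu => hX.mem_labels hu
  have hu' := mem_Icc.1 (hX.mem_labels hu)
  have hf : σ.arr 4 u ≤ X.n := by
    rcases eq_or_ne (σ.arr 4 u) 0 with h | h
    · omega
    · exact (hN.le u ((hN.mem_iff u hu).1 h)).trans hν
  refine (Runs.of_wp ?_).mono (Nat.le_of_ble_eq_true rfl) fun _ => id
  simp [-Order.lt_add_one_iff, and_assoc, assignNumber, wp, Fits, Test.Fits, Test.Holds, eval, hx,
    hcu]
  repeat (refine ⟨by omega, ?_⟩)
  refine ⟨fun h => ?_, fun h => hN.insert_of_ne hu h⟩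
  repeat (refine ⟨by omega, ?_⟩)
  exact hN.insert_of_eq hu h

theorem runs_assignNumbers (hX : X.Valid) (hM : X.InMem σ)
    (hW : X.n * X.n + 2 * X.n + 4 * X.m + X.T + 10 ≤ W) (h5 : σ.var 5 = a) (h6 : σ.var 6 = b)
    (ha : a < W) (hb : b < W) (h4 : ∀ u ∈ X.ends, σ.arr 4 u = 0) :
    Runs W assignNumbers σ (2 + (X.m * (38 + 8) + 6)) fun σ' =>
      Numbers X.ends (X.actEnds a b X.m) (σ'.arr 4) (σ'.var 7) := by
  refine Runs.seqSame (Q' := fun τ => τ.var 7 = 0 ∧ τ.arr 4 = σ.arr 4)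
    ((Runs.of_wp ?_).mono (by decide) fun _ => id) fun σ₁ ⟨h7, h4'⟩ s₁ => ?_
  · simp [wp, Fits, eval]
    omega
  have hM₁ := hM.of_same s₁ (by decide) (by decide)
  have h5₁ := (s₁.var 5 rfl).trans h5
  have h6₁ := (s₁.var 6 rfl).trans h6
  refine (Runs.forTo (B := X.m) (T := 38) (I := fun k σ' =>
    Numbers X.ends (X.actEnds a b k) (σ'.arr 4) (σ'.var 7)) (by omega) (by omega) hM₁.var1
    rfl rfl (by decide) ?_ ?_).mono le_rfl fun σ' h => h.1
  · rw [X.actEnds_zero]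
    refine ⟨fun u hu => ?_, by simp, by simp, by simp, fun x hx => ?_⟩
    · simp [h4', h4 u hu]
    · simp [h7] at hx
  · intro k hk σ' hs hx hI
    have hM' := hM₁.of_same hs (by decide) (by decide)
    have h5' := (hs.var 5 rfl).trans h5₁
    have h6' := (hs.var 6 rfl).trans h6₁
    refine runs_ifActive (T := 14 + 14) hX hM' hW hk hx h5' h6' ha hb (by omega) (fun hact => ?_)
      fun hact => ?_
    · refine Runs.seqSame (runs_assignNumber hX hW hk hx ⟨k, hk, .inl rfl⟩
        (by rw [hM'.arr0]) hI) fun σ₂ hI₂ s₂ => ?_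
      refine (runs_assignNumber (c := 1) hX hW hk ((s₂.var 10 rfl).trans hx)
        ⟨k, hk, .inr rfl⟩ (by rw [s₂.arr 1 rfl, hM'.arr1]) hI₂).mono le_rfl fun σ₃ h => ?_
      rw [Input.actEnds_succ_of_act hact]
      exact h
    · rw [Input.actEnds_succ_of_not_act hact]
      exact hI

theorem Input.adj_succ_of_act {k : ℕ} (h : X.Act a b k) : X.adj a b f (k + 1) = fun x y =>
    (X.adj a b f k x y ∨ (x = f (X.p k) - 1 ∧ y = f (X.q k) - 1)) ∨
      (x = f (X.q k) - 1 ∧ y = f (X.p k) - 1) := by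
  ext x y
  simp only [Input.adj]
  constructor
  · rintro ⟨e, he, ha, h'⟩
    rcases Nat.lt_succ_iff_lt_or_eq.1 he with he | rfl
    · exact .inl (.inl ⟨e, he, ha, h'⟩)
    · exact h'.imp .inr id
  · rintro ((⟨e, he, h'⟩ | h') | h')
    exacts [⟨e, by omega, h'⟩, ⟨k, by omega, h, .inl h'⟩, ⟨k, by omega, h, .inr h'⟩]

theorem Input.adj_succ_of_not_act {k : ℕ} (h : ¬ X.Act a b k) :
    X.adj a b f (k + 1) = X.adj a b f k := by
  ext x y
  simp only [Input.adj]
  constructor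
  · rintro ⟨e, he, ha, h'⟩
    rcases Nat.lt_succ_iff_lt_or_eq.1 he with he | rfl
    exacts [⟨e, he, ha, h'⟩, absurd ha h]
  · rintro ⟨e, he, h'⟩
    exact ⟨e, by omega, h'⟩

theorem Input.adj_symm {k x y : ℕ} (h : X.adj a b f k x y) : X.adj a b f k y x := by
  obtain ⟨e, he, ha, h | h⟩ := h
  exacts [⟨e, he, ha, .inr h.symm⟩, ⟨e, he, ha, .inl h.symm⟩]

theorem runs_pushArc {c c' e μ x y : ℕ} {r : ℕ → ℕ → Prop}
    (hc : c' ≠ 5) (hx : σ.var 10 = e) (he : e < W)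
    (h8 : σ.var 8 = μ) (hμ : μ + 1 < W) (hcW : σ.arr c e < W) (hcW' : σ.arr c' e < W)
    (h4W : σ.arr 4 (σ.arr c e) < W) (h4W' : σ.arr 4 (σ.arr c' e) < W)
    (hcx : σ.arr 4 (σ.arr c e) - 1 = x) (hcy : σ.arr 4 (σ.arr c' e) - 1 = y)
    (h : Lists μ (σ.arr 5) (σ.arr 6) r) (hxy : ¬ r x y) :
    Runs W (pushArc c c') σ 18 fun σ' => σ'.var 8 = μ + 1 ∧
      Lists (μ + 1) (σ'.arr 5) (σ'.arr 6) fun x' y' => r x' y' ∨ (x' = x ∧ y' = y) := by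
  refine (Runs.of_wp ?_).mono (Nat.le_of_ble_eq_true rfl) fun _ => id
  simp [-Order.lt_add_one_iff, and_assoc, pushArc, wp, Fits, eval, hx, h8, hc, hcx, hcy]
  repeat (refine ⟨by omega, ?_⟩)
  exact h.push hxy

theorem Input.not_adj_self (hX : X.Valid) (hN : Numbers X.ends (X.actEnds a b X.m) f ν) {x : ℕ} :
    ¬ X.adj a b f X.m x x := by
  rintro ⟨e, he, ha, h⟩
  have hp : X.p e ∈ X.actEnds a b X.m := ⟨e, he, ha, .inl rfl⟩
  have hq : X.q e ∈ X.actEnds a b X.m := ⟨e, he, ha, .inr rfl⟩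
  have := hN.pos hp
  have := hN.pos hq
  exact hX.ne e he (hN.inj _ hp _ hq (by omega))

theorem runs_listArcs (hX : X.Valid) (hM : X.InMem σ)
    (hW : X.n * X.n + 2 * X.n + 4 * X.m + X.T + 10 ≤ W) (h5 : σ.var 5 = a) (h6 : σ.var 6 = b)
    (ha : a < W) (hb : b < W) (hN : Numbers X.ends (X.actEnds a b X.m) (σ.arr 4) ν) :
    Runs W listArcs σ (2 + (X.m * (46 + 8) + 6)) fun σ' => σ'.var 8 ≤ 2 * X.m ∧
      Lists (σ'.var 8) (σ'.arr 5) (σ'.arr 6) (X.adj a b (σ.arr 4) X.m) := by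
  have hν := hN.le_of_subset fun u hu => hX.mem_labels hu
  refine Runs.seqSame (Q' := fun τ => τ.var 8 = 0)
    ((Runs.of_wp ?_).mono (by decide) fun _ => id) fun σ₁ h8 s₁ => ?_
  · simp [wp, Fits, eval]
    omega
  have hM₁ := hM.of_same s₁ (by decide) (by decide)
  have h5₁ := (s₁.var 5 rfl).trans h5
  have h6₁ := (s₁.var 6 rfl).trans h6
  refine (Runs.forTo (B := X.m) (T := 46) (I := fun k σ' => σ'.var 8 ≤ 2 * k ∧
      Lists (σ'.var 8) (σ'.arr 5) (σ'.arr 6) (X.adj a b (σ.arr 4) k)) (by omega) (by omega) hM₁.var1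
    rfl rfl (by decide) ?_ ?_).mono le_rfl fun σ' h => h.1
  · simp [h8]
    exact ⟨by simp [Input.adj], by simp⟩
  · intro k hk σ' hs hx ⟨hμ, hI⟩
    have hM' := hM₁.of_same hs (by decide) (by decide)
    have h5' := (hs.var 5 rfl).trans h5₁
    have h6' := (hs.var 6 rfl).trans h6₁
    have e4 := (hs.arr 4 rfl).trans (s₁.arr 4 rfl)
    refine runs_ifActive (T := 18 + 18) hX hM' hW hk hx h5' h6' ha hb (by omega) (fun hact => ?_)
      fun hact => ?_
    · have hp : X.p k ∈ X.actEnds a b X.m := ⟨k, hk, hact, .inl rfl⟩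
      have hq : X.q k ∈ X.actEnds a b X.m := ⟨k, hk, hact, .inr rfl⟩
      have := hN.pos hp
      have := hN.pos hq
      have := hN.le _ hp
      have := hN.le _ hq
      have := (hX.p_mem k hk).2
      have := (hX.q_mem k hk).2
      -- An equal arc from an earlier edge would, as the numbering is injective, give two edges with
      -- the same ends. The same argument covers the reversed arc, by symmetry.
      have hnew : ∀ x y, X.adj a b (σ.arr 4) k x y →
          ¬ (x = σ.arr 4 (X.p k) - 1 ∧ y = σ.arr 4 (X.q k) - 1) := by
        rintro x y ⟨e, he, hea, h⟩ ⟨hx, hy⟩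
        have hp' : X.p e ∈ X.actEnds a b X.m := ⟨e, he.trans hk, hea, .inl rfl⟩
        have hq' : X.q e ∈ X.actEnds a b X.m := ⟨e, he.trans hk, hea, .inr rfl⟩
        have := hN.pos hp'
        have := hN.pos hq'
        refine he.ne (hX.simple e (he.trans hk) k hk ?_)
        rcases h with h | h
        · exact .inl ⟨hN.inj _ hp' _ hp (by omega), hN.inj _ hq' _ hq (by omega)⟩
        · exact .inr ⟨hN.inj _ hp' _ hq (by omega), hN.inj _ hq' _ hp (by omega)⟩
      have hne : σ.arr 4 (X.p k) ≠ σ.arr 4 (X.q k) := fun h => hX.ne k hk (hN.inj _ hp _ hq h)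
      refine Runs.seqSame (runs_pushArc (c := 0) (c' := 1) (μ := σ'.var 8)
        (x := σ.arr 4 (X.p k) - 1) (y := σ.arr 4 (X.q k) - 1) (by decide) hx (by omega)
        rfl (by omega) ?_ ?_ ?_ ?_ ?_ ?_ hI fun h => hnew _ _ h ⟨rfl, rfl⟩)
        fun σ₂ ⟨h8₂, hI₂⟩ s₂ => ?_
      iterate 6
        · simp only [hM'.arr0, hM'.arr1, e4] <;> omega
      refine (runs_pushArc (c := 1) (c' := 0) (μ := σ'.var 8 + 1) (e := k)
        (x := σ.arr 4 (X.q k) - 1) (y := σ.arr 4 (X.p k) - 1) (by decide)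
        ((s₂.var 10 rfl).trans hx) (by omega)
        h8₂ (by omega) ?_ ?_ ?_ ?_ ?_ ?_ hI₂ ?_).mono le_rfl fun σ₃ ⟨h8₃, hI₃⟩ => ?_
      iterate 6
        · simp only [s₂.arr 0 rfl, s₂.arr 1 rfl, s₂.arr 4 rfl, hM'.arr0, hM'.arr1, e4] <;> omega
      · rintro (h | h)
        · exact hnew _ _ (Input.adj_symm h) ⟨rfl, rfl⟩
        · omega
      · simp only [Config.setVar_var, Config.setVar_arr, h8₃]
        refine ⟨by norm_num; omega, ?_⟩
        rw [Input.adj_succ_of_act hact]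
        exact hI₃
    · rw [Input.adj_succ_of_not_act hact]
      refine ⟨?_, hI⟩
      simp only [Config.setVar_var]
      norm_num
      omega

theorem runs_build (hX : X.Valid) (hM : X.InMem σ)
    (hW : X.n * X.n + 2 * X.n + 4 * X.m + X.T + 10 ≤ W) (h5 : σ.var 5 = a) (h6 : σ.var 6 = b)
    (ha : a < W) (hb : b < W) :
    Runs W build σ (200 * (X.m + 1)) fun σ' => σ'.var 7 ≤ X.n ∧ σ'.var 8 ≤ 2 * X.m ∧
      Stored W (σ'.var 7) (σ'.var 8) (σ'.arr 5) (σ'.arr 6) σ' ∧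
      Numbers X.ends (X.actEnds a b X.m) (σ'.arr 4) (σ'.var 7) ∧
      Arcs (σ'.var 7) (σ'.var 8) (σ'.arr 5) (σ'.arr 6) (X.adj a b (σ'.arr 4) X.m) := by
  refine Runs.mono (T := (X.m * (8 + 8) + 6) + ((2 + (X.m * (38 + 8) + 6)) +
    (2 + (X.m * (46 + 8) + 6)))) ?_ (by omega) fun _ => id
  refine Runs.seqSame (runs_eraseNumbers hX hM hW) fun σ₁ h₁ s₁ => ?_
  have hM₁ := hM.of_same s₁ (by decide) (by decide)
  have h5₁ := (s₁.var 5 rfl).trans h5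
  have h6₁ := (s₁.var 6 rfl).trans h6
  refine Runs.seqSame (runs_assignNumbers hX hM₁ hW h5₁ h6₁ ha hb h₁) fun σ₂ hN s₂ => ?_
  have hM₂ := hM₁.of_same s₂ (by decide) (by decide)
  have h5₂ := (s₂.var 5 rfl).trans h5₁
  have h6₂ := (s₂.var 6 rfl).trans h6₁
  refine (runs_listArcs hX hM₂ hW h5₂ h6₂ ha hb hN).withSame.mono le_rfl fun σ₃ ⟨⟨h8, hL⟩, s₃⟩ => ?_
  rw [← s₃.arr 4 rfl, ← s₃.var 7 rfl] at hN
  rw [← s₃.arr 4 rfl] at hL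
  have hν := hN.le_of_subset fun u hu => hX.mem_labels hu
  have := Nat.mul_le_mul hν hν
  refine ⟨hν, h8, ⟨rfl, rfl, rfl, rfl, by omega⟩, hN, ⟨fun j hj => ?_, hL.inj, hL.iff,
    fun x y => Input.adj_symm, fun x => Input.not_adj_self hX hN⟩⟩
  obtain ⟨e, he, hea, h⟩ := (hL.iff _ _).2 ⟨j, hj, rfl, rfl⟩
  have hp : X.p e ∈ X.actEnds a b X.m := ⟨e, he, hea, .inl rfl⟩
  have hq : X.q e ∈ X.actEnds a b X.m := ⟨e, he, hea, .inr rfl⟩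
  have := hN.pos hp
  have := hN.pos hq
  have := hN.le _ hp
  have := hN.le _ hq
  omega

end CliqueTree

namespace CliqueTree

open Finset WordRAM WordRAM.Program WordRAM.Expr

/-! ### The output for one interval -/

namespace Input

/-- The edge `e` is active during the interval, and its end vertices are in `U`. -/
def Inside (X : Input) (a b : ℕ) (U : Finset ℕ) (e : ℕ) : Prop :=
  X.Act a b e ∧ X.p e ∈ U ∧ X.q e ∈ U

/-- There is an edge between `u` and `v` that is active during the interval. -/
def Joined (X : Input) (a b u v : ℕ) : Prop :=
  ∃ e < X.m, X.Act a b e ∧ ((X.p e = u ∧ X.q e = v) ∨ (X.p e = v ∧ X.q e = u))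

/-- `U` is a maximal clique of the graph of the active edges. -/
structure IsMaxClique (X : Input) (a b : ℕ) (U : Finset ℕ) : Prop where
  sub : ∀ u ∈ U, u ∈ X.actEnds a b X.m
  clique : ∀ u ∈ U, ∀ v ∈ U, u ≠ v → X.Joined a b u v
  maximal : ∀ w ∈ X.actEnds a b X.m, w ∉ U → ∃ u ∈ U, ¬ X.Joined a b w u

open Classical in
/-- The labels of the vertices in `K`. -/
noncomputable def pull (X : Input) (a b : ℕ) (f : ℕ → ℕ) (K : Finset ℕ) : Finset ℕ :=
  (Icc 1 X.n).filter fun u => u ∈ X.actEnds a b X.m ∧ f u - 1 ∈ K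

theorem Valid.mem_pull {X : Input} {a b u : ℕ} {f : ℕ → ℕ} {K : Finset ℕ} (hX : X.Valid) :
    u ∈ X.pull a b f K ↔ u ∈ X.actEnds a b X.m ∧ f u - 1 ∈ K := by
  classical
  rw [pull, mem_filter]
  exact and_iff_right_of_imp fun h => hX.mem_labels (X.actEnds_subset le_rfl h.1)

variable {X : Input} {a b u v ν : ℕ} {f : ℕ → ℕ} {K : Finset ℕ}

theorem adj_iff_joined (hN : Numbers X.ends (X.actEnds a b X.m) f ν)
    (hu : u ∈ X.actEnds a b X.m) (hv : v ∈ X.actEnds a b X.m) :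
    X.adj a b f X.m (f u - 1) (f v - 1) ↔ X.Joined a b u v := by
  have key : ∀ w ∈ X.actEnds a b X.m, ∀ w' ∈ X.actEnds a b X.m, f w - 1 = f w' - 1 → w = w' := by
    intro w hw w' hw' h
    have := hN.pos hw
    have := hN.pos hw'
    exact hN.inj w hw w' hw' (by omega)
  constructor
  · rintro ⟨e, he, ha, h⟩
    have hp : X.p e ∈ X.actEnds a b X.m := ⟨e, he, ha, .inl rfl⟩
    have hq : X.q e ∈ X.actEnds a b X.m := ⟨e, he, ha, .inr rfl⟩
    refine ⟨e, he, ha, h.imp (fun h => ?_) fun h => ?_⟩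
    · exact ⟨(key _ hu _ hp h.1).symm, (key _ hv _ hq h.2).symm⟩
    · exact ⟨(key _ hv _ hp h.2).symm, (key _ hu _ hq h.1).symm⟩
  · rintro ⟨e, he, ha, h⟩
    refine ⟨e, he, ha, h.imp (fun h => ?_) fun h => ?_⟩
    · rw [h.1, h.2]
      exact ⟨rfl, rfl⟩
    · rw [h.1, h.2]
      exact ⟨rfl, rfl⟩

/-- Shifted down by one, the numbering is a bijection from the active end vertices onto the numbers
below `ν`. So `pull` has a left inverse, and different leaves yield different cliques of labels. -/
theorem image_pull (hX : X.Valid) (hN : Numbers X.ends (X.actEnds a b X.m) f ν)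
    (hK : ∀ x ∈ K, x < ν) : (X.pull a b f K).image (f · - 1) = K := by
  ext x
  simp only [mem_image, hX.mem_pull]
  constructor
  · rintro ⟨u, ⟨-, hu⟩, rfl⟩
    exact hu
  · intro hx
    obtain ⟨u, hu, h⟩ := hN.surj x (hK x hx)
    have : f u - 1 = x := by omega
    exact ⟨u, ⟨hu, this ▸ hx⟩, this⟩

theorem isMaxClique_pull (hX : X.Valid) (hN : Numbers X.ends (X.actEnds a b X.m) f ν)
    (hK : MaxClique (X.adj a b f X.m) ν K) : X.IsMaxClique a b (X.pull a b f K) := by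
  refine ⟨fun u hu => (hX.mem_pull.1 hu).1, fun u hu v hv huv => ?_, fun w hw hwU => ?_⟩
  · rw [hX.mem_pull] at hu hv
    have h1 := hN.pos hu.1
    have h2 := hN.pos hv.1
    exact (adj_iff_joined hN hu.1 hv.1).1 (hK.clique _ hu.2 _ hv.2 fun h =>
      huv (hN.inj u hu.1 v hv.1 (by omega)))
  · have h1 := hN.pos hw
    have h2 := hN.le w hw
    obtain ⟨x, hx, hn⟩ := hK.maximal (f w - 1) (by omega) fun h => hwU (hX.mem_pull.2 ⟨hw, h⟩)
    obtain ⟨u, hu, h⟩ := hN.surj x (hK.lt x hx)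
    have hux : f u - 1 = x := by omega
    rw [← hux] at hn hx
    exact ⟨u, hX.mem_pull.2 ⟨hu, hx⟩, fun h => hn ((adj_iff_joined hN hw hu).2 h)⟩

theorem exists_pull_eq (hX : X.Valid) (hN : Numbers X.ends (X.actEnds a b X.m) f ν)
    {U : Finset ℕ} (hU : X.IsMaxClique a b U) :
    ∃ K, MaxClique (X.adj a b f X.m) ν K ∧ X.pull a b f K = U := by
  have key : ∀ u ∈ X.actEnds a b X.m, f u - 1 ∈ U.image (f · - 1) ↔ u ∈ U := by
    intro u hu
    rw [mem_image]
    refine ⟨?_, fun h => ⟨u, h, rfl⟩⟩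
    rintro ⟨v, hv, h⟩
    have h1 := hN.pos hu
    have h2 := hN.pos (hU.sub v hv)
    rwa [← hN.inj v (hU.sub v hv) u hu (by omega)]
  refine ⟨U.image (f · - 1), ⟨fun x hx => ?_, fun x hx y hy hxy => ?_, fun w hw hwU => ?_⟩, ?_⟩
  · obtain ⟨u, hu, rfl⟩ := mem_image.1 hx
    have h1 := hN.pos (hU.sub u hu)
    have h2 := hN.le u (hU.sub u hu)
    omega
  · obtain ⟨u, hu, rfl⟩ := mem_image.1 hx
    obtain ⟨v, hv, rfl⟩ := mem_image.1 hy
    exact (adj_iff_joined hN (hU.sub u hu) (hU.sub v hv)).2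
      (hU.clique u hu v hv fun h => hxy (by rw [h]))
  · obtain ⟨u, hu, h⟩ := hN.surj w hw
    obtain rfl : f u - 1 = w := by omega
    obtain ⟨v, hv, hn⟩ := hU.maximal u hu fun h => hwU ((key u hu).2 h)
    exact ⟨f v - 1, mem_image_of_mem _ hv, fun h =>
      hn ((adj_iff_joined hN hu (hU.sub v hv)).1 h)⟩
  · ext u
    rw [hX.mem_pull]
    exact ⟨fun h => (key u h.1).1 h.2, fun h => ⟨hU.sub u h, (key u (hU.sub u h)).2 h⟩⟩

end Input

/-- `i` is the last number with the property `r`. -/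
def IsLast (r : ℕ → Prop) (i : ℕ) : Prop := r i ∧ ∀ e, r e → e ≤ i

/-- `v` is one more than the last number below `k` with the property `r`, or zero if there is no
such number. -/
def LastBelow (r : ℕ → Prop) (k v : ℕ) : Prop :=
  (v = 0 ∧ ∀ e < k, ¬ r e) ∨ ∃ e < k, v = e + 1 ∧ r e ∧ ∀ e' < k, r e' → e' ≤ e

theorem LastBelow.succ_of {r : ℕ → Prop} {k : ℕ} (h : r k) : LastBelow r (k + 1) (k + 1) :=
  .inr ⟨k, by omega, rfl, h, fun e' he' _ => by omega⟩

theorem LastBelow.succ_of_not {r : ℕ → Prop} {k v : ℕ} (h : LastBelow r k v) (hk : ¬ r k) :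
    LastBelow r (k + 1) v := by
  have key : ∀ e < k + 1, r e → e < k := fun e he hre =>
    (Nat.lt_succ_iff_lt_or_eq.1 he).resolve_right fun e => hk (e ▸ hre)
  rcases h with ⟨h, h'⟩ | ⟨e, he, hv, hre, h'⟩
  · exact .inl ⟨h, fun e he hre => h' e (key e he hre) hre⟩
  · exact .inr ⟨e, by omega, hv, hre, fun e' he' hre' => h' e' (key e' he' hre') hre'⟩

/-- The shift by one frees the value 0 for "none", so that a single comparison with `i + 1` decides
whether `i` is the last one. -/
theorem LastBelow.eq_succ_iff {r : ℕ → Prop} {k v i : ℕ} (h : LastBelow r k v)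
    (hr : ∀ e, r e → e < k) : v = i + 1 ↔ IsLast r i := by
  rcases h with ⟨h, h'⟩ | ⟨e, he, hv, hre, h'⟩
  · exact ⟨fun hv => by omega, fun hi => absurd hi.1 (h' i (hr i hi.1))⟩
  · constructor
    · intro hi
      obtain rfl : e = i := by omega
      exact ⟨hre, fun e' he' => h' e' (hr e' he') he'⟩
    · intro hi
      have h1 := hi.2 e hre
      have h2 := h' i (hr i hi.1) hi.1
      omega

theorem LastBelow.le {r : ℕ → Prop} {k v : ℕ} (h : LastBelow r k v) : v ≤ k := by
  rcases h with ⟨h, h'⟩ | ⟨e, he, hv, hre, h'⟩ <;> omega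

/-- Mark the edges inside the current clique, and find the last ones among them that start with the
interval and that end with it. -/
def markEdges : Program :=
  .set 10 (.const 0) ;; .set 11 (.const 0) ;; forTo 12 1 (
    .store 15 (.var 12) (.const 0) ;; ifActive 12 (
      .cond (.eq (.load 8 (.sub (.load 4 (.load 0 (.var 12))) (.const 1))) (.const 1))
        (.cond (.eq (.load 8 (.sub (.load 4 (.load 1 (.var 12))) (.const 1))) (.const 1))
          (.store 15 (.var 12) (.const 1) ;;
            .cond (.eq (.load 2 (.var 12)) (.var 5)) (.set 10 (.add (.var 12) (.const 1))) .nop ;;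
            .cond (.eq (.load 3 (.var 12)) (.var 6)) (.set 11 (.add (.var 12) (.const 1))) .nop)
          .nop) .nop))

/-- Write down the marked edges. -/
def writeEdges : Program :=
  forTo 12 1 (.cond (.eq (.load 15 (.var 12)) (.const 1))
    (.emit (.load 0 (.var 12)) ;; .emit (.load 1 (.var 12))) .nop) ;;
  .emit (.const 0)

/-- Output the current clique if the edges in variables 3 and 4 are the last ones in the clique
that start with the interval and that end with it. -/
def report : Program :=
  markEdges ;;
  .cond (.eq (.var 10) (.add (.var 3) (.const 1)))
    (.cond (.eq (.var 11) (.add (.var 4) (.const 1))) writeEdges .nop) .nop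

/-- The edge list `l` as output words. -/
def Input.enc (X : Input) (l : List ℕ) : List ℕ := l.flatMap (fun e => [X.p e, X.q e]) ++ [0]

open Classical in
/-- The edges inside a clique, in order. -/
noncomputable def Input.inner (X : Input) (a b : ℕ) (U : Finset ℕ) : List ℕ :=
  (List.range X.m).filter (X.Inside a b U ·)

/-- The edges `i` and `j` are the last ones inside `U` that start with the interval and that end
with it. -/
def Input.Chosen (X : Input) (a b i j : ℕ) (U : Finset ℕ) : Prop :=
  IsLast (fun e => e < X.m ∧ X.Inside a b U e ∧ X.s e = a) i ∧
    IsLast (fun e => e < X.m ∧ X.Inside a b U e ∧ X.t e = b) j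

variable {X : Input} {W a b i j ν : ℕ} {σ : Config} {K U : Finset ℕ} {f : ℕ → ℕ}

open Classical in
theorem runs_markEdges (hX : X.Valid) (hM : X.InMem σ)
    (hW : X.n * X.n + 2 * X.n + 4 * X.m + X.T + 10 ≤ W) (h5 : σ.var 5 = a) (h6 : σ.var 6 = b)
    (ha : a < W) (hb : b < W) (hN : Numbers X.ends (X.actEnds a b X.m) (σ.arr 4) ν)
    (hK : Codes ν (σ.arr 8) K) :
    Runs W markEdges σ (2 + (2 + (X.m * (80 + 8) + 6))) fun σ' =>
      (∀ e < X.m, σ'.arr 15 e = if X.Inside a b (X.pull a b (σ.arr 4) K) e then 1 else 0) ∧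
      LastBelow (fun e => e < X.m ∧ X.Inside a b (X.pull a b (σ.arr 4) K) e ∧ X.s e = a) X.m
        (σ'.var 10) ∧
      LastBelow (fun e => e < X.m ∧ X.Inside a b (X.pull a b (σ.arr 4) K) e ∧ X.t e = b) X.m
        (σ'.var 11) := by
  have hν := hN.le_of_subset fun u hu => hX.mem_labels hu
  set U := X.pull a b (σ.arr 4) K with hU
  refine Runs.seq (T := 2) (Runs.of_wp (p := .set 10 (.const 0)) ?_)
  refine ⟨by simp only [Fits]; omega, ?_⟩
  refine Runs.seq (T := 2) (Runs.of_wp (p := .set 11 (.const 0)) ?_)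
  refine ⟨by simp only [Fits]; omega, ?_⟩
  refine (Runs.forTo (B := X.m) (T := 80) (I := fun k σ' =>
      (∀ e < k, σ'.arr 15 e = if X.Inside a b U e then 1 else 0) ∧
      LastBelow (fun e => e < X.m ∧ X.Inside a b U e ∧ X.s e = a) k (σ'.var 10) ∧
      LastBelow (fun e => e < X.m ∧ X.Inside a b U e ∧ X.t e = b) k (σ'.var 11))
      (by omega) (by omega) (by simpa using hM.var1) rfl rfl (by decide) ?_ ?_).mono le_rfl
      fun σ' h => h.1
  · exact ⟨by simp, .inl ⟨by simp [eval], by simp⟩, .inl ⟨by simp [eval], by simp⟩⟩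
  · intro k hk σ' hs hx ⟨h15, h10, h11⟩
    have hM' : X.InMem σ' := by
      refine Input.InMem.of_same ?_ hs (by decide) (by decide)
      exact ⟨by simp [hM.var1], by simp [hM.var2], hM.arr0, hM.arr1, hM.arr2, hM.arr3⟩
    have h5' : σ'.var 5 = a := by
      rw [hs.var 5 rfl]
      simpa using h5
    have h6' : σ'.var 6 = b := by
      rw [hs.var 6 rfl]
      simpa using h6
    have e4 : σ'.arr 4 = σ.arr 4 := hs.arr 4 rfl
    have e8 : σ'.arr 8 = σ.arr 8 := hs.arr 8 rfl
    refine Runs.mono (T := 4 + (5 + (5 + 60))) ?_ (by omega) fun _ => id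
    refine Runs.seqSame (Q' := fun τ => τ.arr 15 = Function.update (σ'.arr 15) k 0)
      ((Runs.of_wp ?_).mono (by decide) fun _ => id) fun σ₁ h15' s₁ => ?_
    · simp [wp, Fits, eval, hx]
      omega
    have hM₁ := hM'.of_same s₁ (by decide) (by decide)
    have h5₁ := (s₁.var 5 rfl).trans h5'
    have h6₁ := (s₁.var 6 rfl).trans h6'
    have hx₁ := (s₁.var 12 rfl).trans hx
    have e4₁ := (s₁.arr 4 rfl).trans e4
    have e8₁ := (s₁.arr 8 rfl).trans e8
    rw [← s₁.var 10 rfl] at h10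
    rw [← s₁.var 11 rfl] at h11
    -- Shared by the three ways to fail: the edge is inactive, its first end is outside the clique,
    -- or its second end is.
    have hnot : ¬ X.Inside a b U k →
        (∀ e < k + 1, σ₁.arr 15 e = if X.Inside a b U e then 1 else 0) ∧
        LastBelow (fun e => e < X.m ∧ X.Inside a b U e ∧ X.s e = a) (k + 1) (σ₁.var 10) ∧
        LastBelow (fun e => e < X.m ∧ X.Inside a b U e ∧ X.t e = b) (k + 1) (σ₁.var 11) := by
      refine fun hin => ⟨fun e he => ?_, h10.succ_of_not fun h => hin h.2.1,
        h11.succ_of_not fun h => hin h.2.1⟩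
      rw [h15']
      rcases Nat.lt_succ_iff_lt_or_eq.1 he with he | rfl
      · rw [Function.update_of_ne he.ne, h15 e he]
      · rw [Function.update_self, if_neg hin]
    refine runs_ifActive (T := 60) hX hM₁ hW hk hx₁ h5₁ h6₁ ha hb (by omega) (fun hact => ?_)
      fun hact => ?_
    · have hp : X.p k ∈ X.actEnds a b X.m := ⟨k, hk, hact, .inl rfl⟩
      have hq : X.q k ∈ X.actEnds a b X.m := ⟨k, hk, hact, .inr rfl⟩
      have l1 := hN.pos hp
      have l2 := hN.pos hq
      have l3 := hN.le _ hp
      have l4 := hN.le _ hq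
      have l5 := (hX.p_mem k hk).2
      have l6 := (hX.q_mem k hk).2
      have l7 := hX.le k hk
      have l8 := hX.le_T k hk
      have hpU : σ.arr 8 (σ.arr 4 (X.p k) - 1) = if X.p k ∈ U then 1 else 0 := by
        rw [hK.eq _ (by omega), hU]
        simp only [hX.mem_pull, hp, true_and]
      have hqU : σ.arr 8 (σ.arr 4 (X.q k) - 1) = if X.q k ∈ U then 1 else 0 := by
        rw [hK.eq _ (by omega), hU]
        simp only [hX.mem_pull, hq, true_and]
      refine (Runs.of_wp ?_).mono (Nat.le_of_ble_eq_true rfl) fun _ => id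
      by_cases h1 : X.p k ∈ U
      · by_cases h2 : X.q k ∈ U
        · have hin : X.Inside a b U k := ⟨hact, h1, h2⟩
          have h15k : ∀ e < k + 1, Function.update (σ₁.arr 15) k 1 e =
              if X.Inside a b U e then 1 else 0 := by
            intro e he
            rcases Nat.lt_succ_iff_lt_or_eq.1 he with he | rfl
            · rw [Function.update_of_ne he.ne, h15', Function.update_of_ne he.ne, h15 e he]
            · rw [Function.update_self, if_pos hin]
          simp [-Order.lt_add_one_iff, and_assoc, wp, Fits, Test.Fits, Test.Holds, eval, hx₁,
            hM₁.arr0, hM₁.arr1, hM₁.arr2, hM₁.arr3, e4₁, e8₁, hpU, hqU, h1, h2, h5₁, h6₁]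
          repeat (refine ⟨by omega, ?_⟩)
          refine ⟨fun hc => ?_, fun hc => ?_⟩ <;>
          · repeat (refine ⟨by omega, ?_⟩)
            refine ⟨fun hc' => ?_, fun hc' => ?_⟩ <;>
            · repeat (refine ⟨by omega, ?_⟩)
              refine ⟨?_, ?_⟩
              · first
                | exact LastBelow.succ_of ⟨hk, hin, hc⟩
                | exact h10.succ_of_not fun h => hc h.2.2
              · first
                | exact LastBelow.succ_of ⟨hk, hin, hc'⟩
                | exact h11.succ_of_not fun h => hc' h.2.2
        · have := hnot fun h => h2 h.2.2
          simp [-Order.lt_add_one_iff, and_assoc, wp, Fits, Test.Fits, Test.Holds, eval, hx₁,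
            hM₁.arr0, hM₁.arr1, e4₁, e8₁, hpU, hqU, h1, h2]
          repeat (refine ⟨by omega, ?_⟩)
          exact this
      · have := hnot fun h => h1 h.2.1
        simp [-Order.lt_add_one_iff, and_assoc, wp, Fits, Test.Fits, Test.Holds, eval, hx₁,
          hM₁.arr0, e4₁, e8₁, hpU, h1]
        repeat (refine ⟨by omega, ?_⟩)
        exact this
    · have := hnot fun h => hact h.1
      simpa using this

open Classical in
theorem runs_writeEdges (hX : X.Valid) (hM : X.InMem σ)
    (hW : X.n * X.n + 2 * X.n + 4 * X.m + X.T + 10 ≤ W)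
    (h15 : ∀ e < X.m, σ.arr 15 e = if X.Inside a b U e then 1 else 0) :
    Runs W writeEdges σ (X.m * (20 + 8) + 6 + 2) fun σ' =>
      σ'.out = σ.out ++ X.enc (X.inner a b U) := by
  refine Runs.seqSame (Runs.forTo (B := X.m) (T := 20) (I := fun k σ' => σ'.out = σ.out ++
    ((List.range k).filter (X.Inside a b U ·)).flatMap fun e => [X.p e, X.q e])
    (by omega) (by omega) hM.var1 rfl rfl (by decide) (by simp) ?_) fun σ₁ ⟨h, _⟩ s₁ => ?_
  · intro k hk σ' hs hx hI
    have hM' := hM.of_same hs (by decide) (by decide)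
    have e15 := hs.arr 15 rfl
    have l5 := (hX.p_mem k hk).2
    have l6 := (hX.q_mem k hk).2
    have hk15 := h15 k hk
    refine (Runs.of_wp ?_).mono (by decide) fun _ => id
    by_cases hin : X.Inside a b U k
    · simp [wp, Fits, Test.Fits, Test.Holds, eval, hx, e15, hk15, hin, hM'.arr0, hM'.arr1,
        List.range_succ, hI]
      omega
    · simp [wp, Fits, Test.Fits, Test.Holds, eval, hx, e15, hk15, hin,
        List.range_succ, hI]
      omega
  · refine (Runs.of_wp ?_).mono (by decide) fun _ => id
    simp [wp, Fits, eval, h, Input.enc, Input.inner]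
    omega

open Classical in
theorem runs_report (hX : X.Valid) (hM : X.InMem σ)
    (hW : X.n * X.n + 2 * X.n + 4 * X.m + X.T + 10 ≤ W) (h3 : σ.var 3 = i) (h4 : σ.var 4 = j)
    (hi : i < X.m) (hj : j < X.m) (h5 : σ.var 5 = a) (h6 : σ.var 6 = b)
    (ha : a < W) (hb : b < W) (hN : Numbers X.ends (X.actEnds a b X.m) (σ.arr 4) ν)
    (hK : Codes ν (σ.arr 8) K) :
    Runs W report σ (150 * (X.m + 1)) fun σ' => σ'.out = σ.out ++
      if X.Chosen a b i j (X.pull a b (σ.arr 4) K) then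
        X.enc (X.inner a b (X.pull a b (σ.arr 4) K)) else [] := by
  refine Runs.mono (T := 2 + (2 + (X.m * (80 + 8) + 6)) + (6 + (6 + (X.m * (20 + 8) + 6 + 2)))) ?_
    (by omega) fun _ => id
  refine Runs.seqSame (runs_markEdges hX hM hW h5 h6 ha hb hN hK) fun σ₁ ⟨h15, h10, h11⟩ s₁ => ?_
  have hM₁ := hM.of_same s₁ (by decide) (by decide)
  have h3₁ := (s₁.var 3 rfl).trans h3
  have h4₁ := (s₁.var 4 rfl).trans h4
  have l10 := h10.le
  have l11 := h11.le
  have i10 := h10.eq_succ_iff (i := i) fun e h => h.1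
  have i11 := h11.eq_succ_iff (i := j) fun e h => h.1
  rw [← s₁.out rfl]
  have hnop : ∀ {T}, 1 ≤ T → ¬ X.Chosen a b i j (X.pull a b (σ.arr 4) K) →
      Runs W .nop σ₁ T fun σ' => σ'.out = σ₁.out ++
        if X.Chosen a b i j (X.pull a b (σ.arr 4) K) then
          X.enc (X.inner a b (X.pull a b (σ.arr 4) K)) else [] := fun hT h =>
    (Runs.of_wp (p := .nop) (by simp [wp, h])).mono hT fun _ => id
  refine Runs.cond ?_ (fun hc => Runs.cond ?_ (fun hc' => ?_) fun hc' => ?_) fun hc => ?_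
  · simp only [Test.Fits, Fits, eval, h3₁]
    omega
  · simp only [Test.Fits, Fits, eval, h4₁]
    omega
  · simp only [Test.Holds, eval, h3₁, h4₁] at hc hc'
    rw [if_pos ⟨i10.1 hc, i11.1 hc'⟩]
    exact runs_writeEdges hX hM₁ hW h15
  · simp only [Test.Holds, eval, h4₁] at hc'
    exact hnop (by omega) fun h => hc' (i11.2 h.2)
  · simp only [Test.Holds, eval, h3₁] at hc
    exact hnop (by omega) fun h => hc (i10.2 h.1)

end CliqueTree

namespace CliqueTree

open Finset WordRAM WordRAM.Program WordRAM.Expr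

/-! ### The whole program -/

/-- Treat the interval from the first time stamp of the edge in variable 3 to the last time stamp
of the edge in variable 4. -/
def treatPair : Program :=
  .set 5 (.load 2 (.var 3)) ;; .set 6 (.load 3 (.var 4)) ;;
  .cond (.lt (.var 6) (.var 5)) .nop (build ;; enumerate report)

/-- Treat all pairs of edges. -/
def treatPairs : Program := forTo 3 1 (forTo 4 1 treatPair)

/-- Output the empty clique if no edge is active at all time stamps. -/
def treatEmpty : Program :=
  .set 10 (.const 0) ;;
  forTo 11 1 (.cond (.eq (.load 2 (.var 11)) (.const 1))
    (.cond (.eq (.load 3 (.var 11)) (.var 2)) (.set 10 (.const 1)) .nop) .nop) ;;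
  .cond (.eq (.var 10) (.const 0)) (.emit (.const 0)) .nop

/-- The enumeration program. -/
def enumerateClosed : Program := treatEmpty ;; treatPairs

namespace Input

/-- `l` lists the edges of a maximal clique of the graph for the interval given by the edges `i`
and `j`, and this clique is to be output for this interval. -/
def Out (X : Input) (i j : ℕ) (l : List ℕ) : Prop :=
  X.s i ≤ X.t j ∧ ∃ U, X.IsMaxClique (X.s i) (X.t j) U ∧ X.Chosen (X.s i) (X.t j) i j U ∧
    l = X.inner (X.s i) (X.t j) U

variable {X : Input} {a b i j i' j' u e : ℕ} {U U' : Finset ℕ} {l : List ℕ}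

theorem mem_inner : e ∈ X.inner a b U ↔ e < X.m ∧ X.Inside a b U e := by
  simp [inner]

theorem Joined.symm {u v : ℕ} (h : X.Joined a b u v) : X.Joined a b v u := by
  obtain ⟨e, he, ha, h⟩ := h
  exact ⟨e, he, ha, h.symm⟩

/-- Every vertex of the graph has a neighbour, so a single vertex is never a maximal clique. Hence
each vertex of `U` lies on an edge inside `U`, and `U` can be recovered from its edges. -/
theorem IsMaxClique.mem_iff (hX : X.Valid) (h : X.IsMaxClique a b U) :
    u ∈ U ↔ ∃ e ∈ X.inner a b U, X.p e = u ∨ X.q e = u := by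
  constructor
  · intro hu
    obtain ⟨e, he, ha, h'⟩ := h.sub u hu
    obtain ⟨v, hv, hne, huv⟩ : ∃ v ∈ X.actEnds a b X.m, v ≠ u ∧ X.Joined a b v u := by
      rcases h' with rfl | rfl
      · exact ⟨X.q e, ⟨e, he, ha, .inr rfl⟩, (hX.ne e he).symm, e, he, ha, .inr ⟨rfl, rfl⟩⟩
      · exact ⟨X.p e, ⟨e, he, ha, .inl rfl⟩, hX.ne e he, e, he, ha, .inl ⟨rfl, rfl⟩⟩
    have key : ∃ w ∈ U, X.Joined a b u w := by
      by_cases hvU : v ∈ U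
      · exact ⟨v, hvU, huv.symm⟩
      · obtain ⟨w, hw, hn⟩ := h.maximal v hv hvU
        exact ⟨w, hw, h.clique u hu w hw fun huw => hn (huw ▸ huv)⟩
    obtain ⟨w, hw, e, he, ha, h'⟩ := key
    refine ⟨e, mem_inner.2 ⟨he, ha, ?_⟩, h'.imp (·.1) (·.2)⟩
    rcases h' with h' | h' <;> rw [h'.1, h'.2]
    exacts [⟨hu, hw⟩, ⟨hw, hu⟩]
  · rintro ⟨e, he, rfl | rfl⟩
    exacts [(mem_inner.1 he).2.2.1, (mem_inner.1 he).2.2.2]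

theorem IsMaxClique.eq_of_inner_eq (hX : X.Valid) (h : X.IsMaxClique a b U)
    (h' : X.IsMaxClique a b U') (he : X.inner a b U = X.inner a b U') : U = U' := by
  ext u
  rw [h.mem_iff hX, h'.mem_iff hX, he]

/-- If the same edges are printed for two pairs, then `i` is inside the second clique and `i'`
inside the first, which forces equal first stamps; likewise for the last stamps of `j` and `j'`.
Being the last edge with such a stamp then fixes the index. -/
theorem Out.left_eq (h : X.Out i j l) (h' : X.Out i' j' l) : i = i' ∧ j = j' := by
  obtain ⟨-, U, hU, ⟨⟨⟨h1, h2, -⟩, h3⟩, ⟨h4, h5, -⟩, h6⟩, hl⟩ := h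
  obtain ⟨-, U', hU', ⟨⟨⟨h1', h2', -⟩, h3'⟩, ⟨h4', h5', -⟩, h6'⟩, hl'⟩ := h'
  have key : ∀ e < X.m, X.Inside (X.s i) (X.t j) U e ↔ X.Inside (X.s i') (X.t j') U' e := by
    intro e he
    have := mem_inner (X := X) (a := X.s i) (b := X.t j) (U := U) (e := e)
    rw [← hl, hl', mem_inner] at this
    exact ⟨fun h => (this.2 ⟨he, h⟩).2, fun h => (this.1 ⟨he, h⟩).2⟩
  have k1 := (key i h1).1 h2
  have k2 := (key i' h1').2 h2'
  have k3 := (key j h4).1 h5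
  have k4 := (key j' h4').2 h5'
  have es : X.s i = X.s i' := k1.1.1.antisymm k2.1.1
  have et : X.t j = X.t j' := k4.1.2.antisymm k3.1.2
  exact ⟨(h3' i ⟨h1, k1, es⟩).antisymm (h3 i' ⟨h1', k2, es.symm⟩),
    (h6' j ⟨h4, k3, et⟩).antisymm (h6 j' ⟨h4', k4, et.symm⟩)⟩

end Input

variable {X : Input} {W i j N : ℕ} {σ : Config}

/-- Adding disjoint lists without repetitions. -/
theorem exists_list_succ {α : Type*} {r : ℕ → α → Prop} {k : ℕ} {L L' : List α}
    (hr : ∀ i j l, r i l → r j l → i = j) (hL : L.Nodup) (hL' : L'.Nodup)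
    (h : ∀ l, l ∈ L ↔ ∃ i < k, r i l) (h' : ∀ l, l ∈ L' ↔ r k l) :
    (L ++ L').Nodup ∧ ∀ l, l ∈ L ++ L' ↔ ∃ i < k + 1, r i l := by
  refine ⟨List.nodup_append.2 ⟨hL, hL', ?_⟩, fun l => ?_⟩
  · rintro l hl _ hl' rfl
    obtain ⟨i, hi, h1⟩ := (h l).1 hl
    exact hi.ne (hr i k l h1 ((h' l).1 hl'))
  · rw [List.mem_append, h, h']
    constructor
    · rintro (⟨i, hi, h⟩ | h)
      exacts [⟨i, by omega, h⟩, ⟨k, by omega, h⟩]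
    · rintro ⟨i, hi, hil⟩
      rcases Nat.lt_succ_iff_lt_or_eq.1 hi with hi | rfl
      exacts [.inl ⟨i, hi, hil⟩, .inr hil]

/-- The bound `N` concerns all maximal cliques for this pair, printed or not, since the enumeration
has to visit every one of them. -/
theorem runs_treatPair (hX : X.Valid) (hM : X.InMem σ)
    (hW : X.n * X.n + 2 * X.n + 4 * X.m + X.T + 10 ≤ W) (h3 : σ.var 3 = i) (h4 : σ.var 4 = j)
    (hi : i < X.m) (hj : j < X.m) (hN1 : 1 ≤ N)
    (hN : X.s i ≤ X.t j → ∀ Us : List (Finset ℕ), Us.Nodup →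
      (∀ U ∈ Us, X.IsMaxClique (X.s i) (X.t j) U) → Us.length ≤ N) :
    Runs W treatPair σ (4000 * (X.n * X.m) * N) fun σ' => ∃ L : List (List ℕ), L.Nodup ∧
      (∀ l, l ∈ L ↔ X.Out i j l) ∧ σ'.out = σ.out ++ L.flatMap X.enc := by
  classical
  have hm1 : 1 ≤ X.m := by omega
  have hn1 : 1 ≤ X.n := (hX.p_mem i hi).1.trans (hX.p_mem i hi).2
  have hnm : X.n ≤ X.n * X.m := Nat.le_mul_of_pos_right _ hm1
  have hmn : X.m ≤ X.n * X.m := Nat.le_mul_of_pos_left _ hn1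
  have hNn : X.n * X.m ≤ X.n * X.m * N := Nat.le_mul_of_pos_right _ hN1
  have a1 := hX.le i hi
  have a2 := hX.le_T i hi
  have a3 := hX.le_T j hj
  refine Runs.mono (T := 3 + (3 + (4 + (200 * (X.m + 1) +
    (N * (3000 * (X.n * X.m) + 150 * (X.m + 1)) + 100 * (X.n + 1)))))) ?_ ?_ fun _ => id
  · refine Runs.seqSame (T := 3) (Q' := fun τ => τ.var 5 = X.s i)
      ((Runs.of_wp ?_).mono (by decide) fun _ => id) fun σ₁ h5₁ s₁ => ?_
    · simp [wp, Fits, eval, h3, hM.arr2]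
      omega
    have hM₁ := hM.of_same s₁ (by decide) (by decide)
    refine Runs.seqSame (T := 3) (Q' := fun τ => τ.var 6 = X.t j)
      ((Runs.of_wp ?_).mono (by decide) fun _ => id) fun σ₂ h6₂ s₂ => ?_
    · simp [wp, Fits, eval, s₁.var 4 rfl, h4, hM₁.arr3]
      omega
    have hM₂ := hM₁.of_same s₂ (by decide) (by decide)
    have h3₂ := (s₂.var 3 rfl).trans ((s₁.var 3 rfl).trans h3)
    have h4₂ := (s₂.var 4 rfl).trans ((s₁.var 4 rfl).trans h4)
    have h5₂ := (s₂.var 5 rfl).trans h5₁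
    have hout₂ : σ₂.out = σ.out := (s₂.out rfl).trans (s₁.out rfl)
    refine Runs.cond ?_ (fun hc => ?_) (fun hc => ?_)
    · simp only [Test.Fits, Fits, h5₂, h6₂]
      omega
    · simp only [Test.Holds, eval, h5₂, h6₂] at hc
      refine (Runs.of_wp (p := .nop) ?_).mono (T := 1) (by omega) fun _ => id
      refine ⟨[], by simp, fun l => ?_, by simp [hout₂]⟩
      simp only [List.not_mem_nil, false_iff]
      intro h
      have := h.1
      omega
    · simp only [Test.Holds, eval, h5₂, h6₂, not_lt] at hc
      refine Runs.seqSame (runs_build hX hM₂ hW h5₂ h6₂ (by omega) (by omega))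
        fun σ₃ ⟨hν, hμ, hS, hNum, hA⟩ s₃ => ?_
      have hM₃ := hM₂.of_same s₃ (by decide) (by decide)
      have hout₃ : σ₃.out = σ.out := (s₃.out rfl).trans hout₂
      have h3₃ := (s₃.var 3 rfl).trans h3₂
      have h4₃ := (s₃.var 4 rfl).trans h4₂
      have h5₃ := (s₃.var 5 rfl).trans h5₂
      have h6₃ := (s₃.var 6 rfl).trans h6₂
      set ν := σ₃.var 7
      set μ := σ₃.var 8
      set f := σ₃.arr 4 with hf
      set adj := X.adj (X.s i) (X.t j) f X.m with hadj
      set F := X.pull (X.s i) (X.t j) f with hF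
      -- Every numbered vertex is the tail of an arc. This removes the `ν²` term from the cost of a
      -- clique.
      have hνμ : ν ≤ μ := by
        have h : range ν ⊆ (range μ).image (σ₃.arr 5) := by
          intro x hx
          obtain ⟨u, ⟨e, he, ha, h⟩, hu⟩ := hNum.surj x (mem_range.1 hx)
          have : ∃ y, adj x y := by
            rcases h with rfl | rfl
            · exact ⟨f (X.q e) - 1, e, he, ha, .inl ⟨by omega, rfl⟩⟩
            · exact ⟨f (X.p e) - 1, e, he, ha, .inr ⟨by omega, rfl⟩⟩
          obtain ⟨y, hy⟩ := this
          obtain ⟨j, hj, hP, -⟩ := (hA.adj_iff x y).1 hy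
          exact mem_image.2 ⟨j, mem_range.2 hj, hP⟩
        simpa using (card_le_card h).trans card_image_le
      have hleaf : ∀ K, K ∈ leaves adj ν 0 ∅ ↔ MaxClique adj ν K := fun K =>
        mem_leaves hA.symm hA.irrefl
      have hnodup : ((leaves adj ν 0 ∅).map F).Nodup := by
        refine (List.nodup_map_iff_inj_on (nodup_leaves hA.symm hA.irrefl ν)).2 fun K hK K' hK' h => ?_
        rw [← Input.image_pull hX hNum ((hleaf K).1 hK).lt, ← hF, h, hF,
          Input.image_pull hX hNum ((hleaf K').1 hK').lt]
      have hmem : ∀ U, U ∈ (leaves adj ν 0 ∅).map F ↔ X.IsMaxClique (X.s i) (X.t j) U := by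
        intro U
        rw [List.mem_map]
        constructor
        · rintro ⟨K, hK, rfl⟩
          exact Input.isMaxClique_pull hX hNum ((hleaf K).1 hK)
        · intro hU
          obtain ⟨K, hK, h⟩ := Input.exists_pull_eq hX hNum hU
          exact ⟨K, (hleaf K).2 hK, h⟩
      have hlen : (leaves adj ν 0 ∅).length ≤ N := by
        simpa using hN hc _ hnodup fun U hU => (hmem U).1 hU
      let g : Finset ℕ → List ℕ := fun K => if X.Chosen (X.s i) (X.t j) i j (F K) then
        X.enc (X.inner (X.s i) (X.t j) (F K)) else []
      refine (runs_enumerate (g := g) (TL := 150 * (X.m + 1)) hA hS (by decide) rfl (by decide)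
        fun σ₄ K hl hK hcode => ?_).mono ?_ fun σ' hout => ?_
      · have hM₄ : X.InMem σ₄ := ⟨(hl.var 1 (by decide)).trans hM₃.var1,
          (hl.var 2 (by decide)).trans hM₃.var2, (hl.arr 0 (by decide)).trans hM₃.arr0,
          (hl.arr 1 (by decide)).trans hM₃.arr1, (hl.arr 2 (by decide)).trans hM₃.arr2,
          (hl.arr 3 (by decide)).trans hM₃.arr3⟩
        have e4 := hl.arr 4 (by decide)
        have := runs_report (ν := ν) (K := K) hX hM₄ hW ((hl.var 3 (by decide)).trans h3₃)
          ((hl.var 4 (by decide)).trans h4₃) hi hj ((hl.var 5 (by decide)).trans h5₃)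
          ((hl.var 6 (by decide)).trans h6₃) (by omega) (by omega) (e4 ▸ hNum) hcode
        rw [e4] at this
        exact this
      -- Here `ν ≤ n` and `ν ≤ μ ≤ 2m` are used, together with `1 ≤ n` and `1 ≤ m`, which hold
      -- because an edge exists.
      · have h1 : (ν + 1) * (μ + ν + 1) ≤ (2 * X.n) * (5 * X.m) :=
          Nat.mul_le_mul (by omega) (by omega)
        have h2 : 300 * (ν + 1) * (μ + ν + 1) ≤ 3000 * (X.n * X.m) := by
          rw [Nat.mul_assoc]
          calc 300 * ((ν + 1) * (μ + ν + 1)) ≤ 300 * ((2 * X.n) * (5 * X.m)) := by gcongr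
            _ = 3000 * (X.n * X.m) := by ring
        have h3 : (leaves adj ν 0 ∅).length * (300 * (ν + 1) * (μ + ν + 1) + 150 * (X.m + 1)) ≤
            N * (3000 * (X.n * X.m) + 150 * (X.m + 1)) :=
          Nat.mul_le_mul hlen (by omega)
        omega
      · refine ⟨(((leaves adj ν 0 ∅).map F).filter fun U => X.Chosen (X.s i) (X.t j) i j U).map
          (X.inner (X.s i) (X.t j)), ?_, fun l => ?_, ?_⟩
        · refine (List.nodup_map_iff_inj_on (hnodup.filter _)).2 fun U hU U' hU' h => ?_
          rw [List.mem_filter, hmem] at hU hU'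
          exact hU.1.eq_of_inner_eq hX hU'.1 h
        · simp only [List.mem_map (f := X.inner (X.s i) (X.t j)), List.mem_filter, hmem,
            decide_eq_true_eq, Input.Out, hc, true_and, and_assoc, eq_comm (b := l)]
        · rw [hout, hout₃]
          congr 1
          generalize leaves adj ν 0 ∅ = Ks
          induction Ks with
          | nil => rfl
          | cons K Ks ih =>
            rw [List.flatMap_cons, ih, List.map_cons, List.filter_cons]
            by_cases h : X.Chosen (X.s i) (X.t j) i j (F K)
            · simp [g, h]
            · simp [g, h]
  · have h1 : N * (3000 * (X.n * X.m) + 150 * (X.m + 1)) ≤ 3300 * (X.n * X.m * N) := by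
      have : N * (3000 * (X.n * X.m) + 150 * (X.m + 1)) ≤ N * (3300 * (X.n * X.m)) := by
        gcongr
        omega
      exact this.trans_eq (by ring)
    have h2 : 4000 * (X.n * X.m) * N = 4000 * (X.n * X.m * N) := by ring
    omega

/-- By `Out.left_eq` different pairs contribute disjoint lists, so the concatenated list has no
repetitions. -/
theorem runs_treatPairs (hX : X.Valid) (hM : X.InMem σ)
    (hW : X.n * X.n + 2 * X.n + 4 * X.m + X.T + 10 ≤ W) (hN1 : 1 ≤ N)
    (hN : ∀ i < X.m, ∀ j < X.m, X.s i ≤ X.t j → ∀ Us : List (Finset ℕ), Us.Nodup →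
      (∀ U ∈ Us, X.IsMaxClique (X.s i) (X.t j) U) → Us.length ≤ N) :
    Runs W treatPairs σ (X.m * (X.m * (4000 * (X.n * X.m) * N + 8) + 6 + 8) + 6) fun σ' =>
      ∃ L : List (List ℕ), L.Nodup ∧ (∀ l, l ∈ L ↔ ∃ i < X.m, ∃ j < X.m, X.Out i j l) ∧
        σ'.out = σ.out ++ L.flatMap X.enc := by
  refine (Runs.forTo (B := X.m) (T := X.m * (4000 * (X.n * X.m) * N + 8) + 6)
    (I := fun k σ' => ∃ L : List (List ℕ), L.Nodup ∧
      (∀ l, l ∈ L ↔ ∃ i < k, ∃ j < X.m, X.Out i j l) ∧ σ'.out = σ.out ++ L.flatMap X.enc)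
    (by omega) (by omega) hM.var1 (by decide) (by decide) (by decide) ⟨[], by simp⟩ ?_).mono le_rfl
    fun σ' h => h.1
  rintro i hi σ' hs h3 ⟨L, hL, hmem, hout⟩
  have hM' := hM.of_same hs (by decide) (by decide)
  refine (Runs.forTo (B := X.m) (T := 4000 * (X.n * X.m) * N)
    (I := fun k σ'' => ∃ L : List (List ℕ), L.Nodup ∧
      (∀ l, l ∈ L ↔ ∃ j < k, X.Out i j l) ∧ σ''.out = σ'.out ++ L.flatMap X.enc)
    (by omega) (by omega) hM'.var1 (by decide) (by decide) (by decide) ⟨[], by simp⟩ ?_).mono le_rfl ?_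
  · rintro j hj σ₁ hs₁ h4 ⟨L₁, hL₁, hmem₁, hout₁⟩
    have hM₁ := hM'.of_same hs₁ (by decide) (by decide)
    refine (runs_treatPair hX hM₁ hW ((hs₁.var 3 rfl).trans h3) h4 hi hj hN1
      (hN i hi j hj)).mono le_rfl fun σ₂ ⟨L₂, hL₂, hmem₂, hout₂⟩ => ?_
    obtain ⟨h1, h2⟩ := exists_list_succ (r := fun j => X.Out i j)
      (fun j j' l h h' => (h.left_eq h').2) hL₁ hL₂ hmem₁ hmem₂
    exact ⟨L₁ ++ L₂, h1, h2, by simp [hout₂, hout₁]⟩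
  · rintro σ₂ ⟨⟨L₂, hL₂, hmem₂, hout₂⟩, -⟩
    obtain ⟨h1, h2⟩ := exists_list_succ (r := fun i l => ∃ j < X.m, X.Out i j l)
      (fun i i' l ⟨j, _, h⟩ ⟨j', _, h'⟩ => (h.left_eq h').1) hL hL₂ hmem hmem₂
    exact ⟨L ++ L₂, h1, h2, by simp [hout₂, hout]⟩

/-- No edge is active at all time stamps. -/
def Input.NoFull (X : Input) : Prop := ∀ e < X.m, ¬ (X.s e = 1 ∧ X.t e = X.T)

open Classical in
theorem runs_treatEmpty (hX : X.Valid) (hM : X.InMem σ)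
    (hW : X.n * X.n + 2 * X.n + 4 * X.m + X.T + 10 ≤ W) :
    Runs W treatEmpty σ (2 + (X.m * (20 + 8) + 6 + 6)) fun σ' =>
      σ'.out = σ.out ++ if X.NoFull then [0] else [] := by
  refine Runs.seqSame (Q' := fun τ => τ.var 10 = 0)
    ((Runs.of_wp ?_).mono (by decide) fun _ => id) fun σ₁ h10 s₁ => ?_
  · simp [wp, Fits, eval]
    omega
  have hM₁ := hM.of_same s₁ (by decide) (by decide)
  refine Runs.seqSame (Runs.forTo (B := X.m) (T := 20) (I := fun k σ' => σ'.var 10 ≤ 1 ∧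
    (σ'.var 10 = 0 ↔ ∀ e < k, ¬ (X.s e = 1 ∧ X.t e = X.T)))
    (by omega) (by omega) hM₁.var1 rfl rfl (by decide) (by simp [h10]) ?_)
    fun σ₂ ⟨⟨h2, h2'⟩, _⟩ s₂ => ?_
  · rintro k hk σ' hs hx ⟨h1, hI⟩
    have hM' := hM₁.of_same hs (by decide) (by decide)
    have l1 := hX.le k hk
    have l2 := hX.le_T k hk
    have hsplit : (∀ e < k + 1, ¬ (X.s e = 1 ∧ X.t e = X.T)) ↔
        σ'.var 10 = 0 ∧ ¬ (X.s k = 1 ∧ X.t k = X.T) := by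
      rw [hI]
      exact ⟨fun h => ⟨fun e he => h e (by omega), h k (by omega)⟩, fun h e he =>
        (Nat.lt_succ_iff_lt_or_eq.1 he).elim (h.1 e) fun h' => h' ▸ h.2⟩
    refine (Runs.of_wp ?_).mono (by decide) fun _ => id
    simp only [Config.setVar_var, hsplit]
    simp [wp, Fits, Test.Fits, Test.Holds, eval, hx, hM'.arr2, hM'.arr3, hM'.var2]
    omega
  · have hout : σ₂.out = σ.out := (s₂.out rfl).trans (s₁.out rfl)
    change _ ↔ X.NoFull at h2'
    refine (Runs.of_wp ?_).mono (by decide) fun _ => id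
    rw [← h2']
    simp [wp, Fits, Test.Fits, Test.Holds, eval, hout]
    omega

open Classical in
theorem runs_enumerateClosed (hX : X.Valid) (hM : X.InMem σ)
    (hW : X.n * X.n + 2 * X.n + 4 * X.m + X.T + 10 ≤ W) (hN1 : 1 ≤ N)
    (hN : ∀ i < X.m, ∀ j < X.m, X.s i ≤ X.t j → ∀ Us : List (Finset ℕ), Us.Nodup →
      (∀ U ∈ Us, X.IsMaxClique (X.s i) (X.t j) U) → Us.length ≤ N) :
    Runs W enumerateClosed σ (5000 * max 1 (X.n * X.m ^ 3) * N) fun σ' =>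
      ∃ L : List (List ℕ), L.Nodup ∧ (∀ l, l ∈ L ↔ ∃ i < X.m, ∃ j < X.m, X.Out i j l) ∧
        σ'.out = σ.out ++ (if X.NoFull then [0] else []) ++ L.flatMap X.enc := by
  refine Runs.mono (T := 2 + (X.m * (20 + 8) + 6 + 6) +
    (X.m * (X.m * (4000 * (X.n * X.m) * N + 8) + 6 + 8) + 6)) ?_ ?_ fun _ => id
  · refine Runs.seqSame (runs_treatEmpty hX hM hW) fun σ₁ h₁ s₁ => ?_
    refine (runs_treatPairs hX (hM.of_same s₁ (by decide) (by decide)) hW hN1 hN).mono le_rfl ?_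
    rintro σ₂ ⟨L, hL, hmem, hout⟩
    exact ⟨L, hL, hmem, by rw [hout, h₁]⟩
  -- Without edges `n * m ^ 3` vanishes, and `max 1` pays for the constant overhead. Otherwise `m *
  -- m ≤ n * m ^ 3`, and the lower-order terms are absorbed.
  · rcases Nat.eq_zero_or_pos X.m with hm | hm
    · simp [hm]
      omega
    · have hn1 : 1 ≤ X.n := (hX.p_mem 0 hm).1.trans (hX.p_mem 0 hm).2
      set y := X.n * X.m ^ 3 with hy
      have h1 : X.m * X.m ≤ y := by
        calc X.m * X.m = 1 * X.m ^ 2 := by ring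
          _ ≤ X.n * X.m ^ 3 := Nat.mul_le_mul hn1 (Nat.pow_le_pow_right hm (by omega))
      have h2 : X.m ≤ X.m * X.m := Nat.le_mul_self _
      have h3 : y ≤ max 1 y := le_max_right _ _
      have h4 : y ≤ y * N := Nat.le_mul_of_pos_right _ hN1
      have h5 : max 1 y = y := max_eq_right (by omega)
      rw [h5]
      have e : X.m * (X.m * (4000 * (X.n * X.m) * N + 8) + 6 + 8) =
          4000 * (y * N) + 8 * (X.m * X.m) + 14 * X.m := by
        rw [hy]
        ring
      have e' : 5000 * y * N = 5000 * (y * N) := by ring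
      omega

end CliqueTree

/-! ### From numbers to graph sequences -/

namespace GraphSequence

open Finset CliqueTree

variable {n tmax : ℕ}

/-- The numbers that describe a graph sequence with a given edge list. -/
noncomputable def toInput (S : GraphSequence n tmax) (es : List (Fin n × Fin n)) : Input where
  n := n
  m := es.length
  T := tmax
  p := column es fun p => p.1.val + 1
  q := column es fun p => p.2.val + 1
  s := column es fun p => sInf (S.τ s(p.1, p.2) : Set ℕ)
  t := column es fun p => sSup (S.τ s(p.1, p.2) : Set ℕ)

/-- The input describes the graph sequence with the given edge list. -/
structure Models (S : GraphSequence n tmax) (es : List (Fin n × Fin n)) (X : Input) : Prop where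
  T_eq : X.T = tmax
  get : ∀ x < X.m, ∃ r, es[x]? = some r
  lt : ∀ (x : ℕ) (r : Fin n × Fin n), es[x]? = some r → x < X.m
  p_eq : ∀ (x : ℕ) (r : Fin n × Fin n), es[x]? = some r → X.p x = r.1.val + 1
  q_eq : ∀ (x : ℕ) (r : Fin n × Fin n), es[x]? = some r → X.q x = r.2.val + 1
  adj : ∀ (x : ℕ) (r : Fin n × Fin n), es[x]? = some r → S.graph.Adj r.1 r.2
  τ_eq : ∀ (x : ℕ) (r : Fin n × Fin n), es[x]? = some r → S.τ s(r.1, r.2) = Icc (X.s x) (X.t x)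
  one_le : ∀ x < X.m, 1 ≤ X.s x
  inj : ∀ (x : ℕ) (r : Fin n × Fin n) (y : ℕ) (r' : Fin n × Fin n), es[x]? = some r → es[y]? = some r' → s(r.1, r.2) = s(r'.1, r'.2) → x = y
  surj : ∀ v w, S.graph.Adj v w → ∃ (x : ℕ) (r : Fin n × Fin n), es[x]? = some r ∧ s(r.1, r.2) = s(v, w)

/-- The infimum and supremum of a non-empty integer interval are its ends, so the input columns
determine `τ` on the edges; the bounds on the stamps come from `τ_subset`. -/
theorem models_toInput {S : GraphSequence n tmax} (hS : S.IntervalAssumption)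
    {es : List (Fin n × Fin n)} (hes : S.IsEdgeList es) :
    Models S es (S.toInput es) ∧ (S.toInput es).Valid := by
  have hlt : ∀ (x : ℕ) (r : Fin n × Fin n), es[x]? = some r → x < es.length := fun x r h => by
    by_contra hc
    rw [List.getElem?_eq_none (by omega)] at h
    cases h
  have hget : ∀ x < es.length, ∃ r, es[x]? = some r := fun x hx => ⟨es[x], by simp [hx]⟩
  have hcol : ∀ (f : Fin n × Fin n → ℕ) x r, es[x]? = some r → column es f x = f r := by
    intro f x r h
    simp [column, h]
  have hmem : ∀ (x : ℕ) (r : Fin n × Fin n), es[x]? = some r → s(r.1, r.2) ∈ S.graph.edgeSet := fun x r h =>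
    (hes.2 _).1 (List.mem_map.2 ⟨r, List.mem_of_getElem? h, rfl⟩)
  have hτ : ∀ (x : ℕ) (r : Fin n × Fin n), es[x]? = some r → S.τ s(r.1, r.2) =
      Icc ((S.toInput es).s x) ((S.toInput es).t x) ∧ 1 ≤ (S.toInput es).s x ∧
      (S.toInput es).s x ≤ (S.toInput es).t x ∧ (S.toInput es).t x ≤ tmax := by
    intro x r h
    obtain ⟨a, b, hab, he⟩ := hS _ (hmem x r h)
    have hs : (S.toInput es).s x = a := by
      simp only [toInput]
      rw [hcol _ x r h, he, coe_Icc, csInf_Icc hab]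
    have ht : (S.toInput es).t x = b := by
      simp only [toInput]
      rw [hcol _ x r h, he, coe_Icc, csSup_Icc hab]
    have hsub := S.τ_subset _ (hmem x r h)
    rw [he] at hsub
    have h1 := mem_Icc.1 (hsub (left_mem_Icc.2 hab))
    have h2 := mem_Icc.1 (hsub (right_mem_Icc.2 hab))
    rw [hs, ht]
    exact ⟨he, h1.1, hab, h2.2⟩
  have hinj : ∀ (x : ℕ) (r : Fin n × Fin n) (y : ℕ) (r' : Fin n × Fin n), es[x]? = some r → es[y]? = some r' →
      s(r.1, r.2) = s(r'.1, r'.2) → x = y := by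
    intro x r y r' h h' he
    refine (List.getElem?_inj (l := es.map fun p => s(p.1, p.2)) ?_ hes.1).1 ?_
    · simpa using hlt x r h
    · simp [h, h', he]
  have hM : Models S es (S.toInput es) :=
    { T_eq := rfl
      get := hget
      lt := hlt
      p_eq := hcol _
      q_eq := hcol _
      adj := hmem
      τ_eq := fun x r h => (hτ x r h).1
      one_le := fun x hx => by
        obtain ⟨r, hr⟩ := hget x hx
        exact (hτ x r hr).2.1
      inj := hinj
      surj := fun v w h => by
        obtain ⟨r, hr, he⟩ := List.mem_map.1 ((hes.2 s(v, w)).2 h)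
        obtain ⟨x, hx⟩ := List.mem_iff_getElem?.1 hr
        exact ⟨x, r, hx, he⟩ }
  refine ⟨hM, fun x hx => ?_, fun x hx => ?_, fun x hx => ?_, fun x hx => ?_, fun x hx => ?_,
    fun x hx y hy h => ?_⟩ <;> obtain ⟨r, hr⟩ := hget x hx
  · rw [hM.p_eq x r hr]
    exact ⟨by omega, r.1.isLt⟩
  · rw [hM.q_eq x r hr]
    exact ⟨by omega, r.2.isLt⟩
  · rw [hM.p_eq x r hr, hM.q_eq x r hr]
    intro h
    exact (hM.adj x r hr).ne (Fin.ext (by omega))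
  · exact (hτ x r hr).2.2.1
  · exact (hτ x r hr).2.2.2
  · obtain ⟨r', hr'⟩ := hget y hy
    rw [hM.p_eq x r hr, hM.q_eq x r hr, hM.p_eq y r' hr', hM.q_eq y r' hr'] at h
    refine hinj x r y r' hr hr' (Sym2.eq_iff.2 (h.imp (fun h => ?_) fun h => ?_)) <;>
    exact ⟨Fin.ext (by omega), Fin.ext (by omega)⟩

/-- The edges with the numbers in `l`. -/
def edgeList (es : List (Fin n × Fin n)) (l : List ℕ) : List (Fin n × Fin n) :=
  l.filterMap (es[·]?)

/-- The set of the edges with the numbers in `l`. -/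
def edgesOf (es : List (Fin n × Fin n)) (l : List ℕ) : Finset (Sym2 (Fin n)) :=
  ((edgeList es l).map fun p => s(p.1, p.2)).toFinset

variable {S : GraphSequence n tmax} {es : List (Fin n × Fin n)} {X : Input} {a b : ℕ}
  {l : List ℕ} {e : Sym2 (Fin n)} {U U' : Finset ℕ} {K : Finset (Sym2 (Fin n))}

theorem mem_edgesOf : e ∈ edgesOf es l ↔ ∃ x ∈ l, ∃ r : Fin n × Fin n, es[x]? = some r ∧ s(r.1, r.2) = e := by
  simp only [edgesOf, edgeList, List.mem_toFinset, List.mem_map, List.mem_filterMap]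
  constructor
  · rintro ⟨r, ⟨x, hx, hr⟩, he⟩
    exact ⟨x, hx, r, hr, he⟩
  · rintro ⟨x, hx, r, hr, he⟩
    exact ⟨r, ⟨x, hx, hr⟩, he⟩

theorem mem_activeSet {F : Finset (Sym2 (Fin n))} {t : ℕ} :
    t ∈ S.activeSet F ↔ (1 ≤ t ∧ t ≤ tmax) ∧ ∀ e ∈ F, t ∈ S.τ e := by
  simp [activeSet]

/-! ### Closed active cliques as maximal cliques of the graphs of active edges. -/

namespace Models

variable (hM : Models S es X) (hX : X.Valid)

include hM

theorem joined_iff {v w : Fin n} : X.Joined a b (v + 1) (w + 1) ↔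
    ∃ (x : ℕ) (r : Fin n × Fin n), es[x]? = some r ∧ s(r.1, r.2) = s(v, w) ∧ X.Act a b x := by
  constructor
  · rintro ⟨x, hx, ha, h⟩
    obtain ⟨r, hr⟩ := hM.get x hx
    rw [hM.p_eq x r hr, hM.q_eq x r hr] at h
    refine ⟨x, r, hr, Sym2.eq_iff.2 (h.imp (fun h => ?_) fun h => ?_), ha⟩ <;>
    exact ⟨Fin.ext (by omega), Fin.ext (by omega)⟩
  · rintro ⟨x, r, hr, he, ha⟩
    refine ⟨x, hM.lt x r hr, ha, ?_⟩
    rw [hM.p_eq x r hr, hM.q_eq x r hr]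
    refine (Sym2.eq_iff.1 he).imp (fun h => ?_) fun h => ?_ <;> rw [h.1, h.2] <;> exact ⟨rfl, rfl⟩

theorem mem_edgesOf_inner {x : ℕ} {r : Fin n × Fin n} (hr : es[x]? = some r) :
    s(r.1, r.2) ∈ edgesOf es (X.inner a b U) ↔ X.Inside a b U x := by
  rw [mem_edgesOf]
  constructor
  · rintro ⟨y, hy, r', hr', he⟩
    rw [← hM.inj y r' x r hr' hr he]
    exact (Input.mem_inner.1 hy).2
  · exact fun h => ⟨x, Input.mem_inner.2 ⟨hM.lt x r hr, h⟩, r, hr, rfl⟩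

/-- `inner` lists indices in their natural order and no edge has two indices, so the list is
determined by its set of edges. -/
theorem inner_eq_of_edgesOf_eq {a' b' : ℕ}
    (h : edgesOf es (X.inner a b U) = edgesOf es (X.inner a' b' U')) :
    X.inner a b U = X.inner a' b' U' := by
  classical
  refine List.filter_congr fun x hx => ?_
  obtain ⟨r, hr⟩ := hM.get x (List.mem_range.1 hx)
  simp only [decide_eq_decide]
  rw [← hM.mem_edgesOf_inner hr, h, hM.mem_edgesOf_inner hr]

theorem act_of_mem_τ {x : ℕ} {r : Fin n × Fin n} (hr : es[x]? = some r)
    (ha : a ∈ S.τ s(r.1, r.2)) (hb : b ∈ S.τ s(r.1, r.2)) : X.Act a b x := by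
  rw [hM.τ_eq x r hr, mem_Icc] at ha hb
  exact ⟨ha.1, hb.2⟩

theorem mem_τ_of_act {x t : ℕ} {r : Fin n × Fin n} (hr : es[x]? = some r) (h : X.Act a b x)
    (ha : a ≤ t) (hb : t ≤ b) : t ∈ S.τ s(r.1, r.2) := by
  rw [hM.τ_eq x r hr, mem_Icc]
  exact ⟨h.1.trans ha, hb.trans h.2⟩

include hX

/-- A larger clique `K'` with the same time set has all its edges active during `[a,b]`. One of its
new edges has an end outside `U`, and this end is joined to every vertex of `U`, against the
maximality of `U`. -/
theorem isClosedActiveClique (ha : 1 ≤ a) (hab : a ≤ b) (hb : b ≤ tmax)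
    (hU : X.IsMaxClique a b U) : S.IsClosedActiveClique (edgesOf es (X.inner a b U)) := by
  have hact : ∀ t, a ≤ t → t ≤ b → t ∈ S.activeSet (edgesOf es (X.inner a b U)) := by
    intro t hat htb
    refine mem_activeSet.2 ⟨⟨by omega, by omega⟩, fun e he => ?_⟩
    obtain ⟨x, hx, r, hr, rfl⟩ := mem_edgesOf.1 he
    exact hM.mem_τ_of_act hr (Input.mem_inner.1 hx).2.1 hat htb
  refine ⟨⟨{v | v.val + 1 ∈ U}, fun v hv w hw hvw => ?_, fun e => ⟨fun he => ?_, fun he => ?_⟩⟩,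
    ⟨a, hact a le_rfl hab⟩, ?_⟩
  · obtain ⟨x, r, hr, he, -⟩ := hM.joined_iff.1
      (hU.clique _ hv _ hw fun h => hvw (Fin.ext (by omega)))
    have : s(r.1, r.2) ∈ S.graph.edgeSet := hM.adj x r hr
    rwa [he] at this
  · obtain ⟨x, hx, r, hr, rfl⟩ := mem_edgesOf.1 he
    refine ⟨hM.adj x r hr, fun v hv => ?_⟩
    have h := (Input.mem_inner.1 hx).2.2
    rw [hM.p_eq x r hr, hM.q_eq x r hr] at h
    rcases Sym2.mem_iff.1 hv with rfl | rfl
    exacts [h.1, h.2]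
  · obtain ⟨he, hv⟩ := he
    induction e using Sym2.ind with
    | _ v w =>
      have hvU : v.val + 1 ∈ U := hv v (Sym2.mem_mk_left v w)
      have hwU : w.val + 1 ∈ U := hv w (Sym2.mem_mk_right v w)
      have hne : v ≠ w := S.graph.ne_of_adj he
      obtain ⟨x, r, hr, he', ha'⟩ := hM.joined_iff.1
        (hU.clique _ hvU _ hwU fun h => hne (Fin.ext (by omega)))
      rw [← he', hM.mem_edgesOf_inner hr]
      refine ⟨ha', ?_⟩
      rw [hM.p_eq x r hr, hM.q_eq x r hr]
      rcases Sym2.eq_iff.1 he' with h | h <;> rw [h.1, h.2]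
      exacts [⟨hvU, hwU⟩, ⟨hwU, hvU⟩]
  · rintro K' ⟨V', hV', hK'⟩ hss heq
    -- An edge active at both `a` and `b` is active throughout, because its time set is an interval.
    have hact' : ∀ (x : ℕ) (r : Fin n × Fin n), es[x]? = some r → s(r.1, r.2) ∈ K' → X.Act a b x := by
      intro x r hr he
      have h1 := hact a le_rfl hab
      have h2 := hact b hab le_rfl
      rw [heq, mem_activeSet] at h1 h2
      exact hM.act_of_mem_τ hr (h1.2 _ he) (h2.2 _ he)
    -- Inclusion of edge sets gives inclusion of vertex sets, since each vertex of `U` lies on an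
    -- edge inside `U`.
    have hsub : ∀ v : Fin n, v.val + 1 ∈ U → v ∈ V' := by
      intro v hv
      obtain ⟨x, hx, h⟩ := (hU.mem_iff hX).1 hv
      obtain ⟨r, hr⟩ := hM.get x (Input.mem_inner.1 hx).1
      have hxK' := ((hK' _).1 (hss.1 (mem_edgesOf.2 ⟨x, hx, r, hr, rfl⟩))).2
      rw [hM.p_eq x r hr, hM.q_eq x r hr] at h
      rcases h with h | h
      · obtain rfl : r.1 = v := Fin.ext (by omega)
        exact hxK' _ (Sym2.mem_mk_left _ _)
      · obtain rfl : r.2 = v := Fin.ext (by omega)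
        exact hxK' _ (Sym2.mem_mk_right _ _)
    obtain ⟨e, heK', heK⟩ := exists_of_ssubset hss
    obtain ⟨heG, heV'⟩ := (hK' e).1 heK'
    obtain ⟨x, r, hr, rfl⟩ : ∃ (x : ℕ) (r : Fin n × Fin n), es[x]? = some r ∧ s(r.1, r.2) = e := by
      induction e using Sym2.ind with
      | _ v w => exact hM.surj v w heG
    have hxa := hact' x r hr heK'
    have hz : ∃ z ∈ s(r.1, r.2), z.val + 1 ∉ U := by
      by_contra! hc
      refine heK ((hM.mem_edgesOf_inner hr).2 ⟨hxa, ?_, ?_⟩)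
      · rw [hM.p_eq x r hr]
        exact hc _ (Sym2.mem_mk_left _ _)
      · rw [hM.q_eq x r hr]
        exact hc _ (Sym2.mem_mk_right _ _)
    obtain ⟨z, hze, hzU⟩ := hz
    have hzact : z.val + 1 ∈ X.actEnds a b X.m := by
      refine ⟨x, hM.lt x r hr, hxa, ?_⟩
      rw [hM.p_eq x r hr, hM.q_eq x r hr]
      rcases Sym2.mem_iff.1 hze with rfl | rfl
      exacts [.inl rfl, .inr rfl]
    obtain ⟨u, hu, hn⟩ := hU.maximal _ hzact hzU
    obtain ⟨h1, h2⟩ : 1 ≤ u ∧ ∃ v : Fin n, v.val + 1 = u := by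
      obtain ⟨y, hy, h⟩ := (hU.mem_iff hX).1 hu
      obtain ⟨r', hr'⟩ := hM.get y (Input.mem_inner.1 hy).1
      rw [hM.p_eq y r' hr', hM.q_eq y r' hr'] at h
      rcases h with rfl | rfl
      exacts [⟨by omega, _, rfl⟩, ⟨by omega, _, rfl⟩]
    obtain ⟨v, rfl⟩ := h2
    have hzv : z ≠ v := fun h => hzU (h ▸ hu)
    have hadj : S.graph.Adj z v := hV' (heV' z hze) (hsub v hu) hzv
    obtain ⟨y, r', hr', he'⟩ := hM.surj z v hadj
    refine hn (hM.joined_iff.2 ⟨y, r', hr', he', hact' y r' hr' ((hK' _).2 ⟨hM.adj y r' hr', ?_⟩)⟩)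
    rw [he']
    intro w hw
    rcases Sym2.mem_iff.1 hw with rfl | rfl
    exacts [heV' _ hze, hsub _ hu]

omit hX in
-- The interval is the time set of `K`, from the largest first stamp to the smallest last stamp. A
-- vertex joined to all of `K` during this interval would enlarge `K` without changing the time set,
-- so closedness gives maximality.
theorem exists_out (hK : S.IsClosedActiveClique K) (hne : K.Nonempty) :
    ∃ i < X.m, ∃ j < X.m, ∃ l, X.Out i j l ∧ edgesOf es l = K := by
  classical
  obtain ⟨⟨V, hV, hKV⟩, ⟨t₀, ht₀⟩, hcl⟩ := hK
  rw [mem_activeSet] at ht₀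
  have hedge : ∀ e ∈ K, ∃ (x : ℕ) (r : Fin n × Fin n), es[x]? = some r ∧ s(r.1, r.2) = e := by
    intro e he
    have := ((hKV e).1 he).1
    induction e using Sym2.ind with
    | _ v w => exact hM.surj v w this
  let inK : ℕ → Prop := fun x => ∃ r : Fin n × Fin n, es[x]? = some r ∧ s(r.1, r.2) ∈ K
  set J : Finset ℕ := (range X.m).filter inK with hJ
  have memJ : ∀ {x}, x ∈ J ↔ inK x := by
    intro x
    rw [hJ, mem_filter, mem_range]
    exact and_iff_right_of_imp fun ⟨r, hr, _⟩ => hM.lt x r hr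
  have hJne : J.Nonempty := by
    obtain ⟨e, he⟩ := hne
    obtain ⟨x, r, hr, rfl⟩ := hedge e he
    exact ⟨x, memJ.2 ⟨r, hr, he⟩⟩
  obtain ⟨i₀, hi₀, hmax⟩ := exists_max_image J X.s hJne
  obtain ⟨j₀, hj₀, hmin⟩ := exists_min_image J X.t hJne
  -- Among the edges attaining the extreme stamp the last index is taken, as `Chosen` demands.
  obtain ⟨i, hi, hil⟩ := exists_max_image (J.filter fun x => X.s x = X.s i₀) id
    ⟨i₀, mem_filter.2 ⟨hi₀, rfl⟩⟩
  obtain ⟨j, hj, hjl⟩ := exists_max_image (J.filter fun x => X.t x = X.t j₀) id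
    ⟨j₀, mem_filter.2 ⟨hj₀, rfl⟩⟩
  obtain ⟨hiJ, hia⟩ := mem_filter.1 hi
  obtain ⟨hjJ, hjb⟩ := mem_filter.1 hj
  rw [← hia] at hmax
  rw [← hjb] at hmin
  have hJm : ∀ {x}, x ∈ J → x < X.m := fun hx => mem_range.1 (mem_filter.1 hx).1
  have hJt : ∀ x ∈ J, X.s x ≤ t₀ ∧ t₀ ≤ X.t x := by
    intro x hx
    obtain ⟨r, hr, he⟩ := memJ.1 hx
    have := ht₀.2 _ he
    rwa [hM.τ_eq x r hr, mem_Icc] at this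
  have hab : X.s i ≤ X.t j := (hJt i hiJ).1.trans (hJt j hjJ).2
  have hJact : ∀ x ∈ J, X.Act (X.s i) (X.t j) x := fun x hx => ⟨hmax x hx, hmin x hx⟩
  have hactive : ∀ t ∈ S.activeSet K, X.s i ≤ t ∧ t ≤ X.t j := by
    intro t ht
    rw [mem_activeSet] at ht
    obtain ⟨r, hr, he⟩ := memJ.1 hiJ
    obtain ⟨r', hr', he'⟩ := memJ.1 hjJ
    have h1 := ht.2 _ he
    have h2 := ht.2 _ he'
    rw [hM.τ_eq i r hr, mem_Icc] at h1
    rw [hM.τ_eq j r' hr', mem_Icc] at h2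
    exact ⟨h1.1, h2.2⟩
  set U : Finset ℕ := J.image X.p ∪ J.image X.q with hU
  have memU : ∀ {u}, u ∈ U ↔ ∃ x ∈ J, X.p x = u ∨ X.q x = u := by
    intro u
    simp only [hU, mem_union, mem_image]
    constructor
    · rintro (⟨x, hx, h⟩ | ⟨x, hx, h⟩)
      exacts [⟨x, hx, .inl h⟩, ⟨x, hx, .inr h⟩]
    · rintro ⟨x, hx, h | h⟩
      exacts [.inl ⟨x, hx, h⟩, .inr ⟨x, hx, h⟩]
  have hUV : ∀ v : Fin n, v.val + 1 ∈ U → v ∈ V := by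
    intro v hv
    obtain ⟨x, hx, h⟩ := memU.1 hv
    obtain ⟨r, hr, he⟩ := memJ.1 hx
    have hxV := ((hKV _).1 he).2
    rw [hM.p_eq x r hr, hM.q_eq x r hr] at h
    rcases h with h | h
    · obtain rfl : r.1 = v := Fin.ext (by omega)
      exact hxV _ (Sym2.mem_mk_left _ _)
    · obtain rfl : r.2 = v := Fin.ext (by omega)
      exact hxV _ (Sym2.mem_mk_right _ _)
  have hUlab : ∀ u ∈ U, ∃ v : Fin n, v.val + 1 = u := by
    intro u hu
    obtain ⟨x, hx, h⟩ := memU.1 hu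
    obtain ⟨r, hr, he⟩ := memJ.1 hx
    rw [hM.p_eq x r hr, hM.q_eq x r hr] at h
    rcases h with h | h
    exacts [⟨_, h⟩, ⟨_, h⟩]
  have hUK : ∀ (x : ℕ) (r : Fin n × Fin n), es[x]? = some r → r.1.val + 1 ∈ U → r.2.val + 1 ∈ U → s(r.1, r.2) ∈ K := by
    intro x r hr h1 h2
    refine (hKV _).2 ⟨hM.adj x r hr, fun v hv => ?_⟩
    rcases Sym2.mem_iff.1 hv with rfl | rfl
    exacts [hUV _ h1, hUV _ h2]
  have hinside : ∀ x < X.m, X.Inside (X.s i) (X.t j) U x ↔ x ∈ J := by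
    intro x hx
    obtain ⟨r, hr⟩ := hM.get x hx
    constructor
    · rintro ⟨-, h1, h2⟩
      rw [hM.p_eq x r hr] at h1
      rw [hM.q_eq x r hr] at h2
      exact memJ.2 ⟨r, hr, hUK x r hr h1 h2⟩
    · exact fun h => ⟨hJact x h, memU.2 ⟨x, h, .inl rfl⟩, memU.2 ⟨x, h, .inr rfl⟩⟩
  have hclique : ∀ u ∈ U, ∀ v ∈ U, u ≠ v → X.Joined (X.s i) (X.t j) u v := by
    intro u hu v hv huv
    obtain ⟨u, rfl⟩ := hUlab u hu
    obtain ⟨v, rfl⟩ := hUlab v hv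
    have hadj : S.graph.Adj u v := hV (hUV u hu) (hUV v hv) fun h => huv (by rw [h])
    obtain ⟨x, r, hr, he⟩ := hM.surj u v hadj
    have hxK : s(r.1, r.2) ∈ K := by
      rcases Sym2.eq_iff.1 he with h | h
      · exact hUK x r hr (h.1 ▸ hu) (h.2 ▸ hv)
      · exact hUK x r hr (h.1 ▸ hv) (h.2 ▸ hu)
    exact hM.joined_iff.2 ⟨x, r, hr, he, hJact x (memJ.2 ⟨r, hr, hxK⟩)⟩
  have hUmax : X.IsMaxClique (X.s i) (X.t j) U := by
    refine ⟨fun u hu => ?_, hclique, fun w hw hwU => ?_⟩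
    · obtain ⟨x, hx, h⟩ := memU.1 hu
      exact ⟨x, hJm hx, hJact x hx, h⟩
    · by_contra! hc
      obtain ⟨z, rfl⟩ : ∃ z : Fin n, z.val + 1 = w := by
        obtain ⟨x, hx, -, h⟩ := hw
        obtain ⟨r, hr⟩ := hM.get x hx
        rw [hM.p_eq x r hr, hM.q_eq x r hr] at h
        rcases h with h | h
        exacts [⟨_, h⟩, ⟨_, h⟩]
      set U' := insert (z.val + 1) U with hU'
      have hclique' : ∀ u ∈ U', ∀ v ∈ U', u ≠ v → X.Joined (X.s i) (X.t j) u v := by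
        intro u hu v hv huv
        rcases mem_insert.1 hu with hu | hu <;> rcases mem_insert.1 hv with hv | hv
        · omega
        · exact hu ▸ hc v hv
        · exact hv ▸ (hc u hu).symm
        · exact hclique u hu v hv huv
      let V' : Set (Fin n) := {v | v.val + 1 ∈ U'}
      let K' : Finset (Sym2 (Fin n)) :=
        univ.filter fun e => e ∈ S.graph.edgeSet ∧ ∀ v ∈ e, v ∈ V'
      have hK' : S.IsCliqueEdgeSet K' := by
        refine ⟨V', fun v hv w hw hvw => ?_, fun e => by simp [K']⟩
        obtain ⟨x, r, hr, he, -⟩ := hM.joined_iff.1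
          (hclique' _ hv _ hw fun h => hvw (Fin.ext (by omega)))
        have : s(r.1, r.2) ∈ S.graph.edgeSet := hM.adj x r hr
        rwa [he] at this
      have hsub : K ⊆ K' := by
        intro e he
        obtain ⟨x, r, hr, rfl⟩ := hedge e he
        have hx : x ∈ J := memJ.2 ⟨r, hr, he⟩
        refine mem_filter.2 ⟨mem_univ _, hM.adj x r hr, fun v hv => mem_insert_of_mem (memU.2
          ⟨x, hx, ?_⟩)⟩
        rw [hM.p_eq x r hr, hM.q_eq x r hr]
        rcases Sym2.mem_iff.1 hv with rfl | rfl
        exacts [.inl rfl, .inr rfl]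
      -- The inclusion is strict because of the edge from `z` to an end of some edge of `K`; this is
      -- where `K` must be non-empty.
      have hss : K ⊂ K' := by
        refine (ssubset_iff_of_subset hsub).2 ?_
        obtain ⟨x, hx⟩ := hJne
        have hp : X.p x ∈ U := memU.2 ⟨x, hx, .inl rfl⟩
        obtain ⟨u, hu⟩ := hUlab _ hp
        rw [← hu] at hp
        obtain ⟨y, r, hr, he, -⟩ := hM.joined_iff.1 (hc _ hp)
        refine ⟨s(z, u), mem_filter.2 ⟨mem_univ _, he ▸ hM.adj y r hr, fun v hv => ?_⟩, fun h => ?_⟩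
        · rcases Sym2.mem_iff.1 hv with h | h
          exacts [h ▸ mem_insert_self (z.val + 1) U, h ▸ mem_insert_of_mem hp]
        · rw [← he] at h
          refine hwU (memU.2 ⟨y, memJ.2 ⟨r, hr, h⟩, ?_⟩)
          rw [hM.p_eq y r hr, hM.q_eq y r hr]
          rcases Sym2.eq_iff.1 he with h | h <;> rw [h.1, h.2]
          exacts [.inl rfl, .inr rfl]
      refine hcl K' hK' hss (Subset.antisymm (fun t ht => ?_) fun t ht => ?_)
      · refine mem_activeSet.2 ⟨(mem_activeSet.1 ht).1, fun e he => ?_⟩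
        obtain ⟨-, heG, heV⟩ := mem_filter.1 he
        induction e using Sym2.ind with
        | _ v w =>
          have hne : v ≠ w := S.graph.ne_of_adj heG
          obtain ⟨x, r, hr, he', ha⟩ := hM.joined_iff.1 (hclique' _ (heV v (Sym2.mem_mk_left _ _)) _
            (heV w (Sym2.mem_mk_right _ _)) fun h => hne (Fin.ext (by omega)))
          rw [← he']
          exact hM.mem_τ_of_act hr ha (hactive t ht).1 (hactive t ht).2
      · rw [mem_activeSet] at ht ⊢
        exact ⟨ht.1, fun e he => ht.2 e (hsub he)⟩
  refine ⟨i, hJm hiJ, j, hJm hjJ, X.inner (X.s i) (X.t j) U, ⟨hab, U, hUmax, ⟨⟨?_, ?_⟩, ?_, ?_⟩,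
    rfl⟩, ?_⟩
  · exact ⟨hJm hiJ, (hinside i (hJm hiJ)).2 hiJ, rfl⟩
  · rintro x ⟨hx, hin, hs⟩
    exact hil x (mem_filter.2 ⟨(hinside x hx).1 hin, hs.trans hia⟩)
  · exact ⟨hJm hjJ, (hinside j (hJm hjJ)).2 hjJ, rfl⟩
  · rintro x ⟨hx, hin, ht⟩
    exact hjl x (mem_filter.2 ⟨(hinside x hx).1 hin, ht.trans hjb⟩)
  · ext e
    rw [mem_edgesOf]
    constructor
    · rintro ⟨x, hx, r, hr, rfl⟩
      obtain ⟨hxm, hin⟩ := Input.mem_inner.1 hx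
      obtain ⟨r', hr', he⟩ := memJ.1 ((hinside x hxm).1 hin)
      rw [hr] at hr'
      cases hr'
      exact he
    · intro he
      obtain ⟨x, r, hr, rfl⟩ := hedge e he
      exact ⟨x, Input.mem_inner.2 ⟨hM.lt x r hr, (hinside x (hM.lt x r hr)).2
        (memJ.2 ⟨r, hr, he⟩)⟩, r, hr, rfl⟩

/-- An edge active at all times is itself a larger clique with the full time set. Conversely, every
edge of a non-empty clique with the full time set is active at 1 and at `tmax`, hence always. -/
theorem isClosedActiveClique_empty_iff (hT : 1 ≤ tmax) : S.IsClosedActiveClique ∅ ↔ X.NoFull := by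
  classical
  have hempty : ∀ t, t ∈ S.activeSet ∅ ↔ 1 ≤ t ∧ t ≤ tmax := fun t => by simp [mem_activeSet]
  constructor
  · rintro ⟨-, -, h⟩ x hx ⟨hs, ht⟩
    obtain ⟨r, hr⟩ := hM.get x hx
    refine h {s(r.1, r.2)} ⟨{r.1, r.2}, ?_, fun e => ?_⟩ (by simp) ?_
    · have h1 := hM.adj x r hr
      rintro v (rfl | rfl) w (rfl | rfl) hvw
      exacts [absurd rfl hvw, h1, h1.symm, absurd rfl hvw]
    · rw [mem_singleton]
      constructor
      · rintro rfl
        exact ⟨hM.adj x r hr, fun v hv => Sym2.mem_iff.1 hv⟩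
      · rintro ⟨he, hv⟩
        induction e using Sym2.ind with
        | _ v w =>
          have hne : v ≠ w := S.graph.ne_of_adj he
          rcases hv v (Sym2.mem_mk_left _ _) with rfl | rfl <;>
            rcases hv w (Sym2.mem_mk_right _ _) with h | h
          · exact absurd h.symm hne
          · rw [h]
          · rw [h]
            exact Sym2.eq_swap
          · exact absurd h.symm hne
    · ext t
      rw [hempty, mem_activeSet]
      refine ⟨fun h => ⟨h, fun e he => ?_⟩, fun h => h.1⟩
      rw [mem_singleton.1 he, hM.τ_eq x r hr, hs, ht, hM.T_eq, mem_Icc]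
      exact h
  · intro h
    refine ⟨⟨∅, by simp, fun e => ?_⟩, ⟨1, (hempty 1).2 ⟨le_rfl, hT⟩⟩, ?_⟩
    · simp only [notMem_empty, false_iff, not_and]
      intro _ hc
      induction e using Sym2.ind with
      | _ v w => exact hc v (Sym2.mem_mk_left _ _)
    · rintro K' ⟨V, -, hV⟩ hss heq
      obtain ⟨e, he, -⟩ := exists_of_ssubset hss
      have heG := ((hV e).1 he).1
      obtain ⟨x, r, hr, rfl⟩ : ∃ (x : ℕ) (r : Fin n × Fin n), es[x]? = some r ∧ s(r.1, r.2) = e := by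
        induction e using Sym2.ind with
        | _ v w => exact hM.surj v w heG
      have h1 := (hempty 1).2 ⟨le_rfl, hT⟩
      have h2 := (hempty tmax).2 ⟨hT, le_rfl⟩
      rw [heq, mem_activeSet] at h1 h2
      have := hM.act_of_mem_τ hr (h1.2 _ he) (h2.2 _ he)
      have hxm := hM.lt x r hr
      have := hM.one_le x hxm
      have := hX.le_T x hxm
      have := hM.T_eq
      refine h x hxm ⟨?_, ?_⟩ <;> · simp only [Input.Act] at *; omega

end Models

/-- Take an inclusion-maximal clique among those with the full time set; the empty clique is one of
them. Positivity lets the factor `N` in the bound absorb the fixed costs. -/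
theorem one_le_numClosedActiveCliques (S : GraphSequence n tmax) (hT : 1 ≤ tmax) :
    1 ≤ S.numClosedActiveCliques := by
  let A : Set (Finset (Sym2 (Fin n))) :=
    {K | S.IsCliqueEdgeSet K ∧ S.activeSet K = S.activeSet ∅}
  have hA : A.Nonempty := by
    refine ⟨∅, ⟨∅, by simp, fun e => ?_⟩, rfl⟩
    simp only [notMem_empty, false_iff, not_and]
    intro _ hc
    induction e using Sym2.ind with
    | _ v w => exact hc v (Sym2.mem_mk_left _ _)
  obtain ⟨K, ⟨hK, hKA⟩, hmax⟩ := (Set.toFinite A).exists_maximal hA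
  have h1 : 1 ∈ S.activeSet K := by
    rw [hKA, mem_activeSet]
    simp [hT]
  refine (Set.ncard_pos (Set.toFinite _)).2 ⟨K, hK, ⟨1, h1⟩, fun K' hK' hss heq => ?_⟩
  exact hss.2 (hmax ⟨hK', heq.symm.trans hKA⟩ hss.1)

end GraphSequence

/-! ### Output words, and the number of maximal cliques for one interval. -/

namespace GraphSequence

open Finset CliqueTree

variable {n tmax : ℕ} {S : GraphSequence n tmax} {es : List (Fin n × Fin n)} {X : Input}

theorem IsEdgeList.length_eq (hes : S.IsEdgeList es) : es.length = S.numEdges := by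
  have : S.graph.edgeSet = ((es.map fun p => s(p.1, p.2)).toFinset : Set (Sym2 (Fin n))) := by
    ext e
    rw [mem_coe, List.mem_toFinset]
    exact (hes.2 e).symm
  rw [numEdges, this, Set.ncard_coe_finset, List.toFinset_card_of_nodup hes.1, List.length_map]

theorem IsEdgeList.nodup_edgeList (hes : S.IsEdgeList es) {l : List ℕ} (hl : l.Nodup) :
    ((edgeList es l).map fun p => s(p.1, p.2)).Nodup := by
  have hnd : es.Nodup := hes.1.of_map
  refine (List.nodup_map_iff_inj_on (hl.filterMap fun x y r hx hy => ?_)).2 fun r hr r' hr' h => ?_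
  · have hlt : x < es.length := by
      by_contra hc
      rw [List.getElem?_eq_none (by omega)] at hx
      cases hx
    exact (List.getElem?_inj hlt hnd).1 (Eq.trans hx (Eq.symm hy))
  · obtain ⟨x, -, hx⟩ := List.mem_filterMap.1 hr
    obtain ⟨y, -, hy⟩ := List.mem_filterMap.1 hr'
    exact List.inj_on_of_nodup_map hes.1 (List.mem_of_getElem? hx) (List.mem_of_getElem? hy) h

theorem Models.enc_eq (hM : Models S es X) {l : List ℕ} (hl : ∀ x ∈ l, x < X.m) :
    X.enc l = encodeEdges (edgeList es l) := by
  rw [Input.enc, encodeEdges]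
  congr 1
  induction l with
  | nil => rfl
  | cons x l ih =>
    obtain ⟨r, hr⟩ := hM.get x (hl x (by simp))
    rw [List.flatMap_cons, ih fun y hy => hl y (by simp [hy]), edgeList, edgeList,
      List.filterMap_cons_some hr, List.flatMap_cons, hM.p_eq x r hr, hM.q_eq x r hr]

/-- The amortisation: the maximal cliques for one interval map injectively to closed active cliques,
so the work for a single pair can be charged to `N`, whichever of them this pair prints. -/
theorem Models.length_le (hM : Models S es X) (hX : X.Valid) {a b : ℕ} (ha : 1 ≤ a) (hab : a ≤ b)
    (hb : b ≤ tmax) {Us : List (Finset ℕ)} (hnd : Us.Nodup)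
    (hU : ∀ U ∈ Us, X.IsMaxClique a b U) : Us.length ≤ S.numClosedActiveCliques := by
  classical
  have hnd' : (Us.map fun U => edgesOf es (X.inner a b U)).Nodup :=
    (List.nodup_map_iff_inj_on hnd).2 fun U h U' h' he =>
      (hU U h).eq_of_inner_eq hX (hU U' h') (hM.inner_eq_of_edgesOf_eq he)
  rw [numClosedActiveCliques, ← List.length_map fun U => edgesOf es (X.inner a b U),
    ← List.toFinset_card_of_nodup hnd', ← Set.ncard_coe_finset]
  refine Set.ncard_le_ncard (fun K hK => ?_) (Set.toFinite _)
  obtain ⟨U, h, rfl⟩ := List.mem_map.1 (List.mem_toFinset.1 hK)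
  exact hM.isClosedActiveClique hX ha hab hb (hU U h)

open Classical in
-- Each list printed for a pair contains the edge `i` and is thus non-empty. So it cannot coincide
-- with the separately printed empty clique, and the two kinds of cliques can be treated apart.
theorem Models.outputCorrect (hM : Models S es X) (hX : X.Valid) (hes : S.IsEdgeList es)
    (hT : 1 ≤ tmax) {L : List (List ℕ)} (hL : L.Nodup)
    (hmem : ∀ l, l ∈ L ↔ ∃ i < X.m, ∃ j < X.m, X.Out i j l) :
    S.OutputCorrect ((if X.NoFull then [0] else []) ++ L.flatMap X.enc) := by
  have hlt : ∀ l ∈ L, ∀ x ∈ l, x < X.m := by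
    intro l hl x hx
    obtain ⟨i, hi, j, hj, -, U, -, -, rfl⟩ := (hmem l).1 hl
    exact (Input.mem_inner.1 hx).1
  have hne : ∀ l ∈ L, ((edgeList es l).map fun p => s(p.1, p.2)).toFinset.Nonempty := by
    intro l hl
    obtain ⟨i, hi, j, hj, -, U, -, hch, rfl⟩ := (hmem l).1 hl
    obtain ⟨r, hr⟩ := hM.get i hi
    exact ⟨s(r.1, r.2), mem_edgesOf.2 ⟨i, Input.mem_inner.2 ⟨hi, hch.1.1.2.1⟩, r, hr, rfl⟩⟩
  have hinj : ∀ l ∈ L, ∀ l' ∈ L, edgesOf es l = edgesOf es l' → l = l' := by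
    intro l hl l' hl' h
    obtain ⟨i, hi, j, hj, -, U, -, -, rfl⟩ := (hmem l).1 hl
    obtain ⟨i', hi', j', hj', -, U', -, -, rfl⟩ := (hmem l').1 hl'
    exact hM.inner_eq_of_edgesOf_eq h
  have hclosed : ∀ K, K.Nonempty → ((∃ l ∈ L, edgesOf es l = K) ↔ S.IsClosedActiveClique K) := by
    intro K hK
    constructor
    · rintro ⟨l, hl, rfl⟩
      obtain ⟨i, hi, j, hj, hab, U, hU, -, rfl⟩ := (hmem l).1 hl
      exact hM.isClosedActiveClique hX (hM.one_le i hi) hab ((hX.le_T j hj).trans_eq hM.T_eq) hU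
    · intro h
      obtain ⟨i, hi, j, hj, l, hl, he⟩ := hM.exists_out h hK
      exact ⟨l, (hmem l).2 ⟨i, hi, j, hj, hl⟩, he⟩
  have hnd : ((L.map (edgeList es)).map fun r =>
      (r.map fun p => s(p.1, p.2)).toFinset).Nodup := by
    rw [List.map_map]
    exact (List.nodup_map_iff_inj_on hL).2 hinj
  have henc : L.flatMap X.enc = (L.map (edgeList es)).flatMap encodeEdges := by
    rw [List.flatMap_map]
    exact List.flatMap_congr fun l hl => hM.enc_eq (hlt l hl)
  refine ⟨(if X.NoFull then [[]] else []) ++ L.map (edgeList es), ?_, ?_, ?_, fun K => ?_⟩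
  · rw [List.flatMap_append, ← henc]
    split_ifs <;> simp [encodeEdges]
  · intro r hr
    rcases List.mem_append.1 hr with hr | hr
    · split_ifs at hr <;> simp at hr
      simp [hr]
    · obtain ⟨l, hl, rfl⟩ := List.mem_map.1 hr
      obtain ⟨i, hi, j, hj, -, U, -, -, rfl⟩ := (hmem l).1 hl
      exact hes.nodup_edgeList (List.nodup_range.filter _)
  · rw [List.map_append]
    split_ifs
    · refine List.nodup_append.2 ⟨by simp, hnd, ?_⟩
      rintro K hK K' hK' rfl
      simp only [List.map_cons, List.map_nil, List.mem_singleton] at hK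
      obtain ⟨r, hr, rfl⟩ := List.mem_map.1 hK'
      obtain ⟨l, hl, rfl⟩ := List.mem_map.1 hr
      have := hne l hl
      rw [hK] at this
      simp at this
    · simpa using hnd
  · have hR : K ∈ (L.map (edgeList es)).map (fun r => (r.map fun p => s(p.1, p.2)).toFinset) ↔
        ∃ l ∈ L, edgesOf es l = K := by
      rw [List.map_map, List.mem_map]
      rfl
    rw [List.map_append, List.mem_append, hR]
    rcases K.eq_empty_or_nonempty with rfl | hK
    · rw [hM.isClosedActiveClique_empty_iff hX hT]
      constructor
      · rintro (h | ⟨l, hl, h⟩)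
        · split_ifs at h with hf
          · exact hf
          · simp at h
        · have := hne l hl
          rw [edgesOf] at h
          rw [h] at this
          simp at this
      · intro h
        left
        simp [h]
    · rw [← hclosed K hK]
      refine ⟨fun h => h.elim (fun h => ?_) id, .inr⟩
      split_ifs at h
      · simp only [List.map_cons, List.map_nil, List.mem_singleton] at h
        rw [h] at hK
        simp at hK
      · simp at h

end GraphSequence

theorem mainTheorem6 :
    ∃ (P : WordRAM.Program) (C k : ℕ),
      ∀ (n tmax : ℕ), 1 ≤ tmax →
      ∀ (S : GraphSequence n tmax), S.IntervalAssumption →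
      ∀ (es : List (Fin n × Fin n)), S.IsEdgeList es →
        ∃ (t : ℕ) (σ : WordRAM.Config),
          WordRAM.Exec ((n + S.numEdges + tmax + 2) ^ k) P (S.inputConfig es) t σ ∧
          S.OutputCorrect σ.out ∧
          t ≤ C * max 1 (n * S.numEdges ^ 3) * S.numClosedActiveCliques := by
  -- The exponent 4 suffices because `1 ≤ tmax` makes the base `B` at least 3: every number handled
  -- is below a bound of the form `B² + 4B`, which is at most `9B² ≤ B⁴`.
  refine ⟨CliqueTree.enumerateClosed, 5000, 4, fun n tmax hT S hS es hes => ?_⟩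
  obtain ⟨hM, hX⟩ := GraphSequence.models_toInput hS hes
  have hmem : (S.toInput es).InMem (S.inputConfig es) := ⟨rfl, rfl, rfl, rfl, rfl, rfl⟩
  have hm : (S.toInput es).m = S.numEdges := hes.length_eq
  have hn : (S.toInput es).n = n := rfl
  have hW : (S.toInput es).n * (S.toInput es).n + 2 * (S.toInput es).n + 4 * (S.toInput es).m +
      (S.toInput es).T + 10 ≤ (n + S.numEdges + tmax + 2) ^ 4 := by
    rw [hm, hM.T_eq, hn]
    generalize hB : n + S.numEdges + tmax + 2 = B
    have h1 : n * n ≤ B * B := Nat.mul_le_mul (by omega) (by omega)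
    have h2 : 3 * B ≤ B * B := Nat.mul_le_mul_right B (by omega)
    have h3 : 9 * (B * B) ≤ B ^ 4 := by
      calc 9 * (B * B) ≤ (B * B) * (B * B) := Nat.mul_le_mul_right _ (by omega)
        _ = B ^ 4 := by ring
    omega
  obtain ⟨t, σ, hexec, ht, L, hL, hLmem, hout⟩ := CliqueTree.runs_enumerateClosed hX hmem hW
    (S.one_le_numClosedActiveCliques hT) fun i hi j hj hij Us hnd hU =>
      hM.length_le hX (hM.one_le i hi) hij ((hX.le_T j hj).trans_eq hM.T_eq) hnd hU
  refine ⟨t, σ, hexec, ?_, ?_⟩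
  · rw [hout, List.append_assoc]
    exact hM.outputCorrect hX hes hT hL hLmem
  · rwa [hm, hn] at ht
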